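/- Let $\mathcal A$ be an arrangement of $r$ distinct lines in $\mathbb P^2_{\mathbb C}$ with $3\mid r$, given by linear forms $L_1,\dots,L_r\in\mathbb C[x_1,x_2,x_3]$, and put $\omega=e^{2\pi i/3}$. A quasi-toric relation of type $(3,3,3)$ for $\mathcal A$ is a sextuple $(F_1,F_2,F_3,f,g,h)$ of nonzero homogeneous polynomials in $\mathbb C[x_1,x_2,x_3]$ with $F_1f^3+F_2g^3+F_3h^3=0$, such that each $F_i$ is constant or squarefree, the $F_i$ are pairwise without common factors, the zero set of $F_1F_2F_3$ is the union of the lines of $\mathcal A$, and $f,g,h$ have no non-constant common factor. Let $P_i$ be the product of those $L_j$ that divide $F_i$. The relation is called normalized if $F_i=aP_i$ $(i=1,2,3)$ for one constant $a\neq0$, that is, if the equations of the three curves are the ones given by the fixed linear forms, up to a common constant. Two relations $(F_i,f,g,h)$ and $(F_i',f',g',h')$ are equivalent if there are $\lambda,\lambda_f,\lambda_g,\lambda_h\in\mathbb C$ with $F_i=\lambda F_i'$ for $i=1,2,3$, $f=\lambda_ff'$, $g=\lambda_gg'$, $h=\lambda_hh'$, $\lambda_f/\lambda_h\in\mu_3$,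 $\lambda_g/\lambda_h\in\mu_3$ and $\lambda_f\lambda_g=\lambda_h^2$. Let $\bar M_{\mathcal A}$ be a nonsingular complete model, with a regular action of $\mathbb Z_3$, of the 3-fold cyclic cover of $\mathbb P^2$ branched over $\mathcal A$; its function field is $\mathbb C(x,y)[z]/(z^3-\prod_jL_j(x,y,1))$, and the generator of $\mathbb Z_3$ acts by $z\mapsto\omega z$. Let $E$ be the closure in $\mathbb P^2$ of the affine curve $c^3=s(1-s)$ (the elliptic curve with $j=0$), with the $\mathbb Z_3$-action $(s,c)\mapsto(s,\omega c)$. Then: (a) every quasi-toric relation can be normalized by moving constants: for each quasi-toric relation $(F_i,f,g,h)$ there is a normalized one $(F_i',f',g',h')$ such that $F_i'$ is a constant multiple of $F_i$ for each $i$, and $F_1'f'^3=F_1f^3$, $F_2'g'^3=F_2g^3$, $F_3'h'^3=F_3h^3$; (b) there is a bijection from the set of equivalence classes of normalized quasi-toric relations to the set of non-constant $\mathbb Z_3$-equivariant morphisms $\bar M_{\mathcal A}\to E$ over $\mathbb C$. It sends the class of $(F_1,F_2,F_3,f,g,h)$ to the morphism given at the generic point of $\bar M_{\mathcal A}$, after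 setting $(x_1,x_2,x_3)=(x,y,1)$, by $$s=-\frac{F_1}{F_3}\Big(\frac fh\Big)^3,\qquad c=C\,\frac{fg}{h^2},\qquad C=\frac z{P_3},\quad C^3=\frac{F_1F_2}{F_3^2}.$$ -/

import Mathlib

open AlgebraicGeometry CategoryTheory MvPolynomial

noncomputable section

/-! ## The elliptic curve with `j`-invariant zero

The curve `E` is the closure in the projective plane of the affine curve `c³ = s (1 - s)`, with
its `3`-fold cyclic covering `(s, c) ↦ s` of the projective line. The closure of
`{c³ = a b, a = s, b = 1 - s}` in projective `4`-space lies in the plane with coordinates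
`(s, c)`, so it is the same curve. -/

namespace EquianharmonicCurve

section

attribute [local instance] MvPolynomial.gradedAlgebra

/-- `c³ - s w (w - s)` in the variables `X 0 = s`, `X 1 = c`, `X 2 = w`. -/
def cubic : MvPolynomial (Fin 3) ℂ := X 1 ^ 3 - X 0 * X 2 * (X 2 - X 0)

/-- The ideal of the curve. -/
def ideal : Ideal (MvPolynomial (Fin 3) ℂ) := Ideal.span {cubic}

/-- The homogeneous coordinate ring `ℂ[s, c, w] / (c³ - s w (w - s))`. -/
abbrev CoordRing : Type := MvPolynomial (Fin 3) ℂ ⧸ ideal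

/-- The quotient map onto the homogeneous coordinate ring. -/
def proj : MvPolynomial (Fin 3) ℂ →ₐ[ℂ] CoordRing := Ideal.Quotient.mkₐ ℂ ideal

/-- The grading by degree: the classes of forms of degree `n`. -/
def grading (n : ℕ) : Submodule ℂ CoordRing :=
  (homogeneousSubmodule (Fin 3) ℂ n).map proj.toLinearMap

lemma cubic_isHomogeneous : cubic.IsHomogeneous 3 :=
  ((isHomogeneous_X ℂ (1 : Fin 3)).pow 3).sub
    (((isHomogeneous_X ℂ (0 : Fin 3)).mul (isHomogeneous_X ℂ (2 : Fin 3))).mul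
      ((isHomogeneous_X ℂ (2 : Fin 3)).sub (isHomogeneous_X ℂ (0 : Fin 3))))

lemma ideal_isHomogeneous : ideal.IsHomogeneous (homogeneousSubmodule (Fin 3) ℂ) :=
  Ideal.homogeneous_span _ _ fun x hx => ⟨3, by
    rw [Set.mem_singleton_iff.mp hx]; exact cubic_isHomogeneous⟩

instance : SetLike.GradedMonoid grading where
  one_mem := ⟨1, isHomogeneous_one _ _, map_one proj⟩
  mul_mem := by
    rintro i j _ _ ⟨p, hp, rfl⟩ ⟨q, hq, rfl⟩
    exact ⟨p * q, IsHomogeneous.mul hp hq, map_mul proj p q⟩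

/-- The restriction of the projection to the forms of degree `n`. -/
def projDeg (n : ℕ) : homogeneousSubmodule (Fin 3) ℂ n →ₗ[ℂ] grading n :=
  (proj.toLinearMap.domRestrict _).codRestrict _ fun p => ⟨p, p.2, rfl⟩

/-- The homogeneous components of the class of a polynomial. -/
def decomposePoly : MvPolynomial (Fin 3) ℂ →ₗ[ℂ] DirectSum ℕ fun n => grading n :=
  (DirectSum.lmap projDeg).comp
    (DirectSum.decomposeLinearEquiv (homogeneousSubmodule (Fin 3) ℂ)).toLinearMap

lemma decomposePoly_apply_coe (p : MvPolynomial (Fin 3) ℂ) (n : ℕ) :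
    (decomposePoly p n : CoordRing)
      = proj (DirectSum.decompose (homogeneousSubmodule (Fin 3) ℂ) p n) := by
  simp only [decomposePoly, LinearMap.comp_apply, DirectSum.lmap_apply]
  rfl

lemma decomposePoly_of_mem {p : MvPolynomial (Fin 3) ℂ} {n : ℕ}
    (hp : p ∈ homogeneousSubmodule (Fin 3) ℂ n) :
    decomposePoly p = DirectSum.of (fun n => grading n) n ⟨proj p, p, hp, rfl⟩ := by
  simp only [decomposePoly, LinearMap.comp_apply, LinearEquiv.coe_coe,
    DirectSum.decomposeLinearEquiv_apply]
  rw [DirectSum.decompose_of_mem _ hp]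
  exact DirectSum.lmap_lof projDeg n ⟨p, hp⟩

lemma decomposePoly_eq_zero (p : MvPolynomial (Fin 3) ℂ) (hp : p ∈ ideal) :
    decomposePoly p = 0 :=
  DFinsupp.ext fun n => Subtype.ext <| by
    rw [decomposePoly_apply_coe]
    exact Ideal.Quotient.eq_zero_iff_mem.mpr (ideal_isHomogeneous n hp)

/-- The homogeneous components of an element of the coordinate ring. -/
def decomposeQuot : CoordRing →+ DirectSum ℕ fun n => grading n :=
  QuotientAddGroup.lift ideal.toAddSubgroup decomposePoly.toAddMonoidHom
    fun p hp => decomposePoly_eq_zero p hp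

lemma decomposeQuot_proj (p : MvPolynomial (Fin 3) ℂ) :
    decomposeQuot (proj p) = decomposePoly p := rfl

instance : GradedAlgebra grading where
  decompose' := decomposeQuot
  left_inv x := by
    obtain ⟨p, rfl⟩ := Ideal.Quotient.mk_surjective x
    change DirectSum.coeAddMonoidHom grading (decomposeQuot (proj p)) = proj p
    induction p using DirectSum.Decomposition.inductionOn (homogeneousSubmodule (Fin 3) ℂ) with
    | zero => simp
    | homogeneous p =>
      rw [decomposeQuot_proj, decomposePoly_of_mem p.2, DirectSum.coeAddMonoidHom_of]
    | add p q hp hq => rw [map_add, map_add, map_add, hp, hq]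
  right_inv x := by
    induction x using DirectSum.induction_on with
    | zero => simp
    | of n x =>
      obtain ⟨_, p, hp, rfl⟩ := x
      rw [DirectSum.coeAddMonoidHom_of]
      exact decomposePoly_of_mem hp
    | add x y hx hy => rw [map_add, map_add, hx, hy]
end

/-- The plane cubic `c³ = s w (w - s)`, as a scheme. -/
def curve : Scheme := Proj grading

/-- The structure morphism of the curve. -/
def curveToC : curve ⟶ Spec (.of ℂ) :=
  Proj.toSpecZero grading ≫ Spec.map (CommRingCat.ofHom (algebraMap ℂ (grading 0)))

/-- The primitive cube root of unity `exp (2πi/3)`. -/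
def omega : ℂ := Complex.exp (2 * Real.pi * Complex.I / 3)

lemma omega_pow : omega ^ 3 = 1 := by
  rw [omega, ← Complex.exp_nat_mul, ← Complex.exp_two_pi_mul_I]
  congr 1; push_cast; ring

/-- The substitution `s ↦ s`, `c ↦ ω c`, `w ↦ w`. -/
def rotPoly : MvPolynomial (Fin 3) ℂ →ₐ[ℂ] MvPolynomial (Fin 3) ℂ :=
  aeval ![X 0, C omega * X 1, X 2]

lemma rotPoly_cubic : rotPoly cubic = cubic := by
  simp [rotPoly, cubic, mul_pow, ← C_pow, omega_pow]

/-- The substitution `c ↦ ω c` on the coordinate ring. -/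
def rotRing : CoordRing →ₐ[ℂ] CoordRing :=
  Ideal.quotientMapₐ ideal rotPoly <| by
    rw [ideal, Ideal.span_le, Set.singleton_subset_iff]
    change rotPoly cubic ∈ Ideal.span {cubic}
    rw [rotPoly_cubic]
    exact Ideal.mem_span_singleton_self _

lemma rotPoly_isHomogeneous {p : MvPolynomial (Fin 3) ℂ} {n : ℕ} (hp : p.IsHomogeneous n) :
    (rotPoly p).IsHomogeneous n := by
  have := hp.aeval (![X 0, C omega * X 1, X 2] : Fin 3 → MvPolynomial (Fin 3) ℂ) (n := 1) <| by
    intro i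
    fin_cases i
    · exact isHomogeneous_X _ _
    · simpa using (isHomogeneous_C (Fin 3) omega).mul (isHomogeneous_X ℂ (1 : Fin 3))
    · exact isHomogeneous_X _ _
  rw [one_mul] at this
  exact this

/-- The substitution `c ↦ ω c` as a graded ring homomorphism. -/
def rot : GradedRingHom grading grading where
  toRingHom := rotRing.toRingHom
  map_mem := by
    rintro n _ ⟨p, hp, rfl⟩
    exact ⟨rotPoly p, rotPoly_isHomogeneous hp, rfl⟩

lemma rotPoly_rotPoly_rotPoly (p : MvPolynomial (Fin 3) ℂ) : rotPoly (rotPoly (rotPoly p)) = p := by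
  have h : (rotPoly.comp (rotPoly.comp rotPoly)) = AlgHom.id ℂ _ := by
    ext i : 1
    fin_cases i
    · simp [rotPoly]
    · simp only [rotPoly, AlgHom.comp_apply, aeval_X, map_mul, algHom_C, Fin.mk_one,
        Matrix.cons_val_one, Matrix.cons_val_zero, AlgHom.id_apply, algebraMap_eq]
      rw [← mul_assoc, ← mul_assoc, ← C_mul, ← C_mul, ← pow_two, ← pow_succ, omega_pow, C_1, one_mul]
    · simp [rotPoly]
  exact AlgHom.congr_fun h p

open HomogeneousIdeal in
lemma rot_irrelevant :
    HomogeneousIdeal.irrelevant grading ≤ (HomogeneousIdeal.irrelevant grading).map rot := by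
  rw [← toIdeal_le_toIdeal_iff, toIdeal_irrelevant_le]
  rintro n hn _ ⟨p, hp, rfl⟩
  have h : proj.toLinearMap p = rot (proj (rotPoly (rotPoly p))) := by
    change proj p = proj (rotPoly (rotPoly (rotPoly p)))
    rw [rotPoly_rotPoly_rotPoly]
  rw [h]
  refine Ideal.mem_map_of_mem _ ?_
  exact mem_irrelevant_of_mem _ hn
    ⟨_, rotPoly_isHomogeneous (rotPoly_isHomogeneous hp), rfl⟩

/-- The generator `(s, c) ↦ (s, ω c)` of the group `ℤ/3` of deck transformations of the covering
`(s, c) ↦ s`. -/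
def deck : curve ⟶ curve := Proj.map rot rot_irrelevant

variable {R : Type} [CommRing R] [Algebra ℂ R]

/-- Evaluation of the coordinate ring at `[s : c : 1]`, where `c³ = s (1 - s)`. -/
def evalAffine (s c : R) (h : c ^ 3 = s * (1 - s)) : CoordRing →ₐ[ℂ] R :=
  Ideal.Quotient.liftₐ ideal (aeval ![s, c, 1]) <| by
    intro a ha
    obtain ⟨b, rfl⟩ := Ideal.mem_span_singleton'.mp ha
    simp [cubic, h]

lemma map_irrelevant_evalAffine (s c : R) (h : c ^ 3 = s * (1 - s)) :
    (HomogeneousIdeal.irrelevant grading).toIdeal.map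
      ((Scheme.ΓSpecIso (.of R)).inv.hom.comp (evalAffine s c h).toRingHom) = ⊤ := by
  refine Ideal.eq_top_of_isUnit_mem _ (x := 1) ?_ isUnit_one
  have h2 : proj (X 2) ∈ (HomogeneousIdeal.irrelevant grading).toIdeal :=
    HomogeneousIdeal.mem_irrelevant_of_mem _ one_pos ⟨X 2, isHomogeneous_X _ _, rfl⟩
  have := Ideal.mem_map_of_mem
    ((Scheme.ΓSpecIso (.of R)).inv.hom.comp (evalAffine s c h).toRingHom) h2
  convert! this
  have h3 : evalAffine s c h (proj (X 2)) = 1 := by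
    change aeval ![s, c, 1] (X 2) = 1
    simp
  simp only [RingHom.comp_apply, AlgHom.toRingHom_eq_coe, RingHom.coe_coe, h3, map_one]

/-- The `R`-valued point `[s : c : 1]` of the curve, where `c³ = s (1 - s)`. -/
def affinePoint (s c : R) (h : c ^ 3 = s * (1 - s)) : Spec (.of R) ⟶ curve :=
  Proj.fromOfGlobalSections grading
    ((Scheme.ΓSpecIso (.of R)).inv.hom.comp (evalAffine s c h).toRingHom)
    (map_irrelevant_evalAffine s c h)
end EquianharmonicCurve

/-! ## Line arrangements and quasi-toric relations -/

open EquianharmonicCurve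

/-- An arrangement of `r` distinct lines in the projective plane, given by linear forms. -/
structure LineArrangement (r : ℕ) where
  form : Fin r → MvPolynomial (Fin 3) ℂ
  isHomogeneous : ∀ j, (form j).IsHomogeneous 1
  ne_zero : ∀ j, form j ≠ 0
  distinct : ∀ i j, i ≠ j → ¬ ∃ a : ℂ, form i = C a * form j

variable {r : ℕ}

/-- A quasi-toric relation `F₁ f³ + F₂ g³ + F₃ h³ = 0` of orbifold type `(3,3,3)`. Here `F 0`, `F 1`,
`F 2` are the three coefficients and `f 0`, `f 1`, `f 2` are `f`, `g`, `h`. -/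
structure QuasiToricRelation (𝒜 : LineArrangement r) where
  F : Fin 3 → MvPolynomial (Fin 3) ℂ
  f : Fin 3 → MvPolynomial (Fin 3) ℂ
  F_isHomogeneous : ∀ i, ∃ n, (F i).IsHomogeneous n
  /-- Each `F i` is a nonzero constant or the equation of a reduced curve. -/
  F_squarefree : ∀ i, Squarefree (F i)
  F_coprime : ∀ i j, i ≠ j → IsRelPrime (F i) (F j)
  /-- The zero set of `F₁ F₂ F₃` in the projective plane is the union of the lines. -/
  zeroSet : ∀ v : Fin 3 → ℂ, v ≠ 0 →
    (eval v (F 0 * F 1 * F 2) = 0 ↔ ∃ j, eval v (𝒜.form j) = 0)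
  f_isHomogeneous : ∀ i, ∃ n, (f i).IsHomogeneous n
  f_ne_zero : ∀ i, f i ≠ 0
  /-- `f`, `g`, `h` have no common factor. -/
  f_primitive : ∀ d, (∀ i, d ∣ f i) → IsUnit d
  relation : F 0 * f 0 ^ 3 + F 1 * f 1 ^ 3 + F 2 * f 2 ^ 3 = 0

namespace QuasiToricRelation

variable {𝒜 : LineArrangement r}

/-- The equivalence of quasi-toric relations: `F i = λ F' i` with one `λ` for the three indices, and
`f = λ_f f'`, `g = λ_g g'`, `h = λ_h h'` with `λ_f / λ_h` and `λ_g / λ_h` cube roots of unity and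
`λ_f λ_g = λ_h²`. -/
def Equivalent (R R' : QuasiToricRelation 𝒜) : Prop :=
  ∃ l lf lg lh : ℂ, (∀ i, R.F i = C l * R'.F i) ∧
    R.f 0 = C lf * R'.f 0 ∧ R.f 1 = C lg * R'.f 1 ∧ R.f 2 = C lh * R'.f 2 ∧
    (lf / lh) ^ 3 = 1 ∧ (lg / lh) ^ 3 = 1 ∧ lf * lg = lh ^ 2

lemma Equivalent.refl (R : QuasiToricRelation 𝒜) : Equivalent R R :=
  ⟨1, 1, 1, 1, by simp⟩

lemma Equivalent.symm {R R' : QuasiToricRelation 𝒜} (h : Equivalent R R') : Equivalent R' R := by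
  obtain ⟨l, lf, lg, lh, hF, h0, h1, h2, hfh, hgh, hfg⟩ := h
  have key : ∀ {a : ℂ} {p q : MvPolynomial (Fin 3) ℂ}, p ≠ 0 → p = C a * q →
      a ≠ 0 ∧ q = C a⁻¹ * p := by
    rintro a p q hp rfl
    have ha : a ≠ 0 := by rintro rfl; simp at hp
    refine ⟨ha, ?_⟩
    rw [← mul_assoc, ← C_mul, inv_mul_cancel₀ ha, C_1, one_mul]
  obtain ⟨hf, h0'⟩ := key (R.f_ne_zero 0) h0
  obtain ⟨hg, h1'⟩ := key (R.f_ne_zero 1) h1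
  obtain ⟨hh, h2'⟩ := key (R.f_ne_zero 2) h2
  refine ⟨l⁻¹, lf⁻¹, lg⁻¹, lh⁻¹, fun i => (key (R.F_squarefree i).ne_zero (hF i)).2,
    h0', h1', h2', ?_, ?_, ?_⟩
  · rw [inv_div_inv, ← inv_div, inv_pow, hfh, inv_one]
  · rw [inv_div_inv, ← inv_div, inv_pow, hgh, inv_one]
  · rw [← mul_inv, hfg, inv_pow]

lemma Equivalent.trans {R R' R'' : QuasiToricRelation 𝒜} (h : Equivalent R R')
    (h' : Equivalent R' R'') : Equivalent R R'' := by
  obtain ⟨l, lf, lg, lh, hF, h0, h1, h2, hfh, hgh, hfg⟩ := h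
  obtain ⟨m, mf, mg, mh, hF', h0', h1', h2', hfh', hgh', hfg'⟩ := h'
  refine ⟨l * m, lf * mf, lg * mg, lh * mh, fun i => ?_, ?_, ?_, ?_, ?_, ?_, ?_⟩
  · rw [hF, hF', C_mul, mul_assoc]
  · rw [h0, h0', C_mul, mul_assoc]
  · rw [h1, h1', C_mul, mul_assoc]
  · rw [h2, h2', C_mul, mul_assoc]
  · rw [mul_div_mul_comm, mul_pow, hfh, hfh', one_mul]
  · rw [mul_div_mul_comm, mul_pow, hgh, hgh', one_mul]
  · linear_combination mf * mg * hfg + lh ^ 2 * hfg'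

open Classical in
/-- The product of the given linear forms of those lines of the arrangement that are components of
the curve `F i = 0`. -/
def lineProduct (R : QuasiToricRelation 𝒜) (i : Fin 3) : MvPolynomial (Fin 3) ℂ :=
  ∏ j with 𝒜.form j ∣ R.F i, 𝒜.form j

/-- The equations `F i` of the three curves are the chosen ones, the products of the given linear
forms, up to one common constant factor. -/
def IsNormalized (R : QuasiToricRelation 𝒜) : Prop :=
  ∃ a : ℂ, a ≠ 0 ∧ ∀ i, R.F i = C a * R.lineProduct i

end QuasiToricRelation

/-- The quasi-toric relations whose coefficients are products of the given linear forms, up to one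
common constant factor. -/
abbrev NormalizedRelation (𝒜 : LineArrangement r) : Type :=
  {R : QuasiToricRelation 𝒜 // R.IsNormalized}

/-- The equivalence of quasi-toric relations, on the normalized ones. -/
instance NormalizedRelation.setoid (𝒜 : LineArrangement r) : Setoid (NormalizedRelation 𝒜) where
  r R R' := QuasiToricRelation.Equivalent R.1 R'.1
  iseqv := ⟨fun _ => .refl _, fun h => h.symm, fun h h' => h.trans h'⟩

/-! ## The cyclic cover of the plane and its nonsingular models -/

/-- The function field `ℂ(x, y)` of the projective plane. -/
abbrev PlaneField : Type := FractionRing (MvPolynomial (Fin 2) ℂ)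

/-- The rational function `p(x, y, 1)` on the plane. -/
def dehomogenize (p : MvPolynomial (Fin 3) ℂ) : PlaneField :=
  algebraMap (MvPolynomial (Fin 2) ℂ) PlaneField (aeval ![X 0, X 1, 1] p)

namespace LineArrangement

/-- The product of the equations of the lines, in the affine chart. -/
def affineEquation (𝒜 : LineArrangement r) : PlaneField := dehomogenize (∏ j, 𝒜.form j)

/-- The function field `ℂ(x, y)[z] / (z³ - ∏ L_j(x, y, 1))` of the `3`-fold cyclic cover of the
plane branched over the arrangement. -/
abbrev CoverField (𝒜 : LineArrangement r) : Type :=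
  AdjoinRoot (Polynomial.X ^ 3 - Polynomial.C 𝒜.affineEquation)

/-- The coordinate `z` with `z³ = ∏ L_j(x, y, 1)`. -/
def coverRoot (𝒜 : LineArrangement r) : 𝒜.CoverField := AdjoinRoot.root _

lemma coverRoot_pow (𝒜 : LineArrangement r) :
    𝒜.coverRoot ^ 3 = algebraMap PlaneField 𝒜.CoverField 𝒜.affineEquation := by
  have h := AdjoinRoot.eval₂_root (Polynomial.X ^ 3 - Polynomial.C 𝒜.affineEquation)
  simp only [Polynomial.eval₂_sub, Polynomial.eval₂_pow, Polynomial.eval₂_X,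
    Polynomial.eval₂_C] at h
  exact sub_eq_zero.mp h

/-- The generator `z ↦ ω z` of the group `ℤ/3` of deck transformations of the cover, acting on
functions. -/
def coverDeck (𝒜 : LineArrangement r) : 𝒜.CoverField →+* 𝒜.CoverField :=
  AdjoinRoot.lift (algebraMap PlaneField 𝒜.CoverField)
    (algebraMap ℂ 𝒜.CoverField omega * 𝒜.coverRoot) <| by
      simp only [Polynomial.eval₂_sub, Polynomial.eval₂_pow, Polynomial.eval₂_X,
        Polynomial.eval₂_C, mul_pow, ← map_pow, omega_pow, map_one, one_mul]
      rw [coverRoot_pow, sub_self]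

end LineArrangement

/-- A nonsingular model of the `3`-fold cyclic cover of the plane branched over the arrangement: a
nonsingular complete variety `X` over `ℂ` with the function field of the cover, with a regular action
of the group `ℤ/3` of deck transformations. -/
structure NonsingularModel (𝒜 : LineArrangement r) where
  X : Scheme.{0}
  toC : X ⟶ Spec (.of ℂ)
  isIntegral : IsIntegral X
  isProper : IsProper toC
  nonsingular : ∀ x : X, IsRegularLocalRing (X.presheaf.stalk x)
  /-- The identification of the function field of `X` with that of the cover. -/
  functionFieldIso : X.functionField ≅ CommRingCat.of 𝒜.CoverField
  /-- The identification of the function fields is one over `ℂ`. -/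
  functionFieldIso_toC :
    (Spec.map functionFieldIso.hom ≫ X.fromSpecStalk (genericPoint X)) ≫ toC =
      Spec.map (CommRingCat.ofHom (algebraMap ℂ 𝒜.CoverField))
  /-- The generator of the group `ℤ/3`. -/
  deck : X ≅ X
  deck_toC : deck.hom ≫ toC = toC
  /-- The generator acts on functions by `z ↦ ω z`. -/
  deck_generic :
    (Spec.map functionFieldIso.hom ≫ X.fromSpecStalk (genericPoint X)) ≫ deck.hom =
      Spec.map (CommRingCat.ofHom 𝒜.coverDeck) ≫
        (Spec.map functionFieldIso.hom ≫ X.fromSpecStalk (genericPoint X))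

namespace NonsingularModel

variable {𝒜 : LineArrangement r} (M : NonsingularModel 𝒜)

instance : IsIntegral M.X := M.isIntegral

/-- The generic point of the model. Composing a morphism with it expresses the morphism through
rational functions on the cover. -/
def generic : Spec (.of 𝒜.CoverField) ⟶ M.X :=
  Spec.map M.functionFieldIso.hom ≫ M.X.fromSpecStalk (genericPoint M.X)

/-- The morphism is constant: it factors through a point. -/
def IsConstant (φ : M.X ⟶ curve) : Prop := ∃ p : Spec (.of ℂ) ⟶ curve, φ = M.toC ≫ p

/-- The non-constant `ℤ/3`-equivariant morphisms over `ℂ` from the model to the elliptic curve. -/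
def EquivariantMap : Type :=
  {φ : M.X ⟶ curve //
    φ ≫ curveToC = M.toC ∧ M.deck.hom ≫ φ = φ ≫ EquianharmonicCurve.deck ∧ ¬ M.IsConstant φ}

end NonsingularModel

namespace QuasiToricRelation

variable {𝒜 : LineArrangement r} (R : QuasiToricRelation 𝒜)

/-- The rational function `A = F₁ / F₃` on the plane. -/
def ratioA : PlaneField := dehomogenize (R.F 0) / dehomogenize (R.F 2)

/-- The cube root `C` of `F₁ F₂ / F₃²` on the cover: `z` divided by the product of the linear forms of
the lines in `F₃ = 0`. If the relation is normalized, then `C³ = F₁ F₂ / F₃²`. -/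
def rootC : 𝒜.CoverField :=
  𝒜.coverRoot * algebraMap PlaneField 𝒜.CoverField (dehomogenize (R.lineProduct 2))⁻¹

/-- The first coordinate `s = -A (f / h)³` of the map; then `1 - s = -B (g / h)³` with
`B = F₂ / F₃`. -/
def mapS : 𝒜.CoverField :=
  algebraMap PlaneField 𝒜.CoverField
    (-(R.ratioA * (dehomogenize (R.f 0) / dehomogenize (R.f 2)) ^ 3))

/-- The second coordinate `c = C f g / h²` of the map. -/
def mapC : 𝒜.CoverField :=
  R.rootC * algebraMap PlaneField 𝒜.CoverField
    (dehomogenize (R.f 0) * dehomogenize (R.f 1) / dehomogenize (R.f 2) ^ 2)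

end QuasiToricRelation

end

/-! The bijection identifies three descriptions of the same objects: equivariant morphisms to `E`,
points of `E` over function fields, and factorizations of forms.

A morphism from the model to `E` is determined by its value at the generic point, since `E` is
separated. Conversely, every point `(s, c)` of `E` over the function field of the cover extends to a
morphism, because a rational map from a nonsingular surface to an elliptic curve has no points of
indeterminacy. The usual proof blows up and uses that exceptional curves are rational; here the
argument is arithmetic. Over a regular local ring `O` of dimension at most two write `s = p/q` in
lowest terms. Then `c³ = s(1 - s)` makes `p`, `q - p` and `q` cubes up to units, and indeterminacy,
that is, `p` and `q` both nonunits, would give a solution of `α³ + uγ³ = vβ³` with `u`, `v` units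
and `α`, `γ` coprime in the maximal ideal. An étale extension makes `u` a cube, the left side splits
over the cube roots of unity, and infinite descent (`mem_pow_of_cube_add_cube_eq`) puts `β` into all
powers of the maximal ideal. So `β = 0`, which is absurd. Thus `s` or `1/s` lies in `O`
(`exists_lift_or_inv`), and the point extends over every closed point of the model
(`exists_hom_of_affinePoint`).

Equivariance means that `s` is invariant and that `c` is multiplied by `ω`. Hence `s` is a function
on the plane and `c = z c₁` with `c₁` on the plane, so `(s, c₁)` is a point of the twisted curve `D
c₁³ = s(1 - s)` over `ℂ(x, y)`, where `D` is the product of the lines. The points with `c = 0` are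
the three ramification points, whose maps are constant; an equivariant constant map has `ωc = c`,
hence `c = 0` in the affine chart. So non-constant means `c ≠ 0`.

As `3 ∣ r`, the twisted equation can be homogenized: `s = -p₀/p₂` with coprime forms such that `p₀ +
p₁ + p₂ = 0` and `p₀p₁p₂ = D b³` (`exists_forms_of_mul_pow_eq`). Unique factorization then gives `pᵢ
= Pᵢ fᵢ³`, a normalized quasi-toric relation. In the other direction, `s` determines the terms up to
a common scalar, squarefreeness of the coefficients determines the `fᵢ` up to scalars with equal
cubes, and `c` fixes one product of these scalars. This is exactly the equivalence of relations
(`equivalent_of_map_eq`). Normalization only needs the cube roots in `ℂ`. -/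

open EquianharmonicCurve

/-! ## Two-dimensional regular local rings -/

section RegularPair

open IsLocalRing

/-- `x, y` is a regular system of parameters of a local ring. -/
structure IsRegularPair {O : Type*} [CommRing O] [IsLocalRing O] (x y : O) : Prop where
  span_eq : maximalIdeal O = Ideal.span {x, y}
  mem_nonZeroDivisors : x ∈ nonZeroDivisors O
  -- This encodes dimension two: modulo `x` the maximal ideal is generated by `y`, and `y` is not
  -- nilpotent there. Being a divisibility statement, it passes to faithfully flat extensions.
  pow_notMem : ∀ n : ℕ, ¬ x ∣ y ^ n

namespace IsRegularPair

variable {O : Type*} [CommRing O] [IsLocalRing O] {x y : O}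

lemma left_mem (h : IsRegularPair x y) : x ∈ maximalIdeal O := by
  rw [h.span_eq]; exact Ideal.subset_span (by simp)

lemma right_mem (h : IsRegularPair x y) : y ∈ maximalIdeal O := by
  rw [h.span_eq]; exact Ideal.subset_span (by simp)

variable [IsNoetherianRing O]

/-- By Krull's intersection theorem only finitely many powers of `z` divide `f`. No domain is
assumed, so this applies to the quotient by `x` as well. -/
lemma exists_pow_mul_not_dvd {z f : O} (hz : z ∈ maximalIdeal O) (hf : f ≠ 0) :
    ∃ (n : ℕ) (g : O), f = z ^ n * g ∧ ¬ z ∣ g := by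
  classical
  have hI : Ideal.span {z} ≠ ⊤ := fun h => by
    have : Ideal.span {z} ≤ maximalIdeal O := by
      rwa [Ideal.span_le, Set.singleton_subset_iff]
    rw [h, top_le_iff] at this
    exact (maximalIdeal.isMaximal O).ne_top this
  have hex : ∃ n : ℕ, ¬ z ^ n ∣ f := by
    by_contra! hall
    apply hf
    have := Ideal.iInf_pow_eq_bot_of_isLocalRing (Ideal.span {z}) hI
    have hmem : f ∈ ⨅ i : ℕ, Ideal.span {z} ^ i := by
      rw [Ideal.mem_iInf]
      intro i
      rw [Ideal.span_singleton_pow, Ideal.mem_span_singleton]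
      exact hall i
    rwa [this] at hmem
  have hpos : Nat.find hex ≠ 0 := fun h0 => by
    have := Nat.find_spec hex
    rw [h0] at this
    simp at this
  obtain ⟨g, hg⟩ := not_not.mp (Nat.find_min hex (Nat.sub_one_lt hpos))
  refine ⟨_, g, hg, ?_⟩
  rintro ⟨k, rfl⟩
  apply Nat.find_spec hex
  refine ⟨k, ?_⟩
  refine hg.trans ?_
  rw [← mul_assoc, ← pow_succ, Nat.sub_add_cancel (Nat.one_le_iff_ne_zero.mpr hpos)]

/-- Modulo `x` the maximal ideal is generated by `y`, so a nonzero class there is a unit times a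
power of `y`. Lift this normal form. -/
lemma exists_eq_unit_mul_pow (h : IsRegularPair x y) {f : O} (hf : ¬ x ∣ f) :
    ∃ (n : ℕ) (u w : O), IsUnit u ∧ f = u * y ^ n + x * w := by
  set I := Ideal.span {x} with hI
  have hne : I ≠ ⊤ := fun h1 => by
    have : (1 : O) ∈ I := h1 ▸ Submodule.mem_top
    exact hf ((Ideal.mem_span_singleton.mp this).trans (one_dvd _))
  have : Nontrivial (O ⧸ I) := Ideal.Quotient.nontrivial_iff.mpr hne
  have hloc : IsLocalRing (O ⧸ I) := .of_surjective' _ Ideal.Quotient.mk_surjective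
  have hmax : maximalIdeal (O ⧸ I) = Ideal.span {Ideal.Quotient.mk I y} := by
    have h1 : maximalIdeal (O ⧸ I) = (maximalIdeal O).map (Ideal.Quotient.mk I) := by
      apply le_antisymm
      · intro z hz
        obtain ⟨z, rfl⟩ := Ideal.Quotient.mk_surjective z
        refine Ideal.mem_map_of_mem _ ?_
        rw [mem_maximalIdeal, mem_nonunits_iff] at hz ⊢
        exact fun hu => hz (hu.map _)
      · have : IsLocalHom (Ideal.Quotient.mk I) := .of_surjective _ Ideal.Quotient.mk_surjective
        rw [Ideal.map_le_iff_le_comap]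
        exact ((local_hom_TFAE (Ideal.Quotient.mk I)).out 0 3).mp this
    rw [h1, h.span_eq, Ideal.map_span, Set.image_pair]
    have h0 : Ideal.Quotient.mk I x = 0 :=
      Ideal.Quotient.eq_zero_iff_mem.mpr (Ideal.mem_span_singleton_self x)
    rw [h0, Ideal.span_insert_zero]
  have hf' : Ideal.Quotient.mk I f ≠ 0 := fun h0 =>
    hf (Ideal.mem_span_singleton.mp (Ideal.Quotient.eq_zero_iff_mem.mp h0))
  obtain ⟨n, g, hg, hyg⟩ := exists_pow_mul_not_dvd (z := Ideal.Quotient.mk I y)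
    (by rw [hmax]; exact Ideal.mem_span_singleton_self _) hf'
  obtain ⟨u, rfl⟩ := Ideal.Quotient.mk_surjective g
  have hu : IsUnit u := by
    by_contra hu
    apply hyg
    rw [← Ideal.mem_span_singleton, ← hmax, mem_maximalIdeal, mem_nonunits_iff]
    intro hu'
    have : IsLocalHom (Ideal.Quotient.mk I) := .of_surjective _ Ideal.Quotient.mk_surjective
    exact hu (isUnit_of_map_unit _ _ hu')
  rw [← map_pow, ← map_mul, Ideal.Quotient.eq, Ideal.mem_span_singleton] at hg
  obtain ⟨w, hw⟩ := hg
  exact ⟨n, u, w, hu, by linear_combination hw⟩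

/-- Normal forms modulo `x` multiply to a unit times `y ^ (n + m)`, which is not divisible by `x`.
-/
lemma not_dvd_mul (h : IsRegularPair x y) {a b : O} (ha : ¬ x ∣ a) (hb : ¬ x ∣ b) :
    ¬ x ∣ a * b := by
  obtain ⟨n, u, w, hu, rfl⟩ := h.exists_eq_unit_mul_pow ha
  obtain ⟨m, v, w', hv, rfl⟩ := h.exists_eq_unit_mul_pow hb
  rintro ⟨k, hk⟩
  apply h.pow_notMem (n + m)
  have : x ∣ (u * v) * y ^ (n + m) :=
    ⟨k - u * y ^ n * w' - w * (v * y ^ m + x * w'), by rw [pow_add]; linear_combination hk⟩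
  exact ((hu.mul hv).dvd_mul_left).mp this

lemma isDomain (h : IsRegularPair x y) : IsDomain O := by
  have : NoZeroDivisors O := ⟨fun {a b} hab => by
    by_contra! hne
    obtain ⟨n, a', rfl, ha⟩ := exists_pow_mul_not_dvd h.left_mem hne.1
    obtain ⟨m, b', rfl, hb⟩ := exists_pow_mul_not_dvd h.left_mem hne.2
    apply h.not_dvd_mul ha hb
    have h1 : a' * b' * x ^ (n + m) = 0 := by rw [pow_add]; linear_combination hab
    have h2 : x ^ (n + m) ∈ nonZeroDivisors O := pow_mem h.mem_nonZeroDivisors _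
    rw [mul_right_mem_nonZeroDivisors_eq_zero_iff h2] at h1
    rw [h1]
    exact dvd_zero x⟩
  exact NoZeroDivisors.to_isDomain O

lemma prime (h : IsRegularPair x y) : Prime x := by
  have := h.isDomain
  refine ⟨nonZeroDivisors.ne_zero h.mem_nonZeroDivisors, h.left_mem, fun a b hab => ?_⟩
  by_contra! hne
  exact h.not_dvd_mul hne.1 hne.2 hab

/-- A prime ideal that does not contain `x` is principal. -/
lemma exists_span_singleton_eq (h : IsRegularPair x y) (p : Ideal O) [hp : p.IsPrime]
    (hx : x ∉ p) : ∃ f, p = Ideal.span {f} := by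
  classical
  -- Since `x ∉ p`, the intersection of `p` with `(x)` is `x p`. So by Nakayama's lemma generators
  -- of `p` modulo `x` generate `p`.
  have hxp : ∀ g ∈ p, x ∣ g → g ∈ Ideal.span {x} • p := by
    rintro _ hg ⟨k, rfl⟩
    exact Submodule.smul_mem_smul (Ideal.mem_span_singleton_self x)
      ((hp.mem_or_mem hg).resolve_left hx)
  have hjac : Ideal.span {x} ≤ Ideal.jacobson ⊥ := by
    rw [jacobson_eq_maximalIdeal ⊥ bot_ne_top, Ideal.span_le, Set.singleton_subset_iff]
    exact h.left_mem
  by_cases hall : ∀ g ∈ p, x ∣ g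
  · refine ⟨0, ?_⟩
    rw [Ideal.span_singleton_zero, ← le_bot_iff]
    refine Submodule.le_of_le_smul_of_le_jacobson_bot (IsNoetherian.noetherian p) hjac ?_
    exact fun g hg => Submodule.mem_sup_right (hxp g hg (hall g hg))
  · push Not at hall
    -- An element of `p` with the least exponent of `y` in its normal form generates `p` modulo `x`.
    have hex : ∃ n : ℕ, ∃ f ∈ p, ∃ u w : O, IsUnit u ∧ f = u * y ^ n + x * w := by
      obtain ⟨f, hf, hxf⟩ := hall
      obtain ⟨n, u, w, hu, e⟩ := h.exists_eq_unit_mul_pow hxf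
      exact ⟨n, f, hf, u, w, hu, e⟩
    obtain ⟨f, hf, u, w, hu, e⟩ := Nat.find_spec hex
    refine ⟨f, le_antisymm ?_ ((Ideal.span_singleton_le_iff_mem p).mpr hf)⟩
    refine Submodule.le_of_le_smul_of_le_jacobson_bot (IsNoetherian.noetherian p) hjac ?_
    intro g hg
    by_cases hxg : x ∣ g
    · exact Submodule.mem_sup_right (hxp g hg hxg)
    obtain ⟨k, v, w', hv, e'⟩ := h.exists_eq_unit_mul_pow hxg
    have hk : Nat.find hex ≤ k := Nat.find_min' hex ⟨g, hg, v, w', hv, e'⟩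
    obtain ⟨u', hu'⟩ := hu.exists_right_inv
    set q := v * u' * y ^ (k - Nat.find hex)
    have hq : g = q * f + (g - q * f) := by ring
    rw [hq]
    refine Submodule.add_mem_sup (Ideal.mul_mem_left _ _ (Ideal.mem_span_singleton_self f))
      (hxp _ (p.sub_mem hg (p.mul_mem_left _ hf)) ⟨w' - q * w, ?_⟩)
    have hy : y ^ k = y ^ (k - Nat.find hex) * y ^ Nat.find hex := by
      rw [← pow_add, Nat.sub_add_cancel hk]
    simp only [q]
    linear_combination e' + v * hy - v * u' * y ^ (k - Nat.find hex) * e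
      - v * y ^ (k - Nat.find hex) * y ^ Nat.find hex * hu'

/-- Kaplansky's criterion: a nonzero prime ideal contains the prime `x`, or it is principal and its
generator is prime. -/
lemma uniqueFactorizationMonoid (h : IsRegularPair x y) [IsDomain O] :
    UniqueFactorizationMonoid O := by
  rw [UniqueFactorizationMonoid.iff_exists_prime_mem_of_isPrime]
  intro p hp0 hp
  by_cases hx : x ∈ p
  · exact ⟨x, hx, h.prime⟩
  · obtain ⟨f, rfl⟩ := h.exists_span_singleton_eq p hx
    have hf : f ≠ 0 := by rintro rfl; simp at hp0
    exact ⟨f, Ideal.mem_span_singleton_self f, (Ideal.span_singleton_prime hf).mp hp⟩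

/-- An ideal generated by two relatively prime elements contains a power of the maximal ideal. -/
lemma exists_pow_le_span_pair (h : IsRegularPair x y) [IsDomain O] {a b : O}
    (hab : IsRelPrime a b) : ∃ n : ℕ, maximalIdeal O ^ n ≤ Ideal.span {a, b} := by
  by_cases htop : Ideal.span {a, b} = ⊤
  · exact ⟨0, by rw [htop]; exact le_top⟩
  refine Ideal.exists_pow_le_of_le_radical_of_fg ?_ (IsNoetherian.noetherian _)
  rw [Ideal.radical_eq_sInf]
  refine le_sInf fun p ⟨hle, hp⟩ => ?_
  have ha : a ∈ p := hle (Ideal.subset_span (by simp))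
  have hb : b ∈ p := hle (Ideal.subset_span (by simp))
  -- A generator of `p` would be a common divisor of `a` and `b`, hence a unit. As `p` is not
  -- principal, it contains `x` and an element not divisible by `x`, hence also `y`.
  have key : ∀ f, ¬ p = Ideal.span {f} := by
    rintro f rfl
    rw [Ideal.mem_span_singleton] at ha hb
    exact hp.ne_top (Ideal.span_singleton_eq_top.mpr (hab ha hb))
  by_cases hx : x ∈ p
  · obtain ⟨f, hf, hxf⟩ : ∃ f ∈ p, ¬ x ∣ f := by
      by_contra! hall
      refine key x (le_antisymm (fun f hf => Ideal.mem_span_singleton.mpr (hall f hf)) ?_)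
      exact (Ideal.span_singleton_le_iff_mem p).mpr hx
    obtain ⟨n, u, w, hu, rfl⟩ := h.exists_eq_unit_mul_pow hxf
    have h1 : u * y ^ n ∈ p := by
      rwa [p.add_mem_iff_left (p.mul_mem_right _ hx)] at hf
    have h2 : y ∈ p := hp.mem_of_pow_mem n
      ((hp.mem_or_mem h1).resolve_left fun hup => hp.ne_top (p.eq_top_of_isUnit_mem hup hu))
    rw [h.span_eq, Ideal.span_le]
    rintro z (rfl | rfl)
    exacts [hx, h2]
  · obtain ⟨f, hf⟩ := h.exists_span_singleton_eq p hx
    exact absurd hf (key f)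

/-- A common irreducible factor would divide powers of `x` and of `y`, so it would be associated to
`x` and `x` would divide a power of `y`. The ideal-theoretic form of coprimality is the one that is
carried through a faithfully flat extension. -/
lemma isRelPrime_of_pow_le (h : IsRegularPair x y) [IsDomain O] {a b : O} {n : ℕ}
    (hn : maximalIdeal O ^ n ≤ Ideal.span {a, b}) : IsRelPrime a b := by
  have := h.uniqueFactorizationMonoid
  intro d ha hb
  by_contra hd
  have hmem : ∀ z ∈ maximalIdeal O, d ∣ z ^ n := fun z hz => by
    have := hn (Ideal.pow_mem_pow hz n)
    rw [Ideal.mem_span_pair] at this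
    obtain ⟨s, t, e⟩ := this
    rw [← e]
    exact (ha.mul_left s).add (hb.mul_left t)
  have hd0 : d ≠ 0 := by
    rintro rfl
    exact pow_ne_zero n h.prime.ne_zero (zero_dvd_iff.mp (hmem x h.left_mem))
  obtain ⟨p, hp, hpd⟩ := WfDvdMonoid.exists_irreducible_factor hd hd0
  have hpx := hp.prime.dvd_of_dvd_pow (hpd.trans (hmem x h.left_mem))
  exact h.pow_notMem n (((hp.associated_of_dvd h.prime.irreducible hpx).symm.dvd.trans hpd).trans
    (hmem y h.right_mem))

end IsRegularPair

end RegularPair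

/-! ### Étale extensions by cube roots of units -/

section CubeRootExtension

open IsLocalRing

/-- Flatness preserves nonzerodivisors, and faithful flatness makes an ideal the contraction of its
extension, so that divisibility descends. -/
lemma IsRegularPair.map {O O' : Type*} [CommRing O] [IsLocalRing O] [CommRing O'] [IsLocalRing O']
    [Algebra O O'] [Module.FaithfullyFlat O O'] {x y : O} (h : IsRegularPair x y)
    (hm : (maximalIdeal O).map (algebraMap O O') = maximalIdeal O') :
    IsRegularPair (algebraMap O O' x) (algebraMap O O' y) where
  span_eq := by rw [← hm, h.span_eq, Ideal.map_span, Set.image_pair]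
  mem_nonZeroDivisors := by
    have h1 : IsSMulRegular O x := fun a b hab =>
      (mul_cancel_left_mem_nonZeroDivisors h.mem_nonZeroDivisors).mp hab
    rw [mem_nonZeroDivisors_iff_left]
    exact fun z hz => (h1.of_flat (S := O')) (hz.trans (mul_zero _).symm)
  pow_notMem n hn := by
    apply h.pow_notMem n
    rw [← Ideal.mem_span_singleton,
      ← Ideal.comap_map_eq_self_of_faithfullyFlat (B := O') (Ideal.span {x}), Ideal.mem_comap,
      Ideal.map_span, Set.image_singleton, Ideal.mem_span_singleton, map_pow]
    exact hn

/-- Adjoining a cube root of a unit which has a cube root in the residue field to a local ring in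
which `3` is invertible gives a local ring which is étale over the given one, with the same residue
field. -/
lemma exists_cubeRootExtension {O : Type} [CommRing O] [IsLocalRing O] [IsNoetherianRing O]
    (h3 : IsUnit (3 : O)) {u t₀ : O} (hu : IsUnit u) (ht₀ : t₀ ^ 3 - u ∈ maximalIdeal O) :
    ∃ (O' : Type) (_ : CommRing O') (_ : IsLocalRing O') (_ : IsNoetherianRing O')
      (_ : Algebra O O'), Module.FaithfullyFlat O O' ∧
      (maximalIdeal O).map (algebraMap O O') = maximalIdeal O' ∧
      (∀ a' : O', ∃ a : O, a' - algebraMap O O' a ∈ maximalIdeal O') ∧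
      ∃ t : O', t ^ 3 = algebraMap O O' u := by
  set f : Polynomial O := Polynomial.X ^ 3 - Polynomial.C u with hf
  have hfm : f.Monic := Polynomial.monic_X_pow_sub_C u three_ne_zero
  have hres : residue O t₀ ^ 3 = residue O u := by
    rw [← map_pow, ← sub_eq_zero, ← map_sub]
    exact (residue_eq_zero_iff _).mpr ht₀
  -- Sending the root to the residue of `t₀` selects the maximal ideal at which to localize; the
  -- residue field does not grow.
  let ε : AdjoinRoot f →+* ResidueField O :=
    AdjoinRoot.lift (residue O) (residue O t₀) (by simp [hf, hres])
  have hεO (a : O) : ε (algebraMap O _ a) = residue O a := by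
    rw [AdjoinRoot.algebraMap_eq]; exact AdjoinRoot.lift_of _
  have hεr : ε (AdjoinRoot.root f) = residue O t₀ := AdjoinRoot.lift_root _
  have hεs : Function.Surjective ε := fun z => by
    obtain ⟨a, rfl⟩ := residue_surjective z
    exact ⟨_, hεO a⟩
  let P : Ideal (AdjoinRoot f) := RingHom.ker ε
  have hP : P.IsMaximal := RingHom.ker_isMaximal_of_surjective ε hεs
  have hroot : AdjoinRoot.root f ^ 3 = algebraMap O _ u := by
    have := AdjoinRoot.eval₂_root f
    simp only [hf, Polynomial.eval₂_sub, Polynomial.eval₂_pow, Polynomial.eval₂_X,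
      Polynomial.eval₂_C] at this
    rw [AdjoinRoot.algebraMap_eq]
    exact sub_eq_zero.mp this
  let O' := Localization.AtPrime P
  have : Module.Free O (AdjoinRoot f) := hfm.free_adjoinRoot
  have : Module.Flat (AdjoinRoot f) O' := IsLocalization.flat O' P.primeCompl
  have hflat : Module.Flat O O' := Module.Flat.trans O (AdjoinRoot f) O'
  have htower (a : O) : algebraMap O O' a = algebraMap (AdjoinRoot f) O' (algebraMap O _ a) :=
    IsScalarTower.algebraMap_apply O (AdjoinRoot f) O' a
  have hPmem (b : AdjoinRoot f) : algebraMap _ O' b ∈ maximalIdeal O' ↔ b ∈ P :=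
    IsLocalization.AtPrime.to_map_mem_maximal_iff O' P b
  have hmle : (maximalIdeal O).map (algebraMap O O') ≤ maximalIdeal O' := by
    rw [Ideal.map_le_iff_le_comap]
    intro a ha
    rw [Ideal.mem_comap, htower, hPmem, RingHom.mem_ker, hεO]
    exact (residue_eq_zero_iff _).mpr ha
  have hlocal : IsLocalHom (algebraMap O O') :=
    ((local_hom_TFAE (algebraMap O O')).out 0 2).mpr hmle
  set T : O' := algebraMap _ O' (AdjoinRoot.root f) with hT
  have hT3 : T ^ 3 = algebraMap O O' u := by rw [hT, ← map_pow, hroot, htower]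
  have hTt : T - algebraMap O O' t₀ ∈ (maximalIdeal O).map (algebraMap O O') := by
    -- This cofactor of `T - t₀` in `T³ - t₀³` has residue `3 t₀²`, which is nonzero because `3` and
    -- `u` are units. As `T³ - t₀³ = u - t₀³` comes from the maximal ideal of `O`, so does `T - t₀`.
    have h1 : IsUnit (T ^ 2 + T * algebraMap O O' t₀ + algebraMap O O' t₀ ^ 2) := by
      by_contra hn
      have h2 : algebraMap _ O' (AdjoinRoot.root f ^ 2 + AdjoinRoot.root f * algebraMap O _ t₀
          + algebraMap O _ t₀ ^ 2) ∈ maximalIdeal O' := by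
        rw [mem_maximalIdeal, mem_nonunits_iff]
        simpa only [map_add, map_mul, map_pow, ← htower] using hn
      rw [hPmem, RingHom.mem_ker] at h2
      simp only [map_add, map_mul, map_pow, hεO, hεr] at h2
      have h4 : residue O (3 * t₀ ^ 2) = 0 := by
        rw [map_mul, map_pow, map_ofNat]; linear_combination h2
      rw [residue_eq_zero_iff] at h4
      have h5 : t₀ ∈ maximalIdeal O := by
        refine (maximalIdeal.isMaximal O).isPrime.mem_of_pow_mem 2 ?_
        exact ((maximalIdeal.isMaximal O).isPrime.mem_or_mem h4).resolve_left (fun h => h h3)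
      have h6 : u ∈ maximalIdeal O := by
        have := (maximalIdeal O).sub_mem (Ideal.pow_mem_of_mem _ h5 3 (by norm_num)) ht₀
        simpa using this
      exact h6 hu
    rw [← Ideal.unit_mul_mem_iff_mem _ h1]
    have h2 : (T ^ 2 + T * algebraMap O O' t₀ + algebraMap O O' t₀ ^ 2) * (T - algebraMap O O' t₀)
        = algebraMap O O' (-(t₀ ^ 3 - u)) := by
      rw [map_neg, map_sub, map_pow]; linear_combination hT3
    rw [h2]
    exact Ideal.mem_map_of_mem _ (neg_mem ht₀)
  have hm : (maximalIdeal O).map (algebraMap O O') = maximalIdeal O' := by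
    refine le_antisymm hmle ?_
    rw [← Localization.AtPrime.map_eq_maximalIdeal, Ideal.map_le_iff_le_comap]
    intro b hb
    obtain ⟨p, rfl⟩ := AdjoinRoot.mk_surjective b
    have hmk : algebraMap _ O' (AdjoinRoot.mk f p) = Polynomial.aeval T p := by
      rw [hT, Polynomial.aeval_algebraMap_apply, AdjoinRoot.aeval_eq]
    have h1 : residue O (p.eval t₀) = 0 := by
      have := RingHom.mem_ker.mp hb
      rw [AdjoinRoot.lift_mk] at this
      rwa [← Polynomial.eval₂_at_apply]
    rw [Ideal.mem_comap, hmk]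
    -- The difference `p(T) - p(t₀)` is divisible by `T - t₀`, and `p(t₀)` lies in the maximal ideal
    -- of `O`; so the extension is unramified.
    have h2 : Polynomial.aeval T p = (Polynomial.aeval T p - Polynomial.aeval (algebraMap O O' t₀) p)
        + algebraMap O O' (p.eval t₀) := by
      rw [← Polynomial.coe_aeval_eq_eval, ← Polynomial.aeval_algebraMap_apply, sub_add_cancel]
    rw [h2]
    refine Ideal.add_mem _ ?_ (Ideal.mem_map_of_mem _ ((residue_eq_zero_iff _).mp h1))
    obtain ⟨q, hq⟩ := Polynomial.sub_dvd_eval_sub T (algebraMap O O' t₀) (p.map (algebraMap O O'))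
    rw [Polynomial.eval_map_algebraMap, Polynomial.eval_map_algebraMap] at hq
    rw [hq]
    exact Ideal.mul_mem_right _ _ hTt
  refine ⟨O', inferInstance, inferInstance, inferInstance, inferInstance,
    Module.FaithfullyFlat.of_flat_of_isLocalHom, hm, fun a' => ?_, T, hT3⟩
  let ε' : O' →+* ResidueField O := IsLocalization.lift (M := P.primeCompl) (g := ε)
    fun s => isUnit_iff_ne_zero.mpr fun h0 => s.2 (RingHom.mem_ker.mpr h0)
  obtain ⟨a, ha⟩ := residue_surjective (ε' a')
  refine ⟨a, ?_⟩
  rw [mem_maximalIdeal, mem_nonunits_iff]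
  intro hun
  have h0 : ε' (a' - algebraMap O O' a) = 0 := by
    rw [map_sub, htower, IsLocalization.lift_eq, hεO, ha, sub_self]
  exact (hun.map ε').ne_zero h0

end CubeRootExtension

/-! ### Infinite descent on the Fermat cubic -/

section CubicDescent

open IsLocalRing

lemma exists_associated_pow_three {R : Type*} [CommRing R] [IsDomain R]
    [UniqueFactorizationMonoid R] {p q v c : R} (hpq : IsRelPrime p q) (hv : IsUnit v)
    (e : p * q = v * c ^ 3) : ∃ d, Associated (d ^ 3) p := by
  let := UniqueFactorizationMonoid.toGCDMonoid R
  obtain ⟨w, hw⟩ := hv.exists_left_inv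
  refine exists_associated_pow_of_mul_eq_pow (a := p) (b := w * q) (c := c) ?_
    (by linear_combination w * e + c ^ 3 * hw)
  have hwu : IsUnit w := IsUnit.of_mul_eq_one v hw
  exact ((isRelPrime_mul_unit_left_right hwu).mpr hpq) (gcd_dvd_left _ _) (gcd_dvd_right _ _)

lemma dvd_of_pow_three_dvd {R : Type*} [CommRing R] [IsDomain R]
    [UniqueFactorizationMonoid R] {a b : R} (h : a ^ 3 ∣ b ^ 3) : a ∣ b := by
  exact (IsIntegrallyClosed.pow_dvd_pow_iff three_ne_zero).mp h

/-- Infinite descent for the Fermat cubic over a two-dimensional regular local ring. -/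
lemma mem_pow_of_cube_add_cube_eq (n : ℕ) : ∀ (O : Type) [CommRing O] [IsLocalRing O]
    [IsNoetherianRing O] {x y : O} (_ : IsRegularPair x y) (_ : IsUnit (3 : O))
    (_ : ∃ ω : O, ω ^ 2 + ω + 1 = 0)
    (_ : ∀ u : O, IsUnit u → ∃ t, t ^ 3 - u ∈ maximalIdeal O) {a b c u v : O}
    (_ : IsUnit u) (_ : IsUnit v) (_ : a ∈ maximalIdeal O) (_ : b ∈ maximalIdeal O) {N : ℕ}
    (_ : maximalIdeal O ^ N ≤ Ideal.span {a, b}) (_ : a ^ 3 + u * b ^ 3 = v * c ^ 3),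
    c ∈ maximalIdeal O ^ n := by
  -- Each descent step passes to an étale extension, so the ring has to vary in the induction
  -- hypothesis.
  induction n with
  | zero => intros; simp
  | succ n ih =>
    intro O _ _ _ x y h h3 ⟨ω₀, hω₀⟩ hcube a b c u v hu hv ha hb N hN e
    -- Make `u` a cube `t³`. Then `a³ + u b³` splits into the linear factors `a + ωⁱ t b`.
    obtain ⟨t₀, ht₀⟩ := hcube u hu
    obtain ⟨O', _, _, _, _, _, hm, hsurj, t, ht⟩ := exists_cubeRootExtension h3 hu ht₀
    set φ := algebraMap O O'
    have h' := h.map hm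
    have := h'.isDomain
    have := h'.uniqueFactorizationMonoid
    have hmem {z : O} (hz : z ∈ maximalIdeal O) : φ z ∈ maximalIdeal O' := by
      rw [← hm]; exact Ideal.mem_map_of_mem _ hz
    have h3' : IsUnit (3 : O') := by
      have := h3.map φ
      rwa [map_ofNat] at this
    set ω := φ ω₀ with hωdef
    have hω : ω ^ 2 + ω + 1 = 0 := by
      have := congrArg φ hω₀
      simpa using this
    have hωu : IsUnit ω := IsUnit.of_mul_eq_one (-(ω + 1)) (by linear_combination -hω)
    have htu : IsUnit t := by
      have : IsUnit (t ^ 3) := by rw [ht]; exact hu.map φ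
      exact (isUnit_pow_iff three_ne_zero).mp this
    have hcube' : ∀ u : O', IsUnit u → ∃ t, t ^ 3 - u ∈ maximalIdeal O' := by
      intro w hw
      obtain ⟨w₀, hw₀⟩ := hsurj w
      have hw₀u : IsUnit w₀ := by
        by_contra hn
        have := add_mem hw₀ (hmem (show w₀ ∈ maximalIdeal O from hn))
        rw [sub_add_cancel] at this
        exact this hw
      obtain ⟨s, hs⟩ := hcube w₀ hw₀u
      refine ⟨φ s, ?_⟩
      have := sub_mem (hmem hs) hw₀
      rwa [map_sub, map_pow, show φ s ^ 3 - φ w₀ - (w - φ w₀) = φ s ^ 3 - w by ring] at this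
    -- Coprimality is transported through the containment of a power of the maximal ideal in `(a,
    -- b)`.
    have hrel : IsRelPrime (φ a) (φ b) := by
      refine h'.isRelPrime_of_pow_le (n := N) ?_
      rw [← hm, ← Ideal.map_pow, ← Set.image_pair, ← Ideal.map_span]
      exact Ideal.map_mono hN
    set b' := t * φ b with hb'
    have hrel' : ∀ α β : O', IsUnit (α - β) → IsRelPrime (φ a + α * b') (φ a + β * b') := by
      intro α β hαβ d hd₁ hd₂
      have hd : d ∣ (α - β) * t * φ b := by
        have := dvd_sub hd₁ hd₂
        rwa [show φ a + α * b' - (φ a + β * b') = (α - β) * t * φ b by rw [hb']; ring] at this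
      have hdb : d ∣ φ b := ((hαβ.mul htu).dvd_mul_left).mp hd
      have hda : d ∣ φ a := (dvd_add_left (hdb.mul_left (α * t))).mp (by
        rwa [hb', ← mul_assoc] at hd₁)
      exact hrel hda hdb
    have h1ω : IsUnit (1 - ω) := isUnit_of_dvd_unit ⟨2 + ω, by linear_combination hω⟩ h3'
    have hu01 : IsUnit (1 - ω) := h1ω
    have hu02 : IsUnit (1 - ω ^ 2) := by
      have : 1 - ω ^ 2 = (1 - ω) * -(ω ^ 2) := by linear_combination (1 - ω) * hω
      rw [this]
      exact h1ω.mul (hωu.pow 2).neg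
    have hu12 : IsUnit (ω - ω ^ 2) := by
      have : ω - ω ^ 2 = ω * (1 - ω) := by ring
      rw [this]; exact hωu.mul h1ω
    have hprod : (φ a + 1 * b') * (φ a + ω * b') * (φ a + ω ^ 2 * b') = φ v * φ c ^ 3 := by
      have e' := congrArg φ e
      simp only [map_add, map_mul, map_pow] at e'
      rw [← e', ← ht, hb']
      have hω3 : ω ^ 3 = 1 := by linear_combination (ω - 1) * hω
      linear_combination ((φ a) ^ 2 * (t * φ b) + φ a * (t * φ b) ^ 2 * ω) * hω
        + (t * φ b) ^ 3 * hω3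
    have hr01 := hrel' 1 ω hu01
    have hr02 := hrel' 1 (ω ^ 2) hu02
    have hr12 := hrel' ω (ω ^ 2) hu12
    have hvu := hv.map φ
    -- The three linear factors are pairwise coprime with product a unit times a cube, so each of
    -- them is a unit times a cube.
    obtain ⟨g₀, u₀, hg₀⟩ := exists_associated_pow_three (hr01.mul_right hr02) hvu
      (by rw [← hprod]; ring)
    obtain ⟨g₁, u₁, hg₁⟩ := exists_associated_pow_three (hr01.symm.mul_right hr12) hvu
      (by rw [← hprod]; ring)
    obtain ⟨g₂, u₂, hg₂⟩ := exists_associated_pow_three (hr02.symm.mul_right hr12.symm) hvu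
      (by rw [← hprod]; ring)
    have hgm : ∀ (g : O') (w : O'ˣ) (α : O'), g ^ 3 * w = φ a + α * b' → g ∈ maximalIdeal O' := by
      intro g w α hg
      refine (maximalIdeal.isMaximal O').isPrime.mem_of_pow_mem 3 ?_
      rw [← Ideal.mul_unit_mem_iff_mem _ w.isUnit, hg, hb']
      exact add_mem (hmem ha) (Ideal.mul_mem_left _ _ (Ideal.mul_mem_left _ _ (hmem hb)))
    have hg₀m := hgm _ _ _ hg₀
    have hg₁m := hgm _ _ _ hg₁
    have hgrel : IsRelPrime g₀ g₁ := by
      refine (hr01.of_dvd_left ?_).of_dvd_right ?_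
      · rw [← hg₀]; exact (dvd_pow_self g₀ three_ne_zero).mul_right _
      · rw [← hg₁]; exact (dvd_pow_self g₁ three_ne_zero).mul_right _
    obtain ⟨N', hN'⟩ := h'.exists_pow_le_span_pair hgrel
    -- The linear factors satisfy `L₀ + ω L₁ + ω² L₂ = 0`, because `1 + ω + ω² = 0`. Substituting
    -- `Lᵢ = uᵢ gᵢ³` gives an equation of the original shape, with `g₀` and `g₁` coprime in the
    -- maximal ideal.
    have hg₂n : g₂ ∈ maximalIdeal O' ^ n := by
      refine ih O' h' h3' ⟨ω, hω⟩ hcube' (a := g₀) (b := g₁)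
        (u := (u₀⁻¹ : O'ˣ) * ω * u₁) (v := -((u₀⁻¹ : O'ˣ) * ω ^ 2 * u₂)) ?_ ?_ hg₀m hg₁m hN' ?_
      · exact (u₀⁻¹.isUnit.mul hωu).mul u₁.isUnit
      · exact ((u₀⁻¹.isUnit.mul (hωu.pow 2)).mul u₂.isUnit).neg
      · have hinv : ((u₀⁻¹ : O'ˣ) : O') * u₀ = 1 := u₀.inv_mul
        linear_combination (-g₀ ^ 3) * hinv + ((u₀⁻¹ : O'ˣ) : O') * (hg₀ + ω * hg₁ + ω ^ 2 * hg₂)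
          + ((u₀⁻¹ : O'ˣ) : O') * (φ a + b' * (ω ^ 2 - ω + 1)) * hω
    have hdvd : g₀ * g₁ * g₂ ∣ φ c := by
      refine dvd_of_pow_three_dvd ((hvu.dvd_mul_left).mp ?_)
      rw [← hprod, ← hg₀, ← hg₁, ← hg₂]
      exact ⟨u₀ * u₁ * u₂, by ring⟩
    -- The exponent grows because `g₀ g₁ g₂` divides `c` and the factor `g₀ g₁` is not a unit.
    -- Faithful flatness brings the membership back to `O`.
    have hmem' : φ c ∈ maximalIdeal O' ^ (n + 1) := by
      refine Ideal.mem_of_dvd _ hdvd ?_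
      rw [pow_succ']
      exact Ideal.mul_mem_mul (Ideal.mul_mem_right _ _ hg₀m) hg₂n
    rw [← hm, ← Ideal.map_pow, ← Ideal.mem_comap, Ideal.comap_map_eq_self_of_faithfullyFlat] at hmem'
    exact hmem'

/-- The Fermat cubic with unit coefficients has no primitive solutions in the maximal ideal. -/
lemma IsRegularPair.not_cube_add_cube_eq {O : Type} [CommRing O] [IsLocalRing O] [IsDomain O]
    [IsNoetherianRing O] {x y : O} (h : IsRegularPair x y) (h3 : IsUnit (3 : O))
    (hω : ∃ ω : O, ω ^ 2 + ω + 1 = 0)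
    (hcube : ∀ u : O, IsUnit u → ∃ t, t ^ 3 - u ∈ maximalIdeal O) {a b c u v : O}
    (hu : IsUnit u) (hv : IsUnit v) (ha : a ∈ maximalIdeal O) (hb : b ∈ maximalIdeal O)
    (hab : IsRelPrime a b) : a ^ 3 + u * b ^ 3 ≠ v * c ^ 3 := by
  intro e
  have := h.uniqueFactorizationMonoid
  obtain ⟨N, hN⟩ := h.exists_pow_le_span_pair hab
  have hc : c = 0 := by
    have h1 : c ∈ ⨅ n : ℕ, maximalIdeal O ^ n := (Ideal.mem_iInf).mpr fun n =>
      mem_pow_of_cube_add_cube_eq n O h h3 hω hcube hu hv ha hb hN e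
    rwa [Ideal.iInf_pow_eq_bot_of_isLocalRing _ (maximalIdeal.isMaximal O).ne_top] at h1
  have h1 : a ^ 3 ∣ b ^ 3 := (hu.dvd_mul_left).mp ⟨-1, by rw [hc] at e; linear_combination e⟩
  exact ha (hab dvd_rfl (dvd_of_pow_three_dvd h1))

end CubicDescent

/-! ### Points of the cubic over regular local rings of dimension at most two -/

section LocalExtension

open IsLocalRing

/-- In a local domain of dimension two, generators of the maximal ideal form a regular system of
parameters. -/
lemma isRegularPair_of_one_lt_height {O : Type*} [CommRing O] [IsLocalRing O] [IsDomain O]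
    [IsNoetherianRing O] {x y : O} (hxy : maximalIdeal O = Ideal.span {x, y})
    (hd : 1 < (maximalIdeal O).height) : IsRegularPair x y := by
  -- If `x` divided a power of `y`, the maximal ideal would be minimal over `(x)`, so of height at
  -- most one by Krull's principal ideal theorem.
  have hpow : ∀ n : ℕ, ¬ x ∣ y ^ n := by
    intro n hn
    refine absurd (Ideal.height_le_one_of_isPrincipal_of_mem_minimalPrimes (Ideal.span {x})
      (maximalIdeal O) ⟨⟨inferInstance, ?_⟩, ?_⟩) (not_le.mpr hd)
    · rw [hxy]; exact Ideal.span_mono (by simp)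
    · rintro p ⟨hp, hxp⟩ -
      have hx : x ∈ p := hxp (Ideal.mem_span_singleton_self x)
      rw [hxy, Ideal.span_le]
      rintro z (rfl | rfl)
      exacts [hx, hp.mem_of_pow_mem n (Ideal.mem_of_dvd p hn hx)]
  refine ⟨hxy, mem_nonZeroDivisors_of_ne_zero ?_, hpow⟩
  rintro rfl
  apply not_le.mpr hd
  rw [Ideal.span_insert_zero] at hxy
  have : (maximalIdeal O).IsPrincipal := ⟨y, hxy⟩
  exact Ideal.height_le_one_of_isPrincipal_of_mem_minimalPrimes (maximalIdeal O) _
    (by rw [Ideal.minimalPrimes_eq_subsingleton_self]; rfl)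

/-- The maximal ideal of a regular local domain of dimension at most two is principal, or generated
by a regular system of parameters of length two. -/
lemma IsRegularLocalRing.isPrincipal_or_isRegularPair {O : Type*} [CommRing O] [IsDomain O]
    [IsRegularLocalRing O] (hd : ringKrullDim O ≤ 2) :
    (∃ t, maximalIdeal O = Ideal.span {t}) ∨ ∃ x y : O, IsRegularPair x y := by
  have hr := IsRegularLocalRing.spanFinrank_maximalIdeal (R := O)
  have hht := maximalIdeal_height_eq_ringKrullDim (R := O)
  have hfg : (maximalIdeal O).FG := IsNoetherian.noetherian _
  obtain ⟨s, hs, hspan⟩ := Submodule.FG.exists_span_set_encard_eq_spanFinrank hfg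
  have hn : (maximalIdeal O).spanFinrank ≤ 2 := by
    rw [← hr] at hd
    exact_mod_cast hd
  generalize (maximalIdeal O).spanFinrank = n at *
  interval_cases n
  · rw [Nat.cast_zero, Set.encard_eq_zero] at hs
    subst hs
    exact .inl ⟨0, by rw [← hspan]; simp⟩
  · rw [Nat.cast_one, Set.encard_eq_one] at hs
    obtain ⟨t, rfl⟩ := hs
    exact .inl ⟨t, hspan.symm⟩
  · rw [Nat.cast_two, Set.encard_eq_two] at hs
    obtain ⟨x, y, -, rfl⟩ := hs
    refine .inr ⟨x, y, isRegularPair_of_one_lt_height hspan.symm ?_⟩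
    rw [← hr] at hht
    have h2 : (maximalIdeal O).height = 2 := WithBot.coe_injective (by rw [hht]; rfl)
    rw [h2]
    norm_num

/-- The rational point has no indeterminacy at `O`: it is integral in the chart with coordinates
`(s, c)`, or in the chart at infinity with coordinates `(1/s, c/s)`. If numerator and denominator of
`s` were both nonunits, they would give a solution of the Fermat cubic excluded by the descent; when
the maximal ideal is principal, coprime nonunits do not exist at all. -/
lemma exists_lift_or_inv {O F : Type} [CommRing O] [IsDomain O] [IsRegularLocalRing O]
    (hd : ringKrullDim O ≤ 2) (h3 : IsUnit (3 : O)) (hω : ∃ ω : O, ω ^ 2 + ω + 1 = 0)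
    (hcube : ∀ u : O, IsUnit u → ∃ t, t ^ 3 - u ∈ maximalIdeal O)
    [Field F] [Algebra O F] [IsFractionRing O F] {s c : F} (h : c ^ 3 = s * (1 - s)) :
    (∃ s₀ c₀ : O, algebraMap O F s₀ = s ∧ algebraMap O F c₀ = c) ∨
      ∃ w c₀ : O, algebraMap O F w * s = 1 ∧ algebraMap O F c₀ * s = c := by
  obtain ⟨_, key⟩ : UniqueFactorizationMonoid O ∧ ∀ a b c u v : O, IsUnit u → IsUnit v →
      a ∈ maximalIdeal O → b ∈ maximalIdeal O → IsRelPrime a b →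
      a ^ 3 + u * b ^ 3 ≠ v * c ^ 3 := by
    obtain ⟨t, ht⟩ | ⟨x, y, hxy⟩ := IsRegularLocalRing.isPrincipal_or_isRegularPair hd
    · have : IsPrincipalIdealRing O :=
        ((tfae_of_isNoetherianRing_of_isLocalRing_of_isDomain O).out 4 0 :
          (maximalIdeal O).IsPrincipal ↔ IsPrincipalIdealRing O).mp ⟨t, ht⟩
      refine ⟨inferInstance, fun a b c u v _ _ ha hb hab _ => ?_⟩
      rw [ht, Ideal.mem_span_singleton] at ha hb
      have h1 : t ∈ maximalIdeal O := by rw [ht]; exact Ideal.mem_span_singleton_self t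
      exact h1 (hab ha hb)
    · exact ⟨hxy.uniqueFactorizationMonoid, fun a b c u v hu hv ha hb hab =>
        hxy.not_cube_add_cube_eq h3 hω hcube hu hv ha hb hab⟩
  have hinj := IsFractionRing.injective O F
  have hint : ∀ (z : F) (w : O), z ^ 3 = algebraMap O F w → ∃ z₀ : O, algebraMap O F z₀ = z := by
    intro z w hz
    exact IsIntegrallyClosed.exists_algebraMap_eq_of_isIntegral_pow (n := 3) (by norm_num)
      (hz ▸ isIntegral_algebraMap)
  obtain ⟨p, q, hpq, rfl⟩ := IsFractionRing.exists_reduced_fraction O s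
  have hq0 : algebraMap O F q ≠ 0 := by simp
  rw [IsFractionRing.mk'_eq_div] at h ⊢
  -- The cube of `c q` is `p (q - p) q`, so `c q` lies in the integrally closed ring `O`. The three
  -- coprime factors are then cubes up to units.
  obtain ⟨b, hb⟩ := hint (c * algebraMap O F q) (p * (q - p) * q) (by
    rw [mul_pow, h]
    simp only [map_mul, map_sub]
    field_simp)
  have hb3 : p * (q - p) * q = b ^ 3 := by
    apply hinj
    rw [map_pow, hb, mul_pow, h]
    simp only [map_mul, map_sub]
    field_simp
  obtain ⟨q', hq'⟩ := q
  dsimp only at *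
  have hr1 : IsRelPrime p (q' - p) := fun d h1 h2 => hpq h1 (by simpa using dvd_add h2 h1)
  have hr2 : IsRelPrime q' (q' - p) := fun d h1 h2 => hpq (by simpa using dvd_sub h1 h2) h1
  obtain ⟨α, u₁, hα⟩ := exists_associated_pow_three (hr1.mul_right hpq) isUnit_one
    (c := b) (by rw [← hb3]; ring)
  obtain ⟨β, u₂, hβ⟩ := exists_associated_pow_three (hr2.mul_right hpq.symm) isUnit_one
    (c := b) (by rw [← hb3]; ring)
  obtain ⟨γ, u₃, hγ⟩ := exists_associated_pow_three (hr1.symm.mul_right hr2.symm) isUnit_one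
    (c := b) (by rw [← hb3]; ring)
  have hαγ : IsRelPrime α γ := by
    refine (hr1.of_dvd_left ?_).of_dvd_right ?_
    · rw [← hα]; exact (dvd_pow_self α three_ne_zero).mul_right _
    · rw [← hγ]; exact (dvd_pow_self γ three_ne_zero).mul_right _
  have hor : IsUnit p ∨ IsUnit q' := by
    by_contra! hnu
    have hpm : p ∈ maximalIdeal O := hnu.1
    have hqm : q' ∈ maximalIdeal O := hnu.2
    have hαm : α ∈ maximalIdeal O := by
      rw [← hα, Ideal.mul_unit_mem_iff_mem _ u₁.isUnit] at hpm
      exact (maximalIdeal.isMaximal O).isPrime.mem_of_pow_mem 3 hpm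
    have hγm : γ ∈ maximalIdeal O := by
      have h1 := sub_mem hqm hpm
      rw [← hγ, Ideal.mul_unit_mem_iff_mem _ u₃.isUnit] at h1
      exact (maximalIdeal.isMaximal O).isPrime.mem_of_pow_mem 3 h1
    -- The excluded equation is `p + (q - p) = q`, divided by the unit of `p = α³ u₁`.
    refine key α γ β ((u₁⁻¹ : Oˣ) * u₃) ((u₁⁻¹ : Oˣ) * u₂) (u₁⁻¹.isUnit.mul u₃.isUnit)
      (u₁⁻¹.isUnit.mul u₂.isUnit) hαm hγm hαγ ?_
    have hinv : ((u₁⁻¹ : Oˣ) : O) * u₁ = 1 := u₁.inv_mul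
    linear_combination (-α ^ 3) * hinv + ((u₁⁻¹ : Oˣ) : O) * (hα + hγ - hβ)
  obtain ⟨p', hp'⟩ | ⟨q'', hq''⟩ := hor.imp IsUnit.exists_left_inv IsUnit.exists_left_inv
  · have hp0 : algebraMap O F p' * algebraMap O F p = 1 := by rw [← map_mul, hp', map_one]
    have hp0' : algebraMap O F p ≠ 0 := right_ne_zero_of_mul_eq_one hp0
    refine Or.inr ⟨p' * q', ?_⟩
    -- With `w = 1/s`, the equation of the curve becomes `(c w)³ = w² - w`, so `c w` is integral.
    obtain ⟨c₀, hc₀⟩ := hint (c * (algebraMap O F p' * algebraMap O F q'))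
      ((p' * q') ^ 2 - p' * q') (by
        rw [mul_pow, h]
        simp only [map_mul, map_sub, map_pow]
        rw [eq_inv_of_mul_eq_one_left hp0]
        field_simp)
    refine ⟨c₀, ?_, ?_⟩
    · rw [map_mul, eq_inv_of_mul_eq_one_left hp0]; field_simp
    · rw [hc₀, eq_inv_of_mul_eq_one_left hp0]; field_simp
  · have hq1 : algebraMap O F q'' * algebraMap O F q' = 1 := by rw [← map_mul, hq'', map_one]
    refine Or.inl ⟨p * q'', ?_⟩
    obtain ⟨c₀, hc₀⟩ := hint c (p * q'' * (1 - p * q'')) (by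
      rw [h]
      simp only [map_mul, map_sub, map_one]
      rw [eq_inv_of_mul_eq_one_left hq1, div_eq_mul_inv])
    exact ⟨c₀, by rw [map_mul, eq_inv_of_mul_eq_one_left hq1, div_eq_mul_inv], hc₀⟩

end LocalExtension

/-! ### Points of Proj given by homogeneous coordinates -/

section ProjPoints

namespace AlgebraicGeometry.Proj

open HomogeneousLocalization

variable {σ A : Type} [CommRing A] [SetLike σ A] [AddSubgroupClass σ A] {𝒜 : ℕ → σ} [GradedRing 𝒜]
variable {R : Type} [CommRing R]

/-- The homomorphism on the degree zero part of `A[1/t]` induced by one on `A` that inverts `t`. -/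
noncomputable def awayHom (g : A →+* R) {t : A} (hu : IsUnit (g t)) : Away 𝒜 t →+* R :=
  (IsLocalization.Away.lift (S := Localization.Away t) t hu).comp
    (algebraMap (Away 𝒜 t) (Localization.Away t))

lemma awayHom_mk_mul (g : A →+* R) {t : A} (hu : IsUnit (g t)) {d : ℕ} (ht : t ∈ 𝒜 d) (n : ℕ)
    (x : A) (hx : x ∈ 𝒜 (n • d)) :
    awayHom g hu (Away.mk 𝒜 ht n x hx) * g t ^ n = g x := by
  rw [awayHom, RingHom.comp_apply, HomogeneousLocalization.algebraMap_apply, Away.val_mk,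
    Localization.mk_eq_mk', ← IsLocalization.Away.lift_eq (S := Localization.Away t) t hu x,
    ← IsLocalization.Away.lift_eq (S := Localization.Away t) t hu t, ← map_pow, ← map_pow,
    ← map_mul]
  congr 1
  exact IsLocalization.mk'_spec (Localization.Away t) x (⟨t ^ n, n, rfl⟩ : Submonoid.powers t)

lemma map_irrelevant_comp (g : A →+* R) {d : ℕ} (hd : 0 < d) {t : A} (ht : t ∈ 𝒜 d)
    (hu : IsUnit (g t)) :
    (HomogeneousIdeal.irrelevant 𝒜).toIdeal.map
      ((Scheme.ΓSpecIso (.of R)).inv.hom.comp g) = ⊤ :=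
  Ideal.eq_top_of_isUnit_mem _
    (Ideal.mem_map_of_mem _ (HomogeneousIdeal.mem_irrelevant_of_mem _ hd ht)) (hu.map (Scheme.ΓSpecIso (.of R)).inv.hom)

/-- Where `f t` is invertible, all of `X` lands in the chart of `t`, and the morphism becomes a ring
homomorphism from the degree zero part of `A[1/t]`. This makes such morphisms computable. -/
lemma fromOfGlobalSections_eq_toSpecΓ {X : Scheme.{0}} (f : A →+* Γ(X, ⊤))
    (hf : (HomogeneousIdeal.irrelevant 𝒜).toIdeal.map f = ⊤)
    {d : ℕ} (hd : 0 < d) {t : A} (ht : t ∈ 𝒜 d) (hu : IsUnit (f t)) :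
    fromOfGlobalSections 𝒜 f hf =
      X.toSpecΓ ≫ Spec.map (CommRingCat.ofHom (awayHom f hu)) ≫ awayι 𝒜 t ht hd := by
  have htop : X.basicOpen (f t) = ⊤ := Scheme.basicOpen_of_isUnit _ hu
  have : IsIso (X.basicOpen (f t)).ι := by
    rw [htop, ← Scheme.topIso_hom]; infer_instance
  rw [← cancel_epi (X.basicOpen (f t)).ι]
  have h1 := fromOfGlobalSections_resLE 𝒜 f hf hd ht
  have h2 : (X.basicOpen (f t)).ι ≫ fromOfGlobalSections 𝒜 f hf =
      toBasicOpenOfGlobalSections 𝒜 f rfl hd ht ≫ (basicOpen 𝒜 t).ι := by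
    rw [← h1, Scheme.Hom.resLE_comp_ι]
  rw [h2, toBasicOpenOfGlobalSections]
  simp only [Category.assoc, basicOpenIsoSpec_inv_ι]
  have hle : Submonoid.powers t ≤ (Submonoid.powers (f t)).comap f := by
    rw [← Submonoid.map_le_iff_le_comap, Submonoid.map_powers]
  have h3 : (IsLocalization.map (M := .powers t) (S := Localization.Away t) (T := .powers (f t))
      (Localization.Away (f t)) f hle).comp (algebraMap (Away 𝒜 t) (Localization.Away t)) =
      (algebraMap Γ(X, ⊤) (Localization.Away (f t))).comp (awayHom f hu) := by
    rw [awayHom, ← RingHom.comp_assoc]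
    congr 1
    refine IsLocalization.ringHom_ext (M := .powers t) ?_
    ext x
    simp
  have h4 : CommRingCat.ofHom ((IsLocalization.map (M := .powers t) (S := Localization.Away t)
      (T := .powers (f t)) (Localization.Away (f t)) f hle).comp
        (algebraMap (Away 𝒜 t) (Localization.Away t))) =
      CommRingCat.ofHom (awayHom f hu) ≫
        CommRingCat.ofHom (algebraMap Γ(X, ⊤) (Localization.Away (f t))) := by
    rw [h3]; rfl
  rw [h4, Spec.map_comp]
  simp only [Category.assoc, basicOpenIsoSpecAway]
  rw [IsOpenImmersion.isoOfRangeEq_hom_fac_assoc]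
  have h6 : (X.isoOfEq (X.toSpecΓ_preimage_basicOpen (f t))).inv ≫
      (X.toSpecΓ ∣_ (PrimeSpectrum.basicOpen (f t))) ≫
        Scheme.Opens.ι (X := Spec Γ(X, ⊤)) (PrimeSpectrum.basicOpen (f t)) =
      (X.basicOpen (f t)).ι ≫ X.toSpecΓ := by
    rw [morphismRestrict_ι X.toSpecΓ (PrimeSpectrum.basicOpen (f t))]
    simp [Scheme.isoOfEq_inv]
  have h7 := h6 =≫ (Spec.map (CommRingCat.ofHom (awayHom f hu)) ≫ awayι 𝒜 t ht hd)
  simp only [Category.assoc] at h7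
  exact h7

lemma fromOfGlobalSections_eq_awayι (g : A →+* R)
    (hg : (HomogeneousIdeal.irrelevant 𝒜).toIdeal.map
      ((Scheme.ΓSpecIso (.of R)).inv.hom.comp g) = ⊤)
    {d : ℕ} (hd : 0 < d) {t : A} (ht : t ∈ 𝒜 d) (hu : IsUnit (g t)) :
    fromOfGlobalSections 𝒜 ((Scheme.ΓSpecIso (.of R)).inv.hom.comp g) hg =
      Spec.map (CommRingCat.ofHom (awayHom g hu)) ≫ awayι 𝒜 t ht hd := by
  have h : awayHom (𝒜 := 𝒜) ((Scheme.ΓSpecIso (.of R)).inv.hom.comp g)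
      (hu.map (Scheme.ΓSpecIso (.of R)).inv.hom) =
      (Scheme.ΓSpecIso (.of R)).inv.hom.comp (awayHom g hu) := by
    rw [awayHom, awayHom, ← RingHom.comp_assoc]
    congr 1
    refine IsLocalization.ringHom_ext (M := .powers t) ?_
    ext x
    simp
  rw [fromOfGlobalSections_eq_toSpecΓ _ hg hd ht (hu.map (Scheme.ΓSpecIso (.of R)).inv.hom), h]
  have h5 : CommRingCat.ofHom ((Scheme.ΓSpecIso (.of R)).inv.hom.comp (awayHom g hu)) =
      CommRingCat.ofHom (awayHom (𝒜 := 𝒜) g hu) ≫ (Scheme.ΓSpecIso (.of R)).inv := rfl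
  rw [h5, Spec.map_comp, Category.assoc]
  simp

/-- The preimage of the basic open set of `t` depends only on the morphism, and it is everything
exactly when the value of `t` is a unit. -/
lemma isUnit_of_fromOfGlobalSections_eq (g g' : A →+* R)
    (hg : (HomogeneousIdeal.irrelevant 𝒜).toIdeal.map
      ((Scheme.ΓSpecIso (.of R)).inv.hom.comp g) = ⊤)
    (hg' : (HomogeneousIdeal.irrelevant 𝒜).toIdeal.map
      ((Scheme.ΓSpecIso (.of R)).inv.hom.comp g') = ⊤)
    (h : fromOfGlobalSections 𝒜 ((Scheme.ΓSpecIso (.of R)).inv.hom.comp g) hg =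
      fromOfGlobalSections 𝒜 ((Scheme.ΓSpecIso (.of R)).inv.hom.comp g') hg')
    {d : ℕ} (hd : 0 < d) {t : A} (ht : t ∈ 𝒜 d) (hu : IsUnit (g t)) : IsUnit (g' t) := by
  have h1 := fromOfGlobalSections_preimage_basicOpen 𝒜 _ hg hd ht
  have h2 := fromOfGlobalSections_preimage_basicOpen 𝒜 _ hg' hd ht
  rw [← h, h1, RingHom.comp_apply, Scheme.basicOpen_of_isUnit _ (hu.map (Scheme.ΓSpecIso (.of R)).inv.hom), RingHom.comp_apply,
    eq_comm, basicOpen_eq_of_affine] at h2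
  have h3 : PrimeSpectrum.basicOpen (1 : R) ≤ PrimeSpectrum.basicOpen (g' t) := by
    rw [h2]; exact le_top
  rw [PrimeSpectrum.basicOpen_le_basicOpen_iff] at h3
  obtain ⟨n, hn⟩ := h3
  rw [one_pow] at hn
  exact Ideal.span_singleton_eq_top.mp ((Ideal.eq_top_iff_one _).mpr hn)

lemma awayHom_eq_of_fromOfGlobalSections_eq (g g' : A →+* R)
    (hg : (HomogeneousIdeal.irrelevant 𝒜).toIdeal.map
      ((Scheme.ΓSpecIso (.of R)).inv.hom.comp g) = ⊤)
    (hg' : (HomogeneousIdeal.irrelevant 𝒜).toIdeal.map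
      ((Scheme.ΓSpecIso (.of R)).inv.hom.comp g') = ⊤)
    (h : fromOfGlobalSections 𝒜 ((Scheme.ΓSpecIso (.of R)).inv.hom.comp g) hg =
      fromOfGlobalSections 𝒜 ((Scheme.ΓSpecIso (.of R)).inv.hom.comp g') hg')
    {d : ℕ} (hd : 0 < d) {t : A} (ht : t ∈ 𝒜 d) (hu : IsUnit (g t)) (hu' : IsUnit (g' t)) :
    awayHom (𝒜 := 𝒜) g hu = awayHom g' hu' := by
  rw [fromOfGlobalSections_eq_awayι g hg hd ht hu, fromOfGlobalSections_eq_awayι g' hg' hd ht hu',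
    cancel_mono] at h
  exact congrArg CommRingCat.Hom.hom (Spec.map_injective h)

end AlgebraicGeometry.Proj

end ProjPoints

/-! ### Points of the plane cubic with values in rings and fields -/

section CurvePoints

namespace AlgebraicGeometry.Proj

open HomogeneousLocalization

lemma awayHom_comp_map {A B R : Type} [CommRing A] [CommRing B] [CommRing R] {σ τ : Type}
    [SetLike σ A] [AddSubgroupClass σ A] [SetLike τ B] [AddSubgroupClass τ B] {𝒜 : ℕ → σ}
    {ℬ : ℕ → τ} [GradedRing 𝒜] [GradedRing ℬ] (f : 𝒜 →+*ᵍ ℬ) (g : B →+* R) (g' : A →+* R)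
    (hg : ∀ a, g (f a) = g' a) {t : A} {d : ℕ} (ht : t ∈ 𝒜 d)
    (hu : IsUnit (g (f t))) (hu' : IsUnit (g' t)) :
    (awayHom (𝒜 := ℬ) g hu).comp (Away.map f t) = awayHom (𝒜 := 𝒜) g' hu' := by
  ext x
  obtain ⟨n, x, hx, rfl⟩ := x.mk_surjective _ ht
  rw [RingHom.comp_apply, Away.map_mk, ← (hu'.pow n).mul_left_inj, awayHom_mk_mul,
    ← hg t, awayHom_mk_mul, hg]

end AlgebraicGeometry.Proj

namespace EquianharmonicCurve

open HomogeneousLocalization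

/-- The homogeneous coordinates on the curve. -/
noncomputable abbrev coord (i : Fin 3) : CoordRing := proj (X i)

lemma coord_mem (i : Fin 3) : coord i ∈ grading 1 := ⟨X i, isHomogeneous_X _ _, rfl⟩

/-- The ratio of two homogeneous coordinates. -/
noncomputable abbrev coordRatio (i j : Fin 3) : Away grading (coord i) :=
  Away.mk grading (coord_mem i) 1 (coord j) (by simpa using coord_mem j)

/-- The constants on a chart of the curve. -/
noncomputable abbrev constHom (i : Fin 3) : ℂ →+* Away grading (coord i) :=
  (fromZeroRingHom grading _).comp (algebraMap ℂ (grading 0))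

/-- Dividing a form of degree `n` by the `n`-th power of a coordinate evaluates it at the coordinate
ratios. So constants and ratios generate the ring of a chart, and a homomorphism from it is
determined on them. -/
lemma mk_proj_eq_eval₂ (i : Fin 3) (n : ℕ) (p : MvPolynomial (Fin 3) ℂ) (hp : p.IsHomogeneous n)
    (hx : proj p ∈ grading (n • 1)) :
    Away.mk grading (coord_mem i) n (proj p) hx = eval₂ (constHom i) (coordRatio i) p := by
  apply HomogeneousLocalization.val_injective
  have hval : ∀ q : MvPolynomial (Fin 3) ℂ,
      (eval₂ (constHom i) (coordRatio i) q).val =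
        eval₂ ((algebraMap CoordRing (Localization.Away (coord i))).comp (algebraMap ℂ CoordRing))
          (fun j => (coordRatio i j).val) q := by
    intro q
    rw [← HomogeneousLocalization.algebraMap_apply, hom_eval₂]
    congr 1
  rw [hval, Away.val_mk, Localization.mk_eq_mk', eq_comm, IsLocalization.eq_mk'_iff_mul_eq]
  have h1 : proj p = eval₂ (algebraMap ℂ CoordRing) coord p := by
    have : proj = aeval (R := ℂ) coord := by ext j : 1; simp
    rw [this]; rfl
  rw [h1, hom_eval₂, eval₂_eq, eval₂_eq, Finset.sum_mul]
  refine Finset.sum_congr rfl fun d hd => ?_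
  rw [mul_assoc]
  congr 1
  have hdeg : n = ∑ j ∈ d.support, d j := by
    have := hp (mem_support_iff.mp hd)
    rw [← this, Finsupp.weight_apply]; simp [Finsupp.sum]
  rw [map_pow, hdeg, ← Finset.prod_pow_eq_pow_sum, ← Finset.prod_mul_distrib]
  refine Finset.prod_congr rfl fun j _ => ?_
  rw [← mul_pow]
  congr 1
  rw [Away.val_mk, Localization.mk_eq_mk']
  convert! IsLocalization.mk'_spec (Localization.Away (coord i)) (coord j)
    (⟨coord i ^ 1, 1, rfl⟩ : Submonoid.powers (coord i)) using 3
  exact (pow_one _).symm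

variable {R S : Type} [CommRing R] [CommRing S]

lemma away_ringHom_ext {i : Fin 3} {θ θ' : Away grading (coord i) →+* R}
    (h : ∀ a, θ (constHom i a) = θ' (constHom i a))
    (h' : ∀ j, θ (coordRatio i j) = θ' (coordRatio i j)) : θ = θ' := by
  ext x
  obtain ⟨n, x, hx, rfl⟩ := x.mk_surjective _ (coord_mem i)
  obtain ⟨p, hp, rfl⟩ : x ∈ grading n := by simpa using hx
  have := mk_proj_eq_eval₂ i n p hp hx
  change θ (Away.mk grading (coord_mem i) n (proj p) hx) =
    θ' (Away.mk grading (coord_mem i) n (proj p) hx)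
  rw [this, hom_eval₂, hom_eval₂]
  congr 1
  · ext a; exact h a
  · ext j; exact h' j

variable [Algebra ℂ R] [Algebra ℂ S]

/-- Evaluation of the coordinate ring at a solution of the equation of the curve. -/
noncomputable def evalAt (v : Fin 3 → R) (h : v 1 ^ 3 = v 0 * v 2 * (v 2 - v 0)) :
    CoordRing →ₐ[ℂ] R :=
  Ideal.Quotient.liftₐ ideal (aeval v) <| by
    intro a ha
    obtain ⟨b, rfl⟩ := Ideal.mem_span_singleton'.mp ha
    simp [cubic, h]

lemma evalAt_proj (v : Fin 3 → R) (h : v 1 ^ 3 = v 0 * v 2 * (v 2 - v 0))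
    (p : MvPolynomial (Fin 3) ℂ) : evalAt v h (proj p) = aeval v p := rfl

lemma evalAt_coord (v : Fin 3 → R) (h : v 1 ^ 3 = v 0 * v 2 * (v 2 - v 0)) (i : Fin 3) :
    evalAt v h (coord i) = v i := by rw [evalAt_proj, aeval_X]

lemma isUnit_evalAt (v : Fin 3 → R) (h : v 1 ^ 3 = v 0 * v 2 * (v 2 - v 0)) {i : Fin 3}
    (hu : IsUnit (v i)) : IsUnit ((evalAt v h).toRingHom (coord i)) := by
  change IsUnit (evalAt v h (coord i))
  rwa [evalAt_coord]

/-- The `R`-valued point of the curve with the homogeneous coordinates `v`. -/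
noncomputable def point (v : Fin 3 → R) (h : v 1 ^ 3 = v 0 * v 2 * (v 2 - v 0))
    (hu : ∃ i, IsUnit (v i)) : Spec (.of R) ⟶ curve :=
  Proj.fromOfGlobalSections grading
    ((Scheme.ΓSpecIso (.of R)).inv.hom.comp (evalAt v h).toRingHom)
    (Proj.map_irrelevant_comp _ one_pos (coord_mem hu.choose) (isUnit_evalAt v h hu.choose_spec))

lemma affinePoint_eq_point (s c : R) (h : c ^ 3 = s * (1 - s)) :
    affinePoint s c h = point ![s, c, 1] (by simpa using h) ⟨2, isUnit_one⟩ := rfl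

/-- The affine chart of the curve where a homogeneous coordinate does not vanish. -/
noncomputable def chart (i : Fin 3) : Spec (.of (Away grading (coord i))) ⟶ curve :=
  Proj.awayι grading (coord i) (coord_mem i) one_pos

instance (i : Fin 3) : IsOpenImmersion (chart i) :=
  inferInstanceAs (IsOpenImmersion (Proj.awayι grading (coord i) (coord_mem i) one_pos))

lemma chart_curveToC (i : Fin 3) :
    chart i ≫ curveToC = Spec.map (CommRingCat.ofHom (constHom i)) :=
  (Proj.awayι_toSpecZero_assoc grading (coord i) (coord_mem i) one_pos _).trans
    (Spec.map_comp _ _).symm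

lemma point_eq_chart (v : Fin 3 → R) (h : v 1 ^ 3 = v 0 * v 2 * (v 2 - v 0)) {i : Fin 3}
    (hu : IsUnit (v i)) :
    point v h ⟨i, hu⟩ =
      Spec.map (CommRingCat.ofHom (Proj.awayHom (evalAt v h).toRingHom (isUnit_evalAt v h hu))) ≫
        chart i :=
  Proj.fromOfGlobalSections_eq_awayι ..

lemma awayHom_evalAt_constHom (v : Fin 3 → R) (h : v 1 ^ 3 = v 0 * v 2 * (v 2 - v 0)) {i : Fin 3}
    (hu : IsUnit (v i)) (a : ℂ) :
    Proj.awayHom (evalAt v h).toRingHom (isUnit_evalAt v h hu) (constHom i a) =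
      algebraMap ℂ R a := by
  have h1 : constHom i a = Away.mk grading (coord_mem i) 0 (algebraMap ℂ CoordRing a)
      (by simpa using (algebraMap ℂ (grading 0) a).2) := by
    apply HomogeneousLocalization.val_injective
    rw [Away.val_mk]; simp; rfl
  have h2 := Proj.awayHom_mk_mul (evalAt v h).toRingHom (isUnit_evalAt v h hu) (coord_mem i) 0
    (algebraMap ℂ CoordRing a) (by simpa using (algebraMap ℂ (grading 0) a).2)
  rw [h1, ← (evalAt v h).commutes a]
  simpa using h2

lemma awayHom_evalAt_coordRatio (v : Fin 3 → R) (h : v 1 ^ 3 = v 0 * v 2 * (v 2 - v 0)) {i : Fin 3}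
    (hu : IsUnit (v i)) (j : Fin 3) :
    Proj.awayHom (evalAt v h).toRingHom (isUnit_evalAt v h hu) (coordRatio i j) * v i = v j := by
  have h2 := Proj.awayHom_mk_mul (evalAt v h).toRingHom (isUnit_evalAt v h hu) (coord_mem i) 1
    (coord j) (by simpa using coord_mem j)
  rw [pow_one] at h2
  change _ * evalAt v h (coord i) = evalAt v h (coord j) at h2
  rwa [evalAt_coord, evalAt_coord] at h2

lemma SpecMap_point (φ : R →ₐ[ℂ] S) (v : Fin 3 → R) (h : v 1 ^ 3 = v 0 * v 2 * (v 2 - v 0))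
    (hu : ∃ i, IsUnit (v i)) (h' : φ (v 1) ^ 3 = φ (v 0) * φ (v 2) * (φ (v 2) - φ (v 0))) :
    Spec.map (CommRingCat.ofHom φ.toRingHom) ≫ point v h hu =
      point (fun i => φ (v i)) h' (hu.imp fun _ hi => hi.map φ) := by
  obtain ⟨i, hi⟩ := hu
  rw [point_eq_chart v h hi, point_eq_chart _ h' (hi.map φ), ← Category.assoc, ← Spec.map_comp]
  congr 2
  ext1
  refine away_ringHom_ext (fun a => ?_) fun j => ?_
  · refine Eq.trans ?_ (awayHom_evalAt_constHom (fun i => φ (v i)) h' (hi.map φ) a).symm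
    exact (congrArg φ (awayHom_evalAt_constHom v h hi a)).trans (φ.commutes a)
  · have h1 := awayHom_evalAt_coordRatio v h hi j
    have h2 := awayHom_evalAt_coordRatio (fun i => φ (v i)) h' (hi.map φ) j
    refine (hi.map φ).mul_left_inj.mp (Eq.trans ?_ h2.symm)
    rw [← h1, map_mul]
    rfl

lemma point_eq_of_mul_eq (v v' : Fin 3 → R) (h : v 1 ^ 3 = v 0 * v 2 * (v 2 - v 0))
    (hu : ∃ i, IsUnit (v i)) (h' : v' 1 ^ 3 = v' 0 * v' 2 * (v' 2 - v' 0))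
    (hu' : ∃ i, IsUnit (v' i)) (u : R) (hu₀ : IsUnit u) (e : ∀ i, v' i = u * v i) :
    point v h hu = point v' h' hu' := by
  obtain ⟨i, hi⟩ := hu
  have hi' : IsUnit (v' i) := by rw [e]; exact hu₀.mul hi
  rw [point_eq_chart v h hi, point_eq_chart v' h' hi']
  congr 2
  ext1
  refine away_ringHom_ext (fun a => ?_) fun j => ?_
  · exact (awayHom_evalAt_constHom v h hi a).trans (awayHom_evalAt_constHom v' h' hi' a).symm
  · have h1 := awayHom_evalAt_coordRatio v h hi j
    have h2 := awayHom_evalAt_coordRatio v' h' hi' j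
    refine hi'.mul_left_inj.mp (Eq.trans ?_ h2.symm)
    rw [e j, ← h1, e i]
    exact mul_left_comm _ _ _

/-- Equal points lie in the same chart, where their coordinate ratios agree; the proportionality
factor is the quotient of the invertible coordinates. With `point_eq_of_mul_eq`, such points are
coordinate vectors up to units. -/
lemma mul_eq_mul_of_point_eq (v v' : Fin 3 → R) (h : v 1 ^ 3 = v 0 * v 2 * (v 2 - v 0))
    (hu : ∃ i, IsUnit (v i)) (h' : v' 1 ^ 3 = v' 0 * v' 2 * (v' 2 - v' 0))
    (hu' : ∃ i, IsUnit (v' i)) (e : point v h hu = point v' h' hu') :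
    ∃ u, IsUnit u ∧ ∀ i, v' i = u * v i := by
  obtain ⟨i, hi⟩ := hu
  have hi' : IsUnit (v' i) := by
    have := Proj.isUnit_of_fromOfGlobalSections_eq _ _ _ _ e one_pos (coord_mem i)
      (isUnit_evalAt v h hi)
    change IsUnit (evalAt v' h' (coord i)) at this
    rwa [evalAt_coord] at this
  have h1 := Proj.awayHom_eq_of_fromOfGlobalSections_eq _ _ _ _ e one_pos (coord_mem i)
    (isUnit_evalAt v h hi) (isUnit_evalAt v' h' hi')
  obtain ⟨w, hw⟩ := hi.exists_left_inv
  refine ⟨v' i * w, hi'.mul (IsUnit.of_mul_eq_one _ hw), fun j => ?_⟩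
  have h2 := awayHom_evalAt_coordRatio v h hi j
  have h3 := awayHom_evalAt_coordRatio v' h' hi' j
  rw [h1] at h2
  rw [← h2, ← h3]
  linear_combination (- v' i * Proj.awayHom (evalAt v' h').toRingHom (isUnit_evalAt v' h' hi')
    (coordRatio i j)) * hw

lemma point_curveToC (v : Fin 3 → R) (h : v 1 ^ 3 = v 0 * v 2 * (v 2 - v 0))
    (hu : ∃ i, IsUnit (v i)) :
    point v h hu ≫ curveToC = Spec.map (CommRingCat.ofHom (algebraMap ℂ R)) := by
  obtain ⟨i, hi⟩ := hu
  rw [point_eq_chart v h hi, Category.assoc, chart_curveToC, ← Spec.map_comp]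
  congr 1
  ext a
  exact awayHom_evalAt_constHom v h hi a

lemma point_deck (v : Fin 3 → R) (h : v 1 ^ 3 = v 0 * v 2 * (v 2 - v 0))
    (hu : ∃ i, IsUnit (v i))
    (h' : (![v 0, algebraMap ℂ R omega * v 1, v 2] : Fin 3 → R) 1 ^ 3 =
      (![v 0, algebraMap ℂ R omega * v 1, v 2] : Fin 3 → R) 0 *
      (![v 0, algebraMap ℂ R omega * v 1, v 2] : Fin 3 → R) 2 *
      ((![v 0, algebraMap ℂ R omega * v 1, v 2] : Fin 3 → R) 2 -
        (![v 0, algebraMap ℂ R omega * v 1, v 2] : Fin 3 → R) 0))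
    (hu' : ∃ i, IsUnit ((![v 0, algebraMap ℂ R omega * v 1, v 2] : Fin 3 → R) i)) :
    point v h hu ≫ EquianharmonicCurve.deck =
      point ![v 0, algebraMap ℂ R omega * v 1, v 2] h' hu' := by
  obtain ⟨i, hi⟩ := hu'
  have hrot : ∀ a, (evalAt v h).toRingHom (rot a) = (evalAt _ h').toRingHom a := by
    intro a
    obtain ⟨p, rfl⟩ := Ideal.Quotient.mk_surjective a
    change aeval v (rotPoly p) = aeval ![v 0, algebraMap ℂ R omega * v 1, v 2] p
    rw [← AlgHom.comp_apply]
    congr 1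
    ext j : 1
    fin_cases j <;> simp [rotPoly]
  have hi₁ := isUnit_evalAt _ h' hi
  have hi₂ := hi₁
  rw [← hrot] at hi₂
  -- The deck transformation pulls the chart of a coordinate back to that of the substituted
  -- coordinate, so the point before the transformation is described in the latter.
  have h1 : point v h hu = Spec.map (CommRingCat.ofHom (Proj.awayHom (evalAt v h).toRingHom hi₂)) ≫
      Proj.awayι grading (rot (coord i)) (rot.2 (coord_mem i)) one_pos :=
    Proj.fromOfGlobalSections_eq_awayι ..
  let ι : Spec (.of (Away grading (rot (coord i)))) ⟶ curve :=
    Proj.awayι grading (rot (coord i)) (rot.2 (coord_mem i)) one_pos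
  have h2 : ι ≫ EquianharmonicCurve.deck =
      Spec.map (CommRingCat.ofHom (Away.map rot (coord i))) ≫ chart i :=
    Proj.awayι_comp_map rot rot_irrelevant one_pos _ (coord_mem i)
  rw [h1, point_eq_chart _ h' hi]
  refine (Category.assoc _ ι _).trans ?_
  rw [h2, ← Category.assoc, ← Spec.map_comp]
  congr 2
  ext1
  exact Proj.awayHom_comp_map rot _ _ hrot (coord_mem i) hi₂ hi₁

lemma irrelevant_le_span_coord :
    (HomogeneousIdeal.irrelevant grading).toIdeal ≤ Ideal.span (Set.range coord) := by
  rw [HomogeneousIdeal.toIdeal_irrelevant_le]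
  rintro n hn _ ⟨p, hp, rfl⟩
  have h1 : p ∈ Ideal.span (Set.range (X : Fin 3 → MvPolynomial (Fin 3) ℂ)) := by
    rw [← Set.image_univ, mem_ideal_span_X_image]
    intro m hm
    by_contra! hc
    have h0 : m = 0 := by ext j; simpa using hc j
    have := hp (mem_support_iff.mp hm)
    rw [h0] at this
    simp at this
    omega
  have h2 := Ideal.mem_map_of_mem proj h1
  rw [Ideal.map_span, ← Set.range_comp] at h2
  exact h2

/-- Over a field, every point of the curve has homogeneous coordinates. -/
lemma exists_eq_point {K : Type} [Field K] [Algebra ℂ K] (ψ : Spec (.of K) ⟶ curve)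
    (hψ : ψ ≫ curveToC = Spec.map (CommRingCat.ofHom (algebraMap ℂ K))) :
    ∃ v h hu, ψ = point (R := K) v h hu := by
  let x : Spec (.of K) := default
  -- The spectrum of a field is one point, so its image lies in a single chart; the ratios there
  -- serve as coordinates.
  have hx : ψ x ∈ (⨆ i, Proj.basicOpen grading (coord i) : (Proj grading).Opens) := by
    rw [Proj.iSup_basicOpen_eq_top grading coord irrelevant_le_span_coord]; trivial
  obtain ⟨i, hi⟩ := TopologicalSpace.Opens.mem_iSup.mp hx
  let ι := chart i
  have hr : Set.range ψ ⊆ Set.range ι := by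
    rintro _ ⟨y, rfl⟩
    have hy : y = x := Subsingleton.elim _ _
    have h1 : ψ x ∈ ι.opensRange := by
      have h2 : ι.opensRange = Proj.basicOpen grading (coord i) := Proj.opensRange_awayι ..
      rw [h2]; exact hi
    rw [hy]; exact h1
  let θ := Spec.preimage (IsOpenImmersion.lift ι ψ hr)
  have hθ : Spec.map θ ≫ ι = ψ := by rw [Spec.map_preimage, IsOpenImmersion.lift_fac]
  have hc : ∀ a, θ.hom (constHom i a) = algebraMap ℂ K a := by
    intro a
    rw [← hθ, Category.assoc, chart_curveToC, ← Spec.map_comp] at hψ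
    exact congrArg (fun f => f.hom a) (Spec.map_injective hψ)
  have hii : coordRatio i i = 1 := by
    apply HomogeneousLocalization.val_injective
    rw [Away.val_mk, HomogeneousLocalization.val_one, Localization.mk_eq_mk']
    exact (IsLocalization.mk'_eq_iff_eq_mul).mpr (by rw [one_mul]; exact congrArg _ (pow_one _).symm)
  let v : Fin 3 → K := fun j => θ.hom (coordRatio i j)
  have hvi : v i = 1 := by simp [v, hii]
  have h : v 1 ^ 3 = v 0 * v 2 * (v 2 - v 0) := by
    have h3 := mk_proj_eq_eval₂ i 3 cubic cubic_isHomogeneous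
      ⟨cubic, by simpa using cubic_isHomogeneous, rfl⟩
    have h4 : proj cubic = 0 := Ideal.Quotient.eq_zero_iff_mem.mpr (Ideal.mem_span_singleton_self _)
    have h5 : eval₂ (constHom i) (coordRatio i) cubic = 0 := by
      rw [← h3]
      apply HomogeneousLocalization.val_injective
      refine (Away.val_mk ..).trans ?_
      rw [h4, Localization.mk_zero, HomogeneousLocalization.val_zero]
    have h6 := congrArg θ.hom h5
    rw [hom_eval₂] at h6
    simpa [cubic, sub_eq_zero, v] using h6
  have hvu : IsUnit (v i) := by rw [hvi]; exact isUnit_one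
  refine ⟨v, h, ⟨i, hvu⟩, ?_⟩
  rw [point_eq_chart v h hvu, ← hθ]
  congr 2
  ext1
  refine away_ringHom_ext (fun a => ?_) fun j => ?_
  · rw [hc]; exact (awayHom_evalAt_constHom v h hvu a).symm
  · have := awayHom_evalAt_coordRatio v h hvu j
    exact ((mul_one _).symm.trans ((congrArg _ hvi.symm).trans this)).symm

instance : curve.IsSeparated := inferInstanceAs (Proj grading).IsSeparated

/-- Forms of degree zero are constants. This gives that the curve is locally of finite type over `ℂ`
and not merely over the degree zero part. -/
lemma algebraMap_grading_zero_surjective :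
    Function.Surjective (algebraMap ℂ (grading 0)) := by
  rintro ⟨_, p, hp, rfl⟩
  have hp' : p.totalDegree = 0 := by
    by_cases h : p = 0
    · simp [h]
    · exact IsHomogeneous.totalDegree hp h
  obtain ⟨a, rfl⟩ : ∃ a, p = C a := ⟨_, totalDegree_eq_zero_iff_eq_C.mp hp'⟩
  exact ⟨a, Subtype.ext rfl⟩

instance : LocallyOfFiniteType curveToC := by
  have : Algebra.FiniteType (grading 0) CoordRing :=
    RingHom.finiteType_algebraMap.mp <| RingHom.FiniteType.of_comp_finiteType
      (f := algebraMap ℂ (grading 0))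
      (RingHom.finiteType_algebraMap (A := ℂ) (B := CoordRing).mpr inferInstance)
  have h2 : LocallyOfFiniteType (Spec.map (CommRingCat.ofHom (algebraMap ℂ (grading 0)))) := by
    rw [HasRingHomProperty.Spec_iff (P := @LocallyOfFiniteType)]
    exact RingHom.FiniteType.of_surjective _ algebraMap_grading_zero_surjective
  exact inferInstanceAs (LocallyOfFiniteType (Proj.toSpecZero grading ≫ _))

end EquianharmonicCurve

end CurvePoints

/-! ### Extending rational maps from local rings -/

section Extension

namespace AlgebraicGeometry

variable {X Y S : Scheme.{0}}

instance isDominant_fromSpecStalk_genericPoint [IrreducibleSpace X] :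
    IsDominant (X.fromSpecStalk (genericPoint X)) where
  denseRange := by
    refine Dense.mono ?_ (dense_iff_closure_eq.mpr (genericPoint_spec X))
    rw [Set.singleton_subset_iff, Scheme.range_fromSpecStalk]
    exact specializes_rfl

/-- Morphisms from an integral scheme to a separated one are determined at the generic point. -/
lemma hom_ext_of_genericPoint [IsIntegral X] [Y.IsSeparated] {φ ψ : X ⟶ Y}
    (h : X.fromSpecStalk (genericPoint X) ≫ φ = X.fromSpecStalk (genericPoint X) ≫ ψ) : φ = ψ :=
  ext_of_isDominant (X.fromSpecStalk (genericPoint X)) h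

lemma Scheme.PartialMap.stalkSpecializes_fromSpecStalkOfMem (f : X.PartialMap Y) {x y : X}
    (h : x ⤳ y) (hx : x ∈ f.domain) (hy : y ∈ f.domain) :
    Spec.map (X.presheaf.stalkSpecializes h) ≫ f.fromSpecStalkOfMem hy =
      f.fromSpecStalkOfMem hx := by
  rw [PartialMap.fromSpecStalkOfMem, PartialMap.fromSpecStalkOfMem, ← Category.assoc]
  congr 1
  rw [← cancel_mono f.domain.ι]
  simp

/-- A rational map that is defined at all closed points is a morphism. -/
lemma exists_extension [IsIntegral X] [CompactSpace X] [Y.IsSeparated] [S.IsSeparated]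
    (sX : X ⟶ S) (sY : Y ⟶ S) [LocallyOfFiniteType sY] (f : Spec X.functionField ⟶ Y)
    (hf : f ≫ sY = X.fromSpecStalk (genericPoint X) ≫ sX)
    (hext : ∀ x : X, IsClosed {x} → ∃ g : Spec (X.presheaf.stalk x) ⟶ Y,
      g ≫ sY = X.fromSpecStalk x ≫ sX ∧
        Spec.map (X.presheaf.stalkSpecializes (genericPoint_specializes x)) ≫ g = f) :
    ∃ φ : X ⟶ Y, X.fromSpecStalk (genericPoint X) ≫ φ = f ∧ φ ≫ sY = sX := by
  let r : X.RationalMap Y := Scheme.RationalMap.ofFunctionField sX sY f hf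
  have hr : r.fromFunctionField = f := Scheme.RationalMap.fromFunctionField_ofFunctionField ..
  have hdom : r.domain = ⊤ := by
    by_contra hne
    have hc : IsClosed ((r.domain : Set X)ᶜ) := r.domain.isOpen.isClosed_compl
    have hne' : ((r.domain : Set X)ᶜ).Nonempty := by
      rw [Set.nonempty_compl]
      intro h
      exact hne (TopologicalSpace.Opens.ext h)
    -- A nonempty closed subset of a quasi-compact space contains a closed point. There the given
    -- map on the local ring spreads out to a neighbourhood and agrees with the rational map at the
    -- generic point, so `x` lies in the domain after all.
    obtain ⟨x, hx, hx'⟩ := hc.exists_closed_singleton hne'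
    obtain ⟨g, hg, hg'⟩ := hext x hx'
    let p := Scheme.PartialMap.ofFromSpecStalk sX sY g hg
    have hxp : x ∈ p.domain := Scheme.PartialMap.mem_domain_ofFromSpecStalk ..
    refine hx (Scheme.RationalMap.mem_domain.mpr ⟨p, hxp, ?_⟩)
    apply Scheme.RationalMap.eq_of_fromFunctionField_eq
    rw [hr, Scheme.RationalMap.fromFunctionField_toRationalMap, ← hg',
      Scheme.PartialMap.fromFunctionField,
      ← p.stalkSpecializes_fromSpecStalkOfMem (genericPoint_specializes x) _ hxp]
    congr 1
    exact Scheme.PartialMap.fromSpecStalkOfMem_ofFromSpecStalk sX sY g hg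
  obtain ⟨q, hq, hqr⟩ : ∃ q : X.PartialMap Y, q.domain = ⊤ ∧ q.toRationalMap = r :=
    ⟨r.toPartialMap, hdom, r.toRationalMap_toPartialMap⟩
  have hqf : q.fromFunctionField = f := by
    rw [← hr, ← hqr, Scheme.RationalMap.fromFunctionField_toRationalMap]
  have hiso : IsIso q.domain.ι := by
    rw [hq, ← Scheme.topIso_hom]; infer_instance
  have h1 : X.fromSpecStalk (genericPoint X) ≫ inv q.domain.ι ≫ q.hom = f := by
    have h2 := Scheme.Opens.fromSpecStalkOfMem_ι q.domain (genericPoint X) (by rw [hq]; trivial)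
    rw [← h2, Category.assoc, IsIso.hom_inv_id_assoc, ← hqf]
    rfl
  refine ⟨inv q.domain.ι ≫ q.hom, h1, hom_ext_of_genericPoint ?_⟩
  rw [← Category.assoc, h1, hf]

end AlgebraicGeometry

end Extension

/-! ### Dimension and transcendence degree -/

section Dimension

/-- Incomparability: contraction of primes along an integral extension is strictly monotone. -/
lemma ringKrullDim_le_of_isIntegral (R S : Type*) [CommRing R] [CommRing S] [Algebra R S]
    [Algebra.IsIntegral R S] : ringKrullDim S ≤ ringKrullDim R :=
  Order.krullDim_le_of_strictMono (PrimeSpectrum.comap (algebraMap R S)) fun _ _ h =>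
    Ideal.IsIntegral.comap_lt_comap (R := R) h

/-- The dimension of a finitely generated algebra in a field is at most the transcendence degree of
the field. -/
lemma ringKrullDim_le_of_trdeg_le {k A K : Type} [Field k] [CommRing A] [Nontrivial A] [Algebra k A]
    [Algebra.FiniteType k A] [CommRing K] [Nontrivial K] [Algebra k K] (f : A →ₐ[k] K)
    (hf : Function.Injective f) {n : ℕ} (hn : Algebra.trdeg k K ≤ n) : ringKrullDim A ≤ n := by
  -- By Noether normalization the algebra is integral over a polynomial ring, whose variables stay
  -- algebraically independent in `K`.
  obtain ⟨s, g, hg, hint⟩ := exists_integral_inj_algHom_of_fg k A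
  have h1 : AlgebraicIndependent k fun i => f (g (X i)) := by
    have : AlgebraicIndependent k (X : Fin s → MvPolynomial (Fin s) k) :=
      MvPolynomial.algebraicIndependent_X _ _
    exact this.map' (f := f.comp g) (hf.comp hg)
  have h2 : (s : Cardinal.{0}) ≤ n := by
    simpa using h1.cardinalMk_le_trdeg.trans hn
  algebraize [g.toRingHom]
  have h3 := ringKrullDim_le_of_isIntegral (MvPolynomial (Fin s) k) A
  rw [MvPolynomial.ringKrullDim_of_isNoetherianRing, ringKrullDim_eq_zero_of_field] at h3
  refine h3.trans ?_
  rw [zero_add]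
  rw [Nat.card_fin]
  exact_mod_cast h2

end Dimension

/-! ### Morphisms from nonsingular surfaces to the curve -/

section Models

namespace AlgebraicGeometry

variable {X : Scheme.{0}} (toC : X ⟶ Spec (.of ℂ))

/-- The constants in a local ring of a scheme over `ℂ`. -/
noncomputable abbrev stalkAlgebra (x : X) : Algebra ℂ (X.presheaf.stalk x) :=
  (Spec.preimage (X.fromSpecStalk x ≫ toC)).hom.toAlgebra

lemma SpecMap_stalkAlgebra (x : X) :
    letI := stalkAlgebra toC x
    Spec.map (CommRingCat.ofHom (algebraMap ℂ (X.presheaf.stalk x))) =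
      X.fromSpecStalk x ≫ toC :=
  Spec.map_preimage _

lemma algebraMap_stalkSpecializes {x y : X} (h : x ⤳ y) (a : ℂ) :
    letI := stalkAlgebra toC x
    letI := stalkAlgebra toC y
    (X.presheaf.stalkSpecializes h).hom (algebraMap ℂ (X.presheaf.stalk y) a) =
      algebraMap ℂ (X.presheaf.stalk x) a := by
  have : Spec.preimage (X.fromSpecStalk y ≫ toC) ≫ X.presheaf.stalkSpecializes h =
      Spec.preimage (X.fromSpecStalk x ≫ toC) := by
    apply Spec.map_injective
    rw [Spec.map_comp, Spec.map_preimage, Spec.map_preimage,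
      Scheme.SpecMap_stalkSpecializes_fromSpecStalk_assoc]
  exact congrArg (fun f => f.hom a) this

/-- The residue field at a closed point is `ℂ`, where cube roots exist. The descent needs them for
units, which is why extension is checked at closed points only. -/
lemma exists_cube_sub_mem [LocallyOfFiniteType toC] (x : X) (hx : IsClosed {x})
    (u : X.presheaf.stalk x) :
    ∃ t, t ^ 3 - u ∈ IsLocalRing.maximalIdeal (X.presheaf.stalk x) := by
  let := stalkAlgebra toC x
  have h1 : (residueFieldIsoBase toC x hx).inv =
      CommRingCat.ofHom (algebraMap ℂ (X.presheaf.stalk x)) ≫ X.residue x := by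
    apply Spec.map_injective
    rw [SpecMap_residueFieldIsoBase_inv, Spec.map_comp, SpecMap_stalkAlgebra]
    rfl
  have h2 : (residueFieldIsoBase toC x hx).inv.hom
      ((residueFieldIsoBase toC x hx).hom.hom (X.residue x u)) = X.residue x u := by
    simp
  set a := (residueFieldIsoBase toC x hx).hom.hom (X.residue x u)
  obtain ⟨b, hb⟩ := IsAlgClosed.exists_pow_nat_eq a (n := 3) (by norm_num)
  refine ⟨algebraMap ℂ _ b, ?_⟩
  rw [← map_pow, hb, ← IsLocalRing.residue_eq_zero_iff, map_sub, sub_eq_zero]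
  rw [h1] at h2
  exact h2

/-- The local ring is a localization of the sections over an affine open set, a finitely generated
algebra inside `K`. -/
lemma ringKrullDim_stalk_le [IsIntegral X] [LocallyOfFiniteType toC] {K : Type} [CommRing K]
    [Nontrivial K] [Algebra ℂ K] (ι : X.functionField ≅ CommRingCat.of K)
    (hι : (Spec.map ι.hom ≫ X.fromSpecStalk (genericPoint X)) ≫ toC =
      Spec.map (CommRingCat.ofHom (algebraMap ℂ K))) {n : ℕ} (hn : Algebra.trdeg ℂ K ≤ n) (x : X) :
    ringKrullDim (X.presheaf.stalk x) ≤ n := by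
  obtain ⟨U, hU, hxU, -⟩ := exists_isAffineOpen_mem_and_subset (X := X) (x := x) (U := ⊤) trivial
  have hgU : genericPoint X ∈ U := (genericPoint_specializes x).mem_open U.2 hxU
  have : Nonempty U := ⟨⟨x, hxU⟩⟩
  let σ := Spec.preimage (hU.fromSpec ≫ toC)
  have hσ : Spec.map σ = hU.fromSpec ≫ toC := Spec.map_preimage _
  have hft : σ.hom.FiniteType := by
    rw [← HasRingHomProperty.Spec_iff (P := @LocallyOfFiniteType), hσ]
    infer_instance
  algebraize [σ.hom]
  have hinj : Function.Injective (X.germToFunctionField U).hom :=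
    Scheme.germToFunctionField_injective X U
  have hcomm : σ ≫ X.germToFunctionField U ≫ ι.hom = CommRingCat.ofHom (algebraMap ℂ K) := by
    apply Spec.map_injective
    rw [← hι, Spec.map_comp, Spec.map_comp, hσ, Category.assoc, Category.assoc,
      ← hU.fromSpecStalk_eq_fromSpecStalk hgU, IsAffineOpen.fromSpecStalk, Category.assoc]
  let f : Γ(X, U) →ₐ[ℂ] K :=
    { (X.germToFunctionField U ≫ ι.hom).hom with
      commutes' := fun a => congrArg (fun f => f.hom a) hcomm }
  have hf : Function.Injective f := by
    have h2 : Function.Injective ι.hom.hom :=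
      (ConcreteCategory.bijective_of_isIso ι.hom).1
    exact h2.comp hinj
  have hA := ringKrullDim_le_of_trdeg_le f hf hn
  let := X.presheaf.algebra_section_stalk (⟨x, hxU⟩ : U)
  have := hU.isLocalization_stalk ⟨x, hxU⟩
  have h2 := IsLocalization.AtPrime.ringKrullDim_eq_height (hU.primeIdealOf ⟨x, hxU⟩).asIdeal
    (X.presheaf.stalk x)
  rw [h2]
  exact (Ideal.height_le_ringKrullDim_of_ne_top (hU.primeIdealOf ⟨x, hxU⟩).2.ne_top).trans hA

/-- A pair of rational functions on a nonsingular surface that satisfies the equation of the curve is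
a morphism to the curve. -/
lemma exists_hom_of_affinePoint [IsIntegral X] [IsProper toC]
    (hreg : ∀ x : X, IsRegularLocalRing (X.presheaf.stalk x)) {K : Type} [CommRing K]
    [Nontrivial K] [Algebra ℂ K] (ι : X.functionField ≅ CommRingCat.of K)
    (hι : (Spec.map ι.hom ≫ X.fromSpecStalk (genericPoint X)) ≫ toC =
      Spec.map (CommRingCat.ofHom (algebraMap ℂ K))) (hn : Algebra.trdeg ℂ K ≤ 2)
    (s c : K) (h : c ^ 3 = s * (1 - s)) :
    ∃ φ : X ⟶ curve, (Spec.map ι.hom ≫ X.fromSpecStalk (genericPoint X)) ≫ φ =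
      affinePoint s c h ∧ φ ≫ curveToC = toC := by
  have : CompactSpace X := QuasiCompact.compactSpace_of_compactSpace toC
  let := stalkAlgebra toC (genericPoint X)
  have hιinv : ∀ a, ι.inv.hom (algebraMap ℂ K a) = algebraMap ℂ X.functionField a := by
    intro a
    have h1 : CommRingCat.ofHom (algebraMap ℂ K) ≫ ι.inv =
        CommRingCat.ofHom (algebraMap ℂ X.functionField) := by
      apply Spec.map_injective
      rw [Spec.map_comp, ← hι, Category.assoc, ← Spec.map_comp_assoc, ι.hom_inv_id, Spec.map_id,
        Category.id_comp]
      exact (SpecMap_stalkAlgebra toC _).symm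
    exact congrArg (fun f => f.hom a) h1
  let ιinv : K →ₐ[ℂ] X.functionField := { ι.inv.hom with commutes' := hιinv }
  have h' : ιinv c ^ 3 = ιinv s * (1 - ιinv s) := by
    rw [← map_pow, h, map_mul, map_sub, map_one]
  have hf : Spec.map ι.inv ≫ affinePoint s c h = affinePoint (ιinv s) (ιinv c) h' := by
    rw [affinePoint_eq_point, affinePoint_eq_point]
    refine (SpecMap_point ιinv _ _ _ (by simpa using h')).trans ?_
    refine point_eq_of_mul_eq _ _ _ _ _ _ 1 isUnit_one fun i => ?_
    fin_cases i <;> simp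
  obtain ⟨φ, hφ, hφ'⟩ := exists_extension toC curveToC
    (affinePoint (R := X.functionField) (ιinv s) (ιinv c) h')
    (by rw [affinePoint_eq_point, point_curveToC]; exact SpecMap_stalkAlgebra toC _) <| by
    intro x hx
    let := stalkAlgebra toC x
    have := hreg x
    let sp : X.presheaf.stalk x →ₐ[ℂ] X.functionField :=
      { (X.presheaf.stalkSpecializes (genericPoint_specializes x)).hom with
        commutes' := algebraMap_stalkSpecializes toC (genericPoint_specializes x) }
    have hsp : Function.Injective sp := IsFractionRing.injective (X.presheaf.stalk x) X.functionField
    have h3 : IsUnit (3 : X.presheaf.stalk x) := by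
      have : IsUnit (algebraMap ℂ (X.presheaf.stalk x) 3) :=
        (IsUnit.mk0 (3 : ℂ) (by norm_num)).map _
      rwa [map_ofNat] at this
    have hω : ∃ ω : X.presheaf.stalk x, ω ^ 2 + ω + 1 = 0 := by
      obtain ⟨z, hz⟩ : ∃ z : ℂ, z ^ 2 + z + 1 = 0 := by
        -- Completing the square turns the equation into `(z + 1/2)² = -3/4`.
        obtain ⟨z, hz⟩ := IsAlgClosed.exists_pow_nat_eq (-3 / 4 : ℂ) (n := 2) (by norm_num)
        exact ⟨z - 1 / 2, by linear_combination hz⟩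
      refine ⟨algebraMap ℂ _ z, ?_⟩
      rw [← map_pow, ← map_add, ← map_one (algebraMap ℂ (X.presheaf.stalk x)), ← map_add, hz,
        map_zero]
    obtain ⟨s₀, c₀, hs₀, hc₀⟩ | ⟨w, c₀, hw, hc₀⟩ := exists_lift_or_inv
      (ringKrullDim_stalk_le toC ι hι (n := 2) (by simpa using hn) x) h3 hω
      (fun u _ => exists_cube_sub_mem toC x hx u) h'
    · change sp s₀ = _ at hs₀
      change sp c₀ = _ at hc₀
      have h₀ : c₀ ^ 3 = s₀ * (1 - s₀) := hsp (by
        rw [map_pow, map_mul, map_sub, map_one, hs₀, hc₀, h'])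
      refine ⟨affinePoint (R := X.presheaf.stalk x) s₀ c₀ h₀, ?_, ?_⟩
      · rw [affinePoint_eq_point, point_curveToC]
        exact SpecMap_stalkAlgebra toC _
      · rw [affinePoint_eq_point, affinePoint_eq_point]
        refine (SpecMap_point sp _ _ _ (by simpa [hs₀, hc₀] using h')).trans ?_
        refine point_eq_of_mul_eq _ _ _ _ _ _ 1 isUnit_one fun i => ?_
        fin_cases i <;> simp [hs₀, hc₀]
    · change sp w * _ = _ at hw
      change sp c₀ * _ = _ at hc₀
      have h₁ : sp c₀ ^ 3 = sp w * (sp w - 1) := by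
        rw [← hc₀] at h'
        linear_combination (sp w) ^ 3 * h' - (sp c₀) ^ 3 * (1 + sp w * ιinv s + (sp w * ιinv s) ^ 2) * hw +
           ((sp w) ^ 2 - sp w * (1 + sp w * ιinv s)) * hw
      have h₀ : c₀ ^ 3 = w * (w - 1) := hsp (by
        rw [map_pow, map_mul, map_sub, map_one, h₁])
      have hu : IsUnit (ιinv s) := IsUnit.of_mul_eq_one_right _ hw
      -- In the second case the point is `[1 : c/s : 1/s]`; over the function field, multiplication
      -- by `s` gives `[s : c : 1]`.
      refine ⟨point (R := X.presheaf.stalk x) ![1, c₀, w] (by simpa using h₀) ⟨0, isUnit_one⟩, ?_, ?_⟩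
      · rw [point_curveToC]
        exact SpecMap_stalkAlgebra toC _
      · rw [affinePoint_eq_point]
        refine (SpecMap_point sp _ _ _ (by simpa using h₁)).trans ?_
        refine point_eq_of_mul_eq _ _ _ _ _ _ (ιinv s) hu fun i => ?_
        fin_cases i
        · simp
        · simp [← hc₀, mul_comm]
        · simp [← hw, mul_comm]
  refine ⟨φ, ?_, hφ'⟩
  rw [Category.assoc, hφ, ← hf, ← Spec.map_comp_assoc, ι.inv_hom_id, Spec.map_id, Category.id_comp]

end AlgebraicGeometry

end Models

/-! ### Homogeneous forms, squarefree factors and dehomogenization -/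

section Forms

namespace MvPolynomial

variable {σ R : Type*} [CommRing R]

/-- The substitution `X i ↦ X i * T`. -/
noncomputable def scaleVars : MvPolynomial σ R →ₐ[R] Polynomial (MvPolynomial σ R) :=
  aeval fun i => Polynomial.C (X i) * Polynomial.X

lemma scaleVars_monomial (m : σ →₀ ℕ) (a : R) :
    scaleVars (monomial m a) = Polynomial.C (monomial m a) * Polynomial.X ^ m.degree := by
  rw [scaleVars, aeval_monomial, IsScalarTower.algebraMap_apply R (MvPolynomial σ R)]
  simp only [mul_pow, Finsupp.prod, Finset.prod_mul_distrib, ← Polynomial.C_pow,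
    ← map_prod, Finset.prod_pow_eq_pow_sum]
  rw [← mul_assoc, Polynomial.algebraMap_eq, ← map_mul, algebraMap_eq, monomial_eq]
  rfl

lemma coeff_scaleVars (p : MvPolynomial σ R) (n : ℕ) :
    (scaleVars p).coeff n = homogeneousComponent n p := by
  induction p using MvPolynomial.induction_on' with
  | monomial m a =>
    rw [scaleVars_monomial, Polynomial.coeff_C_mul_X_pow]
    split_ifs with h
    · exact (homogeneousComponent_eq_self (isHomogeneous_monomial a h.symm)).symm
    · rw [homogeneousComponent_of_mem (m := n) (n := m.degree) (isHomogeneous_monomial a rfl),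
        if_neg h]
  | add p q hp hq => rw [map_add, Polynomial.coeff_add, hp, hq, map_add]

lemma scaleVars_injective : Function.Injective (scaleVars : MvPolynomial σ R →ₐ[R] _) := by
  intro p q h
  have key : ∀ p : MvPolynomial σ R, (scaleVars p).eval 1 = p := by
    intro p
    induction p using MvPolynomial.induction_on' with
    | monomial m a => rw [scaleVars_monomial]; simp
    | add p q hp hq => rw [map_add, Polynomial.eval_add, hp, hq]
  rw [← key p, h, key]

lemma IsHomogeneous.scaleVars {p : MvPolynomial σ R} {n : ℕ} (hp : p.IsHomogeneous n) :
    scaleVars p = Polynomial.C p * Polynomial.X ^ n := by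
  ext1 k
  rw [coeff_scaleVars, Polynomial.coeff_C_mul_X_pow, homogeneousComponent_of_mem hp]

/-- The divisors of a form are forms. -/
lemma IsHomogeneous.of_dvd [IsDomain R] {p q : MvPolynomial σ R} {n : ℕ} (hp : p.IsHomogeneous n)
    (hp₀ : p ≠ 0) (h : q ∣ p) : ∃ m, q.IsHomogeneous m := by
  obtain ⟨q', rfl⟩ := h
  have e : MvPolynomial.scaleVars q * MvPolynomial.scaleVars q' =
      Polynomial.C (q * q') * Polynomial.X ^ n := by
    rw [← map_mul, hp.scaleVars]
  have hq : q ≠ 0 := left_ne_zero_of_mul hp₀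
  have hq' : q' ≠ 0 := right_ne_zero_of_mul hp₀
  have hQ : MvPolynomial.scaleVars q ≠ 0 := by
    rw [ne_eq, map_eq_zero_iff _ scaleVars_injective]; exact hq
  have hQ' : MvPolynomial.scaleVars q' ≠ 0 := by
    rw [ne_eq, map_eq_zero_iff _ scaleVars_injective]; exact hq'
  -- Degree and order in `T` are both additive and agree for the product, so they agree for each
  -- factor: a factor is a monomial in `T`, which means homogeneous.
  have h1 := congrArg Polynomial.natDegree e
  have h2 := congrArg Polynomial.natTrailingDegree e
  rw [Polynomial.natDegree_mul hQ hQ', Polynomial.natDegree_C_mul_X_pow n _ hp₀] at h1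
  rw [Polynomial.natTrailingDegree_mul hQ hQ',
    Polynomial.natTrailingDegree_mul_X_pow (Polynomial.C_ne_zero.mpr hp₀),
    Polynomial.natTrailingDegree_C, zero_add] at h2
  have h3 := Polynomial.natTrailingDegree_le_natDegree (MvPolynomial.scaleVars q)
  have h4 := Polynomial.natTrailingDegree_le_natDegree (MvPolynomial.scaleVars q')
  refine ⟨(MvPolynomial.scaleVars q).natDegree, ?_⟩
  have h5 : q = homogeneousComponent (MvPolynomial.scaleVars q).natDegree q := by
    apply scaleVars_injective
    ext1 k
    rw [coeff_scaleVars, coeff_scaleVars,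
      homogeneousComponent_of_mem (homogeneousComponent_isHomogeneous _ _)]
    split_ifs with hk
    · rw [hk]
    · rw [← coeff_scaleVars]
      rcases lt_or_gt_of_ne hk with hlt | hgt
      · exact Polynomial.coeff_eq_zero_of_lt_natTrailingDegree (by omega)
      · exact Polynomial.coeff_eq_zero_of_natDegree_lt hgt
  rw [h5]
  have := homogeneousComponent_isHomogeneous (MvPolynomial.scaleVars q).natDegree q
  rwa [← h5] at this ⊢

/-- Three nonzero forms with sum zero have the same degree. -/
lemma IsHomogeneous.eq_of_add_add_eq_zero {p q s : MvPolynomial σ R} {a b c : ℕ}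
    (hp : p.IsHomogeneous a) (hq : q.IsHomogeneous b) (hs : s.IsHomogeneous c) (hp₀ : p ≠ 0)
    (hq₀ : q ≠ 0) (hs₀ : s ≠ 0) (h : p + q + s = 0) : b = a ∧ c = a := by
  by_cases hb : b = a
  · subst hb
    have hs' : s.IsHomogeneous b := by
      rw [eq_neg_of_add_eq_zero_right h]; exact (hp.add hq).neg
    exact ⟨rfl, hs.inj_right hs' hs₀⟩
  · by_cases hc : c = a
    · subst hc
      have hq' : q.IsHomogeneous c := by
        have : q = -(p + s) := by linear_combination h
        rw [this]; exact (hp.add hs).neg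
      exact absurd (hq.inj_right hq' hq₀) hb
    · have := congrArg (homogeneousComponent a) h
      rw [map_add, map_add, homogeneousComponent_of_mem hp, homogeneousComponent_of_mem hq,
        homogeneousComponent_of_mem hs, if_pos rfl, if_neg (Ne.symm hb), if_neg (Ne.symm hc),
        map_zero, add_zero, add_zero] at this
      exact absurd this hp₀

lemma exists_C_of_isUnit {k : Type*} [Field k] {p : MvPolynomial σ k} (h : IsUnit p) :
    ∃ a, a ≠ 0 ∧ p = C a := by
  obtain ⟨r, hr, rfl⟩ := isUnit_iff_eq_C_of_isReduced.mp h
  exact ⟨r, hr.ne_zero, rfl⟩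

lemma isUnit_C {k : Type*} [Field k] {a : k} (h : a ≠ 0) : IsUnit (C a : MvPolynomial σ k) :=
  (IsUnit.mk0 a h).map C

lemma exists_C_mul_of_associated {k : Type*} [Field k] {p q : MvPolynomial σ k}
    (h : Associated p q) : ∃ a, a ≠ 0 ∧ q = C a * p := by
  obtain ⟨u, rfl⟩ := h
  obtain ⟨a, ha, hu⟩ := exists_C_of_isUnit u.isUnit
  exact ⟨a, ha, by rw [hu, mul_comm]⟩

/-- A nonzero linear form is prime. -/
lemma IsHomogeneous.prime_of_one {k : Type*} [Field k] {p : MvPolynomial σ k}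
    (hp : p.IsHomogeneous 1) (hp₀ : p ≠ 0) : Prime p := by
  refine (irreducible_of_totalDegree_eq_one (hp.totalDegree hp₀) fun x hx => ?_).prime
  by_contra hu
  have hx₀ : x = 0 := by rwa [isUnit_iff_ne_zero, not_not] at hu
  exact hp₀ (by ext i; simpa [hx₀] using hx i)

/-- An irreducible polynomial over `ℂ` divides the polynomials that vanish on its zeros. -/
lemma dvd_of_forall_eval_eq_zero {σ : Type*} [Finite σ] {p f : MvPolynomial σ ℂ} (hp : Prime p)
    (h : ∀ v, eval v p = 0 → eval v f = 0) : p ∣ f := by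
  have h1 : f ∈ (Ideal.span {p}).radical := by
    rw [← vanishingIdeal_zeroLocus_eq_radical (K := ℂ), mem_vanishingIdeal_iff]
    intro v hv
    rw [mem_zeroLocus_iff] at hv
    have := hv p (Ideal.mem_span_singleton_self p)
    rw [aeval_eq_eval] at this ⊢
    exact h v this
  obtain ⟨n, hn⟩ := h1
  exact hp.dvd_of_dvd_pow (Ideal.mem_span_singleton.mp hn)

end MvPolynomial

section Squarefree

variable {R : Type*} [CommRing R] [IsDomain R] [UniqueFactorizationMonoid R]

/-- After removal of the common factor of `b` and `b'`, the cube of the rest of `b` divides the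
squarefree `a`, so this rest is a unit. -/
lemma dvd_of_pow_three_dvd_squarefree_mul {a b b' : R} (ha : Squarefree a) (hb' : b' ≠ 0)
    (h : b ^ 3 ∣ a * b' ^ 3) : b ∣ b' := by
  obtain ⟨β, β', d, hrel, rfl, rfl⟩ := UniqueFactorizationMonoid.exists_reduced_factors' b b' hb'
  have hd : d ^ 3 ≠ 0 := pow_ne_zero _ (left_ne_zero_of_mul hb')
  rw [mul_pow, mul_pow, mul_left_comm] at h
  have h1 : β ^ 3 ∣ a := hrel.pow.dvd_of_dvd_mul_right ((mul_dvd_mul_iff_left hd).mp h)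
  have h2 : IsUnit β := ha β (dvd_trans ⟨β, by ring⟩ h1)
  exact mul_dvd_mul_left d h2.dvd

/-- A squarefree coefficient cannot absorb a cube, so the term determines `b` up to a unit. This
recovers `f`, `g`, `h` from the terms of a relation. -/
lemma associated_of_associated_mul_pow_three {a b a' b' : R} (ha : Squarefree a)
    (ha' : Squarefree a') (hb : b ≠ 0) (hb' : b' ≠ 0)
    (h : Associated (a * b ^ 3) (a' * b' ^ 3)) : Associated b b' :=
  associated_of_dvd_dvd
    (dvd_of_pow_three_dvd_squarefree_mul ha' hb' ((dvd_mul_left _ _).trans h.dvd))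
    (dvd_of_pow_three_dvd_squarefree_mul ha hb ((dvd_mul_left _ _).trans h.symm.dvd))

lemma prod_dvd_of_primes {ι : Type*} (s : Finset ι) (L : ι → R) (hL : ∀ j, Prime (L j))
    (hne : ∀ i j, i ≠ j → ¬ Associated (L i) (L j)) {p : R} (h : ∀ j ∈ s, L j ∣ p) :
    ∏ j ∈ s, L j ∣ p :=
  Finset.prod_dvd_of_isRelPrime (fun i _ j _ hij =>
    ((hL i).irreducible.isRelPrime_iff_not_dvd).mpr fun hd =>
      hne i j hij ((hL i).associated_of_dvd (hL j) hd)) h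

lemma squarefree_prod_of_primes {ι : Type*} (s : Finset ι) (L : ι → R) (hL : ∀ j, Prime (L j))
    (hne : ∀ i j, i ≠ j → ¬ Associated (L i) (L j)) : Squarefree (∏ j ∈ s, L j) :=
  Finset.squarefree_prod_of_pairwise_isCoprime (fun i _ j _ hij =>
    ((hL i).irreducible.isRelPrime_iff_not_dvd).mpr fun hd =>
      hne i j hij ((hL i).associated_of_dvd (hL j) hd)) fun j _ => (hL j).squarefree

end Squarefree

section Dehomogenize

/-- Dehomogenization as a homomorphism. -/
noncomputable def dehomHom : MvPolynomial (Fin 3) ℂ →ₐ[ℂ] PlaneField :=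
  (IsScalarTower.toAlgHom ℂ (MvPolynomial (Fin 2) ℂ) PlaneField).comp (aeval ![X 0, X 1, 1])

lemma dehomHom_apply (p : MvPolynomial (Fin 3) ℂ) : dehomHom p = dehomogenize p := rfl

/-- A form that vanishes where the last coordinate is `1` vanishes by scaling wherever that
coordinate is nonzero, so its product with `X 2` is zero. -/
lemma dehomogenize_eq_zero {p : MvPolynomial (Fin 3) ℂ} {n : ℕ} (hp : p.IsHomogeneous n)
    (h : dehomogenize p = 0) : p = 0 := by
  have h1 : aeval ![X 0, X 1, (1 : MvPolynomial (Fin 2) ℂ)] p = 0 :=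
    (map_eq_zero_iff _ (IsFractionRing.injective (MvPolynomial (Fin 2) ℂ) PlaneField)).mp h
  have h2 : ∀ a b : ℂ, eval ![a, b, 1] p = 0 := by
    intro a b
    have := congrArg (eval ![a, b]) h1
    rw [map_zero, ← aeval_eq_eval, ← AlgHom.comp_apply, comp_aeval] at this
    rw [← aeval_eq_eval, ← this]
    congr 2
    ext i
    fin_cases i <;> simp
  have h3 : X 2 * p = 0 := by
    apply MvPolynomial.funext
    intro v
    rw [map_mul, eval_X, map_zero]
    by_cases hv : v 2 = 0
    · rw [hv, zero_mul]
    · have h4 : v = fun i => v 2 * ![v 0 / v 2, v 1 / v 2, 1] i := by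
        ext i
        fin_cases i
        · simp; field_simp
        · simp; field_simp
        · simp
      have h5 : eval (fun i => v 2 * ![v 0 / v 2, v 1 / v 2, 1] i) p = 0 := by
        have : eval (fun i => v 2 * ![v 0 / v 2, v 1 / v 2, 1] i) p =
            v 2 ^ n * eval ![v 0 / v 2, v 1 / v 2, 1] p := by
          rw [eval_eq, eval_eq, Finset.mul_sum]
          refine Finset.sum_congr rfl fun d hd => ?_
          have hdeg : n = ∑ j ∈ d.support, d j := by
            have := hp (mem_support_iff.mp hd)
            rw [← this, Finsupp.weight_apply]; simp [Finsupp.sum]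
          simp only [mul_pow, Finset.prod_mul_distrib]
          rw [hdeg, ← Finset.prod_pow_eq_pow_sum]
          ring
        rw [this, h2, mul_zero]
      rw [← h4] at h5
      rw [h5, mul_zero]
  exact (mul_eq_zero.mp h3).resolve_left (X_ne_zero 2)

lemma dehomogenize_ne_zero {p : MvPolynomial (Fin 3) ℂ} {n : ℕ} (hp : p.IsHomogeneous n)
    (h : p ≠ 0) : dehomogenize p ≠ 0 := fun h' => h (dehomogenize_eq_zero hp h')

lemma eq_of_dehomogenize_eq {p q : MvPolynomial (Fin 3) ℂ} {n : ℕ} (hp : p.IsHomogeneous n)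
    (hq : q.IsHomogeneous n) (h : dehomogenize p = dehomogenize q) : p = q := by
  rw [← sub_eq_zero]
  refine dehomogenize_eq_zero (hp.sub hq) ?_
  rw [← dehomHom_apply, map_sub, dehomHom_apply, dehomHom_apply, h, sub_self]

/-- All large degrees are possible, by powers of the last variable; this freedom is what allows a
prescribed difference of degrees in a fraction. -/
lemma exists_homogenize (q : MvPolynomial (Fin 2) ℂ) :
    ∃ N, ∀ n ≥ N, ∃ p : MvPolynomial (Fin 3) ℂ, p.IsHomogeneous n ∧
      dehomogenize p = algebraMap _ PlaneField q := by
  have hX2 : dehomHom (X 2) = 1 := by simp [dehomHom]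
  induction q using MvPolynomial.induction_on with
  | C a =>
    refine ⟨0, fun n _ => ⟨C a * X 2 ^ n, ?_, ?_⟩⟩
    · simpa using (isHomogeneous_C (Fin 3) a).mul (isHomogeneous_X_pow (R := ℂ) (2 : Fin 3) n)
    · rw [← dehomHom_apply, map_mul, map_pow, hX2, one_pow, mul_one, ← algebraMap_eq,
        AlgHom.commutes, ← algebraMap_eq, ← IsScalarTower.algebraMap_apply]
  | add p q hp hq =>
    obtain ⟨N, hN⟩ := hp
    obtain ⟨N', hN'⟩ := hq
    refine ⟨max N N', fun n hn => ?_⟩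
    obtain ⟨p₁, h1, h2⟩ := hN n (le_trans (le_max_left _ _) hn)
    obtain ⟨p₂, h3, h4⟩ := hN' n (le_trans (le_max_right _ _) hn)
    refine ⟨p₁ + p₂, h1.add h3, ?_⟩
    rw [← dehomHom_apply, map_add, map_add, dehomHom_apply, dehomHom_apply, h2, h4]
  | mul_X p i hp =>
    obtain ⟨N, hN⟩ := hp
    refine ⟨N + 1, fun n hn => ?_⟩
    obtain ⟨p₁, h1, h2⟩ := hN (n - 1) (by omega)
    refine ⟨p₁ * X i.castSucc, ?_, ?_⟩
    · have := h1.mul (isHomogeneous_X ℂ i.castSucc)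
      rwa [Nat.sub_add_cancel (by omega)] at this
    · rw [← dehomHom_apply, map_mul, dehomHom_apply, h2, map_mul]
      congr 1
      fin_cases i <;> simp [dehomHom]

/-- A rational function is a quotient of coprime forms, with a prescribed difference of degrees. -/
lemma exists_eq_div (s : PlaneField) (k : ℕ) :
    ∃ (p q : MvPolynomial (Fin 3) ℂ) (m n : ℕ), p.IsHomogeneous m ∧ q.IsHomogeneous n ∧ q ≠ 0 ∧
      (p ≠ 0 → n = m + k) ∧ IsRelPrime p q ∧ s = dehomogenize p / dehomogenize q := by
  obtain ⟨a, b, hb, rfl⟩ := IsFractionRing.div_surjective (A := MvPolynomial (Fin 2) ℂ) s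
  have hb₀ : b ≠ 0 := nonZeroDivisors.ne_zero hb
  obtain ⟨N, hN⟩ := exists_homogenize a
  obtain ⟨N', hN'⟩ := exists_homogenize b
  obtain ⟨p, hp, hpa⟩ := hN (max N N') (le_max_left _ _)
  obtain ⟨q, hq, hqb⟩ := hN' (max N N' + k) (by omega)
  have hq₀ : q ≠ 0 := by
    rintro rfl
    rw [← dehomHom_apply, map_zero, eq_comm,
      map_eq_zero_iff _ (IsFractionRing.injective (MvPolynomial (Fin 2) ℂ) PlaneField)] at hqb
    exact hb₀ hqb
  obtain ⟨p', q', d, hrel, rfl, rfl⟩ := UniqueFactorizationMonoid.exists_reduced_factors' p q hq₀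
  obtain ⟨l, hl⟩ := hq.of_dvd hq₀ (dvd_mul_right d q')
  obtain ⟨n, hn⟩ := hq.of_dvd hq₀ (dvd_mul_left q' d)
  have hd₀ : d ≠ 0 := left_ne_zero_of_mul hq₀
  have hq'₀ : q' ≠ 0 := right_ne_zero_of_mul hq₀
  have hln := (hl.mul hn).inj_right hq hq₀
  have hs : algebraMap _ PlaneField a / algebraMap _ PlaneField b =
      dehomogenize p' / dehomogenize q' := by
    rw [← hpa, ← hqb, ← dehomHom_apply, ← dehomHom_apply, map_mul, map_mul,
      mul_div_mul_left _ _ (show dehomHom d ≠ 0 from dehomogenize_ne_zero hl hd₀)]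
    rfl
  by_cases hp₀ : p' = 0
  · exact ⟨p', q', 0, n, hp₀ ▸ isHomogeneous_zero _ _ _, hn, hq'₀, fun h => absurd hp₀ h, hrel, hs⟩
  · obtain ⟨m, hm⟩ := hp.of_dvd (mul_ne_zero hd₀ hp₀) (dvd_mul_left p' d)
    have hlm := (hl.mul hm).inj_right hp (mul_ne_zero hd₀ hp₀)
    exact ⟨p', q', m, n, hm, hn, hq'₀, fun _ => by omega, hrel, hs⟩

end Dehomogenize

end Forms

/-! ### Distribution of the lines over coprime factors; normalization -/

section Arrangements

namespace LineArrangement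

variable {r : ℕ} (𝒜 : LineArrangement r)

lemma form_prime (j : Fin r) : Prime (𝒜.form j) := (𝒜.isHomogeneous j).prime_of_one (𝒜.ne_zero j)

lemma not_associated (i j : Fin r) (h : i ≠ j) : ¬ Associated (𝒜.form i) (𝒜.form j) := fun ha =>
  let ⟨a, _, e⟩ := exists_C_mul_of_associated ha.symm
  𝒜.distinct i j h ⟨a, e⟩

open Classical in
/-- The product of the linear forms of the arrangement that divide a polynomial. -/
noncomputable def lineFactor (p : MvPolynomial (Fin 3) ℂ) : MvPolynomial (Fin 3) ℂ :=
  ∏ j with 𝒜.form j ∣ p, 𝒜.form j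

lemma lineFactor_dvd (p : MvPolynomial (Fin 3) ℂ) : 𝒜.lineFactor p ∣ p :=
  prod_dvd_of_primes _ _ 𝒜.form_prime 𝒜.not_associated fun j hj => by simpa using hj

lemma form_dvd_lineFactor_iff (p : MvPolynomial (Fin 3) ℂ) (j : Fin r) :
    𝒜.form j ∣ 𝒜.lineFactor p ↔ 𝒜.form j ∣ p :=
  ⟨fun h => h.trans (𝒜.lineFactor_dvd p), fun h => Finset.dvd_prod_of_mem _ (by simpa using h)⟩

lemma lineFactor_congr {p q : MvPolynomial (Fin 3) ℂ} (h : ∀ j, 𝒜.form j ∣ p ↔ 𝒜.form j ∣ q) :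
    𝒜.lineFactor p = 𝒜.lineFactor q := by
  classical
  unfold lineFactor
  congr 1
  ext j
  simp [h]

lemma lineFactor_lineFactor (p : MvPolynomial (Fin 3) ℂ) :
    𝒜.lineFactor (𝒜.lineFactor p) = 𝒜.lineFactor p :=
  𝒜.lineFactor_congr (𝒜.form_dvd_lineFactor_iff p)

lemma squarefree_lineFactor (p : MvPolynomial (Fin 3) ℂ) : Squarefree (𝒜.lineFactor p) :=
  squarefree_prod_of_primes _ _ 𝒜.form_prime 𝒜.not_associated

lemma lineFactor_isHomogeneous (p : MvPolynomial (Fin 3) ℂ) :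
    ∃ n, (𝒜.lineFactor p).IsHomogeneous n :=
  ⟨_, IsHomogeneous.prod _ _ (fun _ => 1) fun j _ => 𝒜.isHomogeneous j⟩

lemma prod_form_isHomogeneous : (∏ j, 𝒜.form j).IsHomogeneous r := by
  have := IsHomogeneous.prod Finset.univ 𝒜.form (fun _ => 1) fun j _ => 𝒜.isHomogeneous j
  simpa using this

lemma prod_form_ne_zero : ∏ j, 𝒜.form j ≠ 0 := Finset.prod_ne_zero_iff.mpr fun j _ => 𝒜.ne_zero j

/-- Each line divides exactly one of the three coprime factors, so the lines are partitioned among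
them. -/
lemma lineFactor_mul_lineFactor_mul_lineFactor (p : Fin 3 → MvPolynomial (Fin 3) ℂ)
    (hrel : ∀ i j, i ≠ j → IsRelPrime (p i) (p j)) (h : ∀ j, 𝒜.form j ∣ p 0 * p 1 * p 2) :
    𝒜.lineFactor (p 0) * 𝒜.lineFactor (p 1) * 𝒜.lineFactor (p 2) = ∏ j, 𝒜.form j := by
  classical
  have h1 : ∀ j, ∃ i, 𝒜.form j ∣ p i := by
    intro j
    rcases (𝒜.form_prime j).dvd_or_dvd (h j) with h | h
    · rcases (𝒜.form_prime j).dvd_or_dvd h with h | h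
      exacts [⟨0, h⟩, ⟨1, h⟩]
    · exact ⟨2, h⟩
  choose σ hσ using h1
  have h2 : ∀ i j, 𝒜.form j ∣ p i ↔ σ j = i := by
    intro i j
    refine ⟨fun hd => ?_, fun h => h ▸ hσ j⟩
    by_contra hne
    exact (𝒜.form_prime j).not_isUnit (hrel _ _ hne (hσ j) hd)
  have h3 : ∀ i, 𝒜.lineFactor (p i) = ∏ j with σ j = i, 𝒜.form j := by
    intro i
    rw [lineFactor]
    congr 1
    ext j
    simp [h2]
  rw [h3, h3, h3, ← Finset.prod_fiberwise Finset.univ σ, Fin.prod_univ_three]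

/-- Pairwise coprime polynomials whose product is the product of the lines times a cube are products
of lines times cubes. -/
lemma exists_eq_lineFactor_mul_pow (p : Fin 3 → MvPolynomial (Fin 3) ℂ) (b : MvPolynomial (Fin 3) ℂ)
    (hrel : ∀ i j, i ≠ j → IsRelPrime (p i) (p j))
    (e : p 0 * p 1 * p 2 = (∏ j, 𝒜.form j) * b ^ 3) (i : Fin 3) :
    ∃ f, p i = 𝒜.lineFactor (p i) * f ^ 3 := by
  have hd : ∀ j, 𝒜.form j ∣ p 0 * p 1 * p 2 := fun j => by
    rw [e]; exact (Finset.dvd_prod_of_mem _ (Finset.mem_univ j)).mul_right _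
  have h1 := 𝒜.lineFactor_mul_lineFactor_mul_lineFactor p hrel hd
  choose m hm using fun i => 𝒜.lineFactor_dvd (p i)
  -- Cancelling all lines leaves coprime cofactors whose product is a cube.
  have h2 : m 0 * m 1 * m 2 = b ^ 3 := by
    apply mul_left_cancel₀ 𝒜.prod_form_ne_zero
    rw [← e, ← h1]
    calc _ = 𝒜.lineFactor (p 0) * m 0 * (𝒜.lineFactor (p 1) * m 1) *
          (𝒜.lineFactor (p 2) * m 2) := by ring
      _ = _ := by rw [← hm 0, ← hm 1, ← hm 2]
  have hmrel : ∀ i j, i ≠ j → IsRelPrime (m i) (m j) := fun i j hij =>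
    ((hrel i j hij).of_dvd_left ⟨_, (hm i).trans (mul_comm _ _)⟩).of_dvd_right
      ⟨_, (hm j).trans (mul_comm _ _)⟩
  have h3 : ∃ d, Associated (d ^ 3) (m i) := by
    fin_cases i
    · exact exists_associated_pow_three (p := m 0) (q := m 1 * m 2) (v := 1) (c := b)
        (IsRelPrime.mul_right (hmrel 0 1 (by decide)) (hmrel 0 2 (by decide))) isUnit_one
        (by rw [one_mul, ← h2]; ring)
    · exact exists_associated_pow_three (p := m 1) (q := m 0 * m 2) (v := 1) (c := b)
        (IsRelPrime.mul_right (hmrel 1 0 (by decide)) (hmrel 1 2 (by decide))) isUnit_one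
        (by rw [one_mul, ← h2]; ring)
    · exact exists_associated_pow_three (p := m 2) (q := m 0 * m 1) (v := 1) (c := b)
        (IsRelPrime.mul_right (hmrel 2 0 (by decide)) (hmrel 2 1 (by decide))) isUnit_one
        (by rw [one_mul, ← h2]; ring)
  obtain ⟨d, hd⟩ := h3
  obtain ⟨a, -, ha⟩ := exists_C_mul_of_associated hd
  -- The units are constants, and a constant is a cube.
  obtain ⟨t, ht⟩ := IsAlgClosed.exists_pow_nat_eq a (n := 3) (by norm_num)
  refine ⟨C t * d, ?_⟩
  rw [mul_pow, ← C_pow, ht, ← ha]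
  exact hm i

end LineArrangement

namespace QuasiToricRelation

variable {r : ℕ} {𝒜 : LineArrangement r} (R : QuasiToricRelation 𝒜)

lemma F_ne_zero (i : Fin 3) : R.F i ≠ 0 := (R.F_squarefree i).ne_zero

lemma lineProduct_eq (i : Fin 3) : R.lineProduct i = 𝒜.lineFactor (R.F i) := rfl

lemma exists_prod_isHomogeneous : ∃ n, (R.F 0 * R.F 1 * R.F 2).IsHomogeneous n := by
  obtain ⟨a, ha⟩ := R.F_isHomogeneous 0
  obtain ⟨b, hb⟩ := R.F_isHomogeneous 1
  obtain ⟨c, hc⟩ := R.F_isHomogeneous 2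
  exact ⟨_, (ha.mul hb).mul hc⟩

/-- By the Nullstellensatz it suffices that the product vanishes on the line. The projective zero
set says nothing about the origin, which is handled separately. -/
lemma form_dvd (j : Fin r) : 𝒜.form j ∣ R.F 0 * R.F 1 * R.F 2 := by
  refine dvd_of_forall_eval_eq_zero (𝒜.form_prime j) fun v hv => ?_
  by_cases hv₀ : v = 0
  · obtain ⟨n, hn⟩ := R.exists_prod_isHomogeneous
    set G := R.F 0 * R.F 1 * R.F 2 with hG
    have hne : 𝒜.form j ≠ 0 := 𝒜.ne_zero j
    -- a nonzero point of the line
    obtain ⟨w, hw₀, hw⟩ : ∃ w : Fin 3 → ℂ, w ≠ 0 ∧ eval w (𝒜.form j) = 0 := by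
      by_contra! hc
      have h0 : 𝒜.form j ∣ X 0 := dvd_of_forall_eval_eq_zero (𝒜.form_prime j) fun v hv => by
        by_contra hne
        refine hc v ?_ hv
        rintro rfl
        simp at hne
      have h1 : 𝒜.form j ∣ X 1 := dvd_of_forall_eval_eq_zero (𝒜.form_prime j) fun v hv => by
        by_contra hne
        refine hc v ?_ hv
        rintro rfl
        simp at hne
      have h2 : Associated (X 0 : MvPolynomial (Fin 3) ℂ) (X 1) :=
        (((𝒜.form_prime j).associated_of_dvd ((isHomogeneous_X ℂ 0).prime_of_one (X_ne_zero 0)) h0).symm).trans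
          ((𝒜.form_prime j).associated_of_dvd ((isHomogeneous_X ℂ 1).prime_of_one (X_ne_zero 1)) h1)
      obtain ⟨a, -, ha⟩ := exists_C_mul_of_associated h2
      have := congrArg (eval ![0, 1, 0]) ha
      simp at this
    have hGw : eval w G = 0 := (R.zeroSet w hw₀).mpr ⟨j, hw⟩
    -- At the origin a form of positive degree vanishes, and a constant one takes its value at the
    -- nonzero point `w` of the line, which is zero.
    by_cases hn₀ : n = 0
    · subst hn₀
      have hGC : G = C (coeff 0 G) :=
        totalDegree_eq_zero_iff_eq_C.mp (Nat.le_zero.mp hn.totalDegree_le)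
      rw [hGC, eval_C] at hGw ⊢
      exact hGw
    · rw [hv₀]
      have := hn.coeff_eq_zero (d := 0) (by simpa using Ne.symm hn₀)
      rw [← constantCoeff_eq, ← eval_zero] at this
      exact this
  · exact (R.zeroSet v hv₀).mpr ⟨j, hv⟩

/-- Outside the origin the zeros of `π` lie on the lines. Multiplying the product of the lines by a
coordinate takes care of the origin, and `π` cannot divide two different coordinates. -/
lemma exists_associated_form {π : MvPolynomial (Fin 3) ℂ} (hπ : Prime π) {i : Fin 3}
    (h : π ∣ R.F i) : ∃ j, Associated (𝒜.form j) π := by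
  have hG : π ∣ R.F 0 * R.F 1 * R.F 2 := by
    fin_cases i
    · exact (h.mul_right _).mul_right _
    · exact (h.mul_left _).mul_right _
    · exact h.mul_left _
  have key : ∀ k, π ∣ (∏ j, 𝒜.form j) * X k := by
    intro k
    refine dvd_of_forall_eval_eq_zero hπ fun v hv => ?_
    rw [map_mul, eval_X, map_prod]
    by_cases hv₀ : v = 0
    · simp [hv₀]
    · obtain ⟨j, hj⟩ := (R.zeroSet v hv₀).mp (by
        obtain ⟨q, hq⟩ := hG
        rw [hq, map_mul, hv, zero_mul])
      rw [Finset.prod_eq_zero (Finset.mem_univ j) hj, zero_mul]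
  have h1 : π ∣ ∏ j, 𝒜.form j := by
    by_contra hc
    have h0 := (hπ.dvd_or_dvd (key 0)).resolve_left hc
    have h1 := (hπ.dvd_or_dvd (key 1)).resolve_left hc
    have h2 : Associated (X 0 : MvPolynomial (Fin 3) ℂ) (X 1) :=
      ((hπ.associated_of_dvd ((isHomogeneous_X ℂ 0).prime_of_one (X_ne_zero 0)) h0).symm).trans (hπ.associated_of_dvd ((isHomogeneous_X ℂ 1).prime_of_one (X_ne_zero 1)) h1)
    obtain ⟨a, -, ha⟩ := exists_C_mul_of_associated h2
    have := congrArg (eval ![0, 1, 0]) ha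
    simp at this
  obtain ⟨j, -, hj⟩ := hπ.exists_mem_finset_dvd h1
  exact ⟨j, (hπ.associated_of_dvd (𝒜.form_prime j) hj).symm⟩

/-- All prime factors of `F i` are lines; a nonconstant cofactor of their product would contain one
of them a second time. -/
lemma exists_F_eq (i : Fin 3) : ∃ a, a ≠ 0 ∧ R.F i = C a * R.lineProduct i := by
  obtain ⟨q, hq⟩ := 𝒜.lineFactor_dvd (R.F i)
  have hu : IsUnit q := by
    by_contra hu
    have hq₀ : q ≠ 0 := right_ne_zero_of_mul (hq ▸ R.F_ne_zero i)
    obtain ⟨π, hπ, hd⟩ := WfDvdMonoid.exists_irreducible_factor hu hq₀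
    obtain ⟨j, hj⟩ := R.exists_associated_form hπ.prime (i := i) (hq ▸ hd.mul_left _)
    have h1 : 𝒜.form j ∣ 𝒜.lineFactor (R.F i) := (𝒜.form_dvd_lineFactor_iff _ j).mpr
      (hj.dvd.trans (hq ▸ hd.mul_left _))
    have h2 : 𝒜.form j * 𝒜.form j ∣ R.F i := by
      rw [hq]; exact mul_dvd_mul h1 (hj.dvd.trans hd)
    exact (𝒜.form_prime j).not_isUnit (R.F_squarefree i _ h2)
  obtain ⟨a, ha, rfl⟩ := exists_C_of_isUnit hu
  exact ⟨a, ha, by rw [mul_comm]; exact hq⟩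

lemma prod_lineProduct : R.lineProduct 0 * R.lineProduct 1 * R.lineProduct 2 = ∏ j, 𝒜.form j :=
  𝒜.lineFactor_mul_lineFactor_mul_lineFactor R.F R.F_coprime R.form_dvd

/-- Every quasi-toric relation becomes normalized after moving constants. -/
lemma exists_normalized : ∃ R' : NormalizedRelation 𝒜,
    ∀ i, Associated (R'.1.F i) (R.F i) ∧ R'.1.F i * R'.1.f i ^ 3 = R.F i * R.f i ^ 3 := by
  choose a ha hF using R.exists_F_eq
  -- The constant in `F i` moves into `f i` as a cube root.
  choose t ht using fun i => IsAlgClosed.exists_pow_nat_eq (a i) (n := 3) (by norm_num)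
  have ht₀ : ∀ i, t i ≠ 0 := fun i h => ha i (by rw [← ht i, h]; norm_num)
  have hassoc : ∀ i, Associated (R.lineProduct i) (R.F i) := fun i => by
    rw [hF i, mul_comm]
    exact ⟨(isUnit_C (ha i)).unit, by simp⟩
  have hmul : ∀ i, R.lineProduct i * (C (t i) * R.f i) ^ 3 = R.F i * R.f i ^ 3 := fun i => by
    rw [mul_pow, ← C_pow, ht i]
    conv_rhs => rw [hF i]
    ring
  let R' : QuasiToricRelation 𝒜 :=
    { F := R.lineProduct
      f := fun i => C (t i) * R.f i
      F_isHomogeneous := fun i => 𝒜.lineFactor_isHomogeneous _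
      F_squarefree := fun i => 𝒜.squarefree_lineFactor _
      F_coprime := fun i j hij => ((R.F_coprime i j hij).of_dvd_left
        (𝒜.lineFactor_dvd _)).of_dvd_right (𝒜.lineFactor_dvd _)
      zeroSet := fun v _ => by
        rw [R.prod_lineProduct, map_prod, Finset.prod_eq_zero_iff]
        simp
      f_isHomogeneous := fun i => (R.f_isHomogeneous i).imp fun n hn => hn.C_mul _
      f_ne_zero := fun i => mul_ne_zero (C_ne_zero.mpr (ht₀ i)) (R.f_ne_zero i)
      f_primitive := fun d hd => R.f_primitive d fun i =>
        (isUnit_C (ht₀ i)).dvd_mul_left.mp (hd i)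
      relation := by rw [hmul, hmul, hmul]; exact R.relation }
  refine ⟨⟨R', 1, one_ne_zero, fun i => ?_⟩, fun i => ⟨hassoc i, hmul i⟩⟩
  rw [C_1, one_mul]
  exact (𝒜.lineFactor_lineFactor _).symm

end QuasiToricRelation

end Arrangements

/-! ### From relations to points of the curve, and uniqueness up to equivalence -/

section RelationMaps

lemma dehomogenize_mul (p q : MvPolynomial (Fin 3) ℂ) :
    dehomogenize (p * q) = dehomogenize p * dehomogenize q := map_mul dehomHom p q

lemma dehomogenize_add (p q : MvPolynomial (Fin 3) ℂ) :
    dehomogenize (p + q) = dehomogenize p + dehomogenize q := map_add dehomHom p q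

lemma dehomogenize_sub (p q : MvPolynomial (Fin 3) ℂ) :
    dehomogenize (p - q) = dehomogenize p - dehomogenize q := map_sub dehomHom p q

lemma dehomogenize_neg (p : MvPolynomial (Fin 3) ℂ) :
    dehomogenize (-p) = -dehomogenize p := map_neg dehomHom p

lemma dehomogenize_pow (p : MvPolynomial (Fin 3) ℂ) (n : ℕ) :
    dehomogenize (p ^ n) = dehomogenize p ^ n := map_pow dehomHom p n

lemma dehomogenize_C (a : ℂ) : dehomogenize (C a) = algebraMap ℂ PlaneField a :=
  dehomHom.commutes a

lemma dehomogenize_zero : dehomogenize 0 = 0 := map_zero dehomHom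

namespace LineArrangement

variable {r : ℕ} (𝒜 : LineArrangement r)

lemma affineEquation_ne_zero : 𝒜.affineEquation ≠ 0 :=
  dehomogenize_ne_zero 𝒜.prod_form_isHomogeneous 𝒜.prod_form_ne_zero

lemma algebraMap_injective [Nontrivial 𝒜.CoverField] :
    Function.Injective (algebraMap PlaneField 𝒜.CoverField) :=
  RingHom.injective (algebraMap PlaneField 𝒜.CoverField)

lemma coverRoot_ne_zero [Nontrivial 𝒜.CoverField] : 𝒜.coverRoot ≠ 0 := by
  intro h
  have := 𝒜.coverRoot_pow
  rw [h, zero_pow (by norm_num), eq_comm, map_eq_zero_iff _ 𝒜.algebraMap_injective] at this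
  exact 𝒜.affineEquation_ne_zero this

lemma coverDeck_algebraMap (a : PlaneField) :
    𝒜.coverDeck (algebraMap PlaneField 𝒜.CoverField a) = algebraMap PlaneField 𝒜.CoverField a :=
  AdjoinRoot.lift_of _

lemma coverDeck_coverRoot :
    𝒜.coverDeck 𝒜.coverRoot = algebraMap ℂ 𝒜.CoverField omega * 𝒜.coverRoot :=
  AdjoinRoot.lift_root _

end LineArrangement

namespace QuasiToricRelation

variable {r : ℕ} {𝒜 : LineArrangement r} (R : QuasiToricRelation 𝒜)

lemma dehomogenize_F_ne_zero (i : Fin 3) : dehomogenize (R.F i) ≠ 0 :=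
  let ⟨_, h⟩ := R.F_isHomogeneous i
  dehomogenize_ne_zero h (R.F_ne_zero i)

lemma dehomogenize_f_ne_zero (i : Fin 3) : dehomogenize (R.f i) ≠ 0 :=
  let ⟨_, h⟩ := R.f_isHomogeneous i
  dehomogenize_ne_zero h (R.f_ne_zero i)

lemma lineProduct_ne_zero (i : Fin 3) : R.lineProduct i ≠ 0 :=
  (𝒜.squarefree_lineFactor (R.F i)).ne_zero

lemma dehomogenize_lineProduct_ne_zero (i : Fin 3) : dehomogenize (R.lineProduct i) ≠ 0 :=
  let ⟨_, h⟩ := 𝒜.lineFactor_isHomogeneous (R.F i)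
  dehomogenize_ne_zero h (R.lineProduct_ne_zero i)

lemma affineEquation_eq : 𝒜.affineEquation = dehomogenize (R.lineProduct 0) *
    dehomogenize (R.lineProduct 1) * dehomogenize (R.lineProduct 2) := by
  rw [LineArrangement.affineEquation, ← R.prod_lineProduct, dehomogenize_mul, dehomogenize_mul]

/-- The value of the second coordinate of the map is `z` times this function on the plane. -/
noncomputable def ratioC : PlaneField :=
  (dehomogenize (R.lineProduct 2))⁻¹ *
    (dehomogenize (R.f 0) * dehomogenize (R.f 1) / dehomogenize (R.f 2) ^ 2)

lemma mapC_eq : R.mapC = 𝒜.coverRoot * algebraMap PlaneField 𝒜.CoverField R.ratioC := by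
  rw [mapC, rootC, ratioC, map_mul, mul_assoc]

/-- The value of the first coordinate of the map. -/
noncomputable def ratioS : PlaneField :=
  -(R.ratioA * (dehomogenize (R.f 0) / dehomogenize (R.f 2)) ^ 3)

lemma mapS_eq : R.mapS = algebraMap PlaneField 𝒜.CoverField R.ratioS := rfl

lemma ratioC_ne_zero : R.ratioC ≠ 0 :=
  mul_ne_zero (inv_ne_zero (R.dehomogenize_lineProduct_ne_zero 2))
    (div_ne_zero (mul_ne_zero (R.dehomogenize_f_ne_zero 0) (R.dehomogenize_f_ne_zero 1))
      (pow_ne_zero _ (R.dehomogenize_f_ne_zero 2)))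

lemma mapC_ne_zero [IsDomain 𝒜.CoverField] : R.mapC ≠ 0 := by
  rw [mapC_eq]
  refine mul_ne_zero 𝒜.coverRoot_ne_zero ?_
  rw [ne_eq, map_eq_zero_iff _ 𝒜.algebraMap_injective]
  exact R.ratioC_ne_zero

lemma coverDeck_mapS : 𝒜.coverDeck R.mapS = R.mapS := 𝒜.coverDeck_algebraMap _

lemma coverDeck_mapC :
    𝒜.coverDeck R.mapC = algebraMap ℂ 𝒜.CoverField omega * R.mapC := by
  rw [mapC_eq, map_mul, 𝒜.coverDeck_algebraMap, 𝒜.coverDeck_coverRoot, mul_assoc]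

/-- Here normalization matters: as `z³` is the product of the given forms, `(z / P₃)³ = P₁P₂ / P₃²`,
and this is `F₁F₂ / F₃²` because the three coefficients carry the same constant. The relation gives
`1 - s = -(F₂ / F₃)(g / h)³`. -/
lemma mapC_pow (hR : R.IsNormalized) : R.mapC ^ 3 = R.mapS * (1 - R.mapS) := by
  obtain ⟨a, ha, hF⟩ := hR
  rw [mapC_eq, mul_pow, 𝒜.coverRoot_pow, mapS_eq, ← map_pow, ← map_mul,
    ← map_one (algebraMap PlaneField 𝒜.CoverField), ← map_sub, ← map_mul]
  congr 1
  rw [R.affineEquation_eq, ratioC, ratioS, ratioA]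
  have hrel := congrArg dehomogenize R.relation
  rw [dehomogenize_add, dehomogenize_add, dehomogenize_mul, dehomogenize_mul, dehomogenize_mul,
    dehomogenize_pow, dehomogenize_pow, dehomogenize_pow, dehomogenize_zero] at hrel
  rw [hF 0, hF 1, hF 2] at hrel
  rw [hF 0, hF 2]
  simp only [dehomogenize_mul, dehomogenize_C] at hrel ⊢
  have ha' : algebraMap ℂ PlaneField a ≠ 0 := by simpa using ha
  have hP2 := R.dehomogenize_lineProduct_ne_zero 2
  have hf2 := R.dehomogenize_f_ne_zero 2
  generalize algebraMap ℂ PlaneField a = a' at *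
  generalize dehomogenize (R.lineProduct 0) = P0 at *
  generalize dehomogenize (R.lineProduct 1) = P1 at *
  generalize dehomogenize (R.lineProduct 2) = P2 at *
  generalize dehomogenize (R.f 0) = f0 at *
  generalize dehomogenize (R.f 1) = f1 at *
  generalize dehomogenize (R.f 2) = f2 at *
  have h1 : P0 * f0 ^ 3 + P1 * f1 ^ 3 + P2 * f2 ^ 3 = 0 := by
    apply mul_left_cancel₀ ha'
    linear_combination hrel
  field_simp
  linear_combination P0 * f0 ^ 3 * h1

-- The common factor of the coefficients cancels in `F₁ / F₃` and leaves the set of dividing lines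
-- unchanged; `(λ_f / λ_h)³ = 1` preserves `s`, and `λ_f λ_g = λ_h²` preserves `c`.
variable {R} in
lemma Equivalent.map_eq {R' : QuasiToricRelation 𝒜} (h : R.Equivalent R') :
    R.mapS = R'.mapS ∧ R.mapC = R'.mapC := by
  obtain ⟨l, lf, lg, lh, hF, h0, h1, h2, hfh, hgh, hfg⟩ := h
  have hl : l ≠ 0 := by
    rintro rfl
    exact R.F_ne_zero 0 (by rw [hF 0, C_0, zero_mul])
  have hlh : lh ≠ 0 := by
    rintro rfl
    exact R.f_ne_zero 2 (by rw [h2, C_0, zero_mul])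
  have hP : R.lineProduct 2 = R'.lineProduct 2 := 𝒜.lineFactor_congr fun j => by
    rw [hF 2]; exact (isUnit_C hl).dvd_mul_left
  have hl' : algebraMap ℂ PlaneField l ≠ 0 := by simpa using hl
  have hlh' : algebraMap ℂ PlaneField lh ≠ 0 := by simpa using hlh
  have hx2 := R'.dehomogenize_f_ne_zero 2
  have hF2 := R'.dehomogenize_F_ne_zero 2
  rw [div_pow, div_eq_one_iff_eq (pow_ne_zero _ hlh)] at hfh
  have hfh' := congrArg (algebraMap ℂ PlaneField) hfh
  have hfg' := congrArg (algebraMap ℂ PlaneField) hfg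
  simp only [map_pow, map_mul] at hfh' hfg'
  constructor
  · rw [mapS_eq, mapS_eq, ratioS, ratioS, ratioA, ratioA, hF 0, hF 2, h0, h2]
    simp only [dehomogenize_mul, dehomogenize_C]
    congr 2
    field_simp
    rw [hfh']
    ring
  · rw [mapC_eq, mapC_eq, ratioC, ratioC, hP, h0, h1, h2]
    simp only [dehomogenize_mul, dehomogenize_C]
    rw [mul_mul_mul_comm, hfg', mul_pow, mul_div_mul_left _ _ (pow_ne_zero _ hlh')]

/-- A prime dividing two terms divides all three. Since the coefficients are coprime, it divides two
of `f`, `g`, `h`, so its cube divides the third term; squarefreeness makes it divide the third of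
`f`, `g`, `h`, against primitivity. -/
lemma isRelPrime_terms (i j : Fin 3) (hij : i ≠ j) :
    IsRelPrime (R.F i * R.f i ^ 3) (R.F j * R.f j ^ 3) := by
  have hcyc : ∀ i j : Fin 3, i ≠ j → ∃ k, k ≠ i ∧ k ≠ j ∧
      (∀ l : Fin 3, l = i ∨ l = j ∨ l = k) ∧
      R.F k * R.f k ^ 3 = -(R.F i * R.f i ^ 3 + R.F j * R.f j ^ 3) := by
    have h := R.relation
    intro i j hij
    fin_cases i <;> fin_cases j <;> first | exact absurd rfl hij | skip
    · refine ⟨2, by decide, by decide, by decide, ?_⟩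
      change _ = -(R.F 0 * R.f 0 ^ 3 + R.F 1 * R.f 1 ^ 3)
      linear_combination h
    · refine ⟨1, by decide, by decide, by decide, ?_⟩
      change _ = -(R.F 0 * R.f 0 ^ 3 + R.F 2 * R.f 2 ^ 3)
      linear_combination h
    · refine ⟨2, by decide, by decide, by decide, ?_⟩
      change _ = -(R.F 1 * R.f 1 ^ 3 + R.F 0 * R.f 0 ^ 3)
      linear_combination h
    · refine ⟨0, by decide, by decide, by decide, ?_⟩
      change _ = -(R.F 1 * R.f 1 ^ 3 + R.F 2 * R.f 2 ^ 3)
      linear_combination h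
    · refine ⟨1, by decide, by decide, by decide, ?_⟩
      change _ = -(R.F 2 * R.f 2 ^ 3 + R.F 0 * R.f 0 ^ 3)
      linear_combination h
    · refine ⟨0, by decide, by decide, by decide, ?_⟩
      change _ = -(R.F 2 * R.f 2 ^ 3 + R.F 1 * R.f 1 ^ 3)
      linear_combination h
  refine (UniqueFactorizationMonoid.isRelPrime_iff_no_prime_factors (mul_ne_zero (R.F_ne_zero i)
    (pow_ne_zero _ (R.f_ne_zero i)))).mpr fun π hi hj hπ => ?_
  obtain ⟨k, hki, hkj, hall, hk⟩ := hcyc i j hij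
  have hdvd : ∀ l, π ∣ R.F l * R.f l ^ 3 := by
    intro l
    rcases hall l with rfl | rfl | rfl
    · exact hi
    · exact hj
    · rw [hk]; exact (dvd_add hi hj).neg_right
  have hor : ∀ l, π ∣ R.F l ∨ π ∣ R.f l := fun l =>
    (hπ.dvd_or_dvd (hdvd l)).imp_right hπ.dvd_of_dvd_pow
  have hcop : ∀ l m, l ≠ m → π ∣ R.F l → π ∣ R.f m := fun l m hlm hl =>
    (hor m).resolve_left fun hm => hπ.not_isUnit (R.F_coprime l m hlm hl hm)
  -- two of the three `f` are divisible by `π`, hence so is the third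
  have hthird : ∀ a b c : Fin 3, (∀ l, l = a ∨ l = b ∨ l = c) →
      R.F c * R.f c ^ 3 = -(R.F a * R.f a ^ 3 + R.F b * R.f b ^ 3) →
      π ∣ R.f a → π ∣ R.f b → False := by
    intro a b c hall hc ha hb
    have h3 : π ^ 3 ∣ R.F c * R.f c ^ 3 := by
      rw [hc]
      exact (dvd_add ((pow_dvd_pow_of_dvd ha 3).mul_left _)
        ((pow_dvd_pow_of_dvd hb 3).mul_left _)).neg_right
    have hfc := dvd_of_pow_three_dvd_squarefree_mul (R.F_squarefree c) (R.f_ne_zero c) h3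
    exact hπ.not_isUnit (R.f_primitive π fun l => by
      rcases hall l with rfl | rfl | rfl <;> assumption)
  by_cases hFk : π ∣ R.F k
  · exact hthird i j k hall hk (hcop k i hki hFk) (hcop k j hkj hFk)
  · have hfk := (hor k).resolve_left hFk
    by_cases hFi : π ∣ R.F i
    · refine hthird j k i (fun l => ?_) ?_ (hcop i j hij hFi) hfk
      · rcases hall l with h | h | h <;> simp [h]
      · linear_combination hk
    · refine hthird i k j (fun l => ?_) ?_ ((hor i).resolve_left hFi) hfk
      · rcases hall l with h | h | h <;> simp [h]
      · linear_combination hk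

lemma exists_isHomogeneous_terms :
    ∃ n, ∀ i, (R.F i * R.f i ^ 3).IsHomogeneous n := by
  choose a ha using R.F_isHomogeneous
  choose b hb using R.f_isHomogeneous
  have h := fun i => (ha i).mul ((hb i).pow 3)
  have hne : ∀ i, R.F i * R.f i ^ 3 ≠ 0 := fun i =>
    mul_ne_zero (R.F_ne_zero i) (pow_ne_zero _ (R.f_ne_zero i))
  obtain ⟨h1, h2⟩ := IsHomogeneous.eq_of_add_add_eq_zero (h 0) (h 1) (h 2) (hne 0) (hne 1) (hne 2)
    R.relation
  refine ⟨a 0 + b 0 * 3, fun i => ?_⟩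
  fin_cases i
  · exact h 0
  · exact h1 ▸ h 1
  · exact h2 ▸ h 2

lemma ratioS_eq : R.ratioS =
    -(dehomogenize (R.F 0 * R.f 0 ^ 3) / dehomogenize (R.F 2 * R.f 2 ^ 3)) := by
  rw [ratioS, ratioA, dehomogenize_mul, dehomogenize_mul, dehomogenize_pow, dehomogenize_pow,
    mul_div_mul_comm, div_pow]

variable {R} in
/-- Normalized relations that give the same map are equivalent. -/
lemma equivalent_of_map_eq [IsDomain 𝒜.CoverField] {R' : QuasiToricRelation 𝒜}
    (hR : R.IsNormalized) (hR' : R'.IsNormalized) (hS : R.mapS = R'.mapS) (hC : R.mapC = R'.mapC) :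
    R.Equivalent R' := by
  obtain ⟨n, hn⟩ := R.exists_isHomogeneous_terms
  obtain ⟨n', hn'⟩ := R'.exists_isHomogeneous_terms
  have hne : ∀ i, R.F i * R.f i ^ 3 ≠ 0 := fun i =>
    mul_ne_zero (R.F_ne_zero i) (pow_ne_zero _ (R.f_ne_zero i))
  have hne' : ∀ i, R'.F i * R'.f i ^ 3 ≠ 0 := fun i =>
    mul_ne_zero (R'.F_ne_zero i) (pow_ne_zero _ (R'.f_ne_zero i))
  have hS' : R.ratioS = R'.ratioS := 𝒜.algebraMap_injective hS
  rw [ratioS_eq, ratioS_eq, neg_inj, div_eq_div_iff (dehomogenize_ne_zero (hn 2) (hne 2))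
    (dehomogenize_ne_zero (hn' 2) (hne' 2)), ← dehomogenize_mul, ← dehomogenize_mul] at hS'
  have h02 : R.F 0 * R.f 0 ^ 3 * (R'.F 2 * R'.f 2 ^ 3) =
      R'.F 0 * R'.f 0 ^ 3 * (R.F 2 * R.f 2 ^ 3) := by
    refine eq_of_dehomogenize_eq ((hn 0).mul (hn' 2)) ?_ hS'
    rw [add_comm]
    exact (hn' 0).mul (hn 2)
  -- Both relations write `s` as a fraction in lowest terms, so the denominators agree up to a
  -- constant `u`. The relations then give the same `u` for all three terms.
  have hassoc : Associated (R.F 2 * R.f 2 ^ 3) (R'.F 2 * R'.f 2 ^ 3) :=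
    associated_of_dvd_dvd
      ((R.isRelPrime_terms 2 0 (by decide)).dvd_of_dvd_mul_left ⟨_, h02.trans (mul_comm _ _)⟩)
      ((R'.isRelPrime_terms 2 0 (by decide)).dvd_of_dvd_mul_left ⟨_, h02.symm.trans (mul_comm _ _)⟩)
  obtain ⟨u, hu, hu2⟩ := exists_C_mul_of_associated hassoc.symm
  have hu0 : R.F 0 * R.f 0 ^ 3 = C u * (R'.F 0 * R'.f 0 ^ 3) := by
    apply mul_right_cancel₀ (hne' 2)
    rw [h02, hu2]; ring
  have hu1 : R.F 1 * R.f 1 ^ 3 = C u * (R'.F 1 * R'.f 1 ^ 3) := by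
    linear_combination R.relation - C u * R'.relation - hu0 - hu2
  have hui : ∀ i, R.F i * R.f i ^ 3 = C u * (R'.F i * R'.f i ^ 3) := by
    intro i
    fin_cases i
    exacts [hu0, hu1, hu2]
  have hassoc' : ∀ i, Associated (R'.F i * R'.f i ^ 3) (R.F i * R.f i ^ 3) := fun i => by
    rw [hui i]
    exact ⟨(isUnit_C hu).unit, mul_comm _ _⟩
  have hf : ∀ i, ∃ μ : ℂ, μ ≠ 0 ∧ R.f i = C μ * R'.f i := fun i =>
    exists_C_mul_of_associated (associated_of_associated_mul_pow_three (R'.F_squarefree i)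
      (R.F_squarefree i) (R'.f_ne_zero i) (R.f_ne_zero i) (hassoc' i))
  choose μ hμ hf using hf
  have hFi : ∀ i, C (μ i ^ 3) * R.F i = C u * R'.F i := fun i => by
    apply mul_right_cancel₀ (pow_ne_zero 3 (R'.f_ne_zero i))
    have := hui i
    rw [hf i, mul_pow, ← C_pow] at this
    linear_combination this
  have hP : ∀ i, R.lineProduct i = R'.lineProduct i := fun i => 𝒜.lineFactor_congr fun j => by
    rw [← (isUnit_C (pow_ne_zero 3 (hμ i))).dvd_mul_left, hFi i, (isUnit_C hu).dvd_mul_left]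
  obtain ⟨a, ha, hF⟩ := hR
  obtain ⟨a', ha', hF'⟩ := hR'
  have hF'' : ∀ i, R.F i = C (a / a') * R'.F i := fun i => by
    rw [hF i, hF' i, hP i, ← mul_assoc, ← C_mul, div_mul_cancel₀ _ ha']
  -- Normalization makes the ratio of the coefficients the same for all `i`, so the scalars `μ i`
  -- have equal cubes.
  have hcube : ∀ i, μ i ^ 3 * (a / a') = u := fun i => by
    have := hFi i
    rw [hF'' i, ← mul_assoc, ← C_mul] at this
    exact C_injective _ _ (mul_right_cancel₀ (R'.F_ne_zero i) this)
  have hdiv : ∀ i, (μ i / μ 2) ^ 3 = 1 := fun i => by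
    rw [div_pow, div_eq_one_iff_eq (pow_ne_zero _ (hμ 2))]
    exact mul_right_cancel₀ (div_ne_zero ha ha') ((hcube i).trans (hcube 2).symm)
  refine ⟨a / a', μ 0, μ 1, μ 2, hF'', hf 0, hf 1, hf 2, hdiv 0, hdiv 1, ?_⟩
  rw [mapC_eq, mapC_eq] at hC
  -- The coordinate `c` gives the remaining condition `μ 0 * μ 1 = μ 2 ^ 2`, which the cubes alone
  -- do not determine.
  have hC' : R.ratioC = R'.ratioC :=
    𝒜.algebraMap_injective (mul_left_cancel₀ 𝒜.coverRoot_ne_zero hC)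
  rw [ratioC, ratioC, hP 2, hf 0, hf 1, hf 2] at hC'
  have hC'' := mul_left_cancel₀ (inv_ne_zero (R'.dehomogenize_lineProduct_ne_zero 2)) hC'
  simp only [dehomogenize_mul, dehomogenize_C] at hC''
  have hx0 := R'.dehomogenize_f_ne_zero 0
  have hx1 := R'.dehomogenize_f_ne_zero 1
  have hx2 := R'.dehomogenize_f_ne_zero 2
  have hμ2 : algebraMap ℂ PlaneField (μ 2) ≠ 0 := by simpa using hμ 2
  apply (algebraMap ℂ PlaneField).injective
  rw [map_mul, map_pow]
  rw [div_eq_div_iff (pow_ne_zero _ (mul_ne_zero hμ2 hx2)) (pow_ne_zero _ hx2)] at hC''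
  have hne3 : dehomogenize (R'.f 0) * dehomogenize (R'.f 1) * dehomogenize (R'.f 2) ^ 2 ≠ 0 :=
    mul_ne_zero (mul_ne_zero hx0 hx1) (pow_ne_zero _ hx2)
  apply mul_right_cancel₀ hne3
  linear_combination hC''

end QuasiToricRelation

end RelationMaps

/-! ### Cube roots of unity -/

section Omega

lemma EquianharmonicCurve.isPrimitiveRoot_omega : IsPrimitiveRoot omega 3 :=
  Complex.isPrimitiveRoot_exp 3 (by norm_num)

lemma EquianharmonicCurve.omega_sq_add_omega_add_one : omega ^ 2 + omega + 1 = 0 := by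
  have h := isPrimitiveRoot_omega.geom_sum_eq_zero (by norm_num)
  simp only [Finset.sum_range_succ, Finset.sum_range_zero] at h
  linear_combination h

/-- The cube roots of unity of an extension of `ℂ` are complex numbers. -/
lemma exists_algebraMap_eq_of_pow_three_eq_one {K : Type*} [Field K] [Algebra ℂ K] {x : K}
    (h : x ^ 3 = 1) : ∃ t : ℂ, t ^ 3 = 1 ∧ algebraMap ℂ K t = x := by
  have hp := isPrimitiveRoot_omega.map_of_injective (algebraMap ℂ K).injective
  obtain ⟨i, -, hi⟩ := hp.eq_pow_of_pow_eq_one h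
  exact ⟨omega ^ i, by rw [← pow_mul, mul_comm, pow_mul, omega_pow, one_pow], by rw [map_pow, hi]⟩

end Omega

/-! ### From points of the twisted curve to quasi-toric relations -/

namespace LineArrangement

variable {r : ℕ} (𝒜 : LineArrangement r)

lemma squarefree_prod_form : Squarefree (∏ j, 𝒜.form j) :=
  squarefree_prod_of_primes _ _ 𝒜.form_prime 𝒜.not_associated

/-- Three coprime forms with sum zero that are cubes up to lines of the arrangement, each line
occurring, are the terms of a normalized quasi-toric relation. -/
lemma exists_normalizedRelation (p f : Fin 3 → MvPolynomial (Fin 3) ℂ) {n : ℕ}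
    (hp : ∀ i, (p i).IsHomogeneous n) (hp₀ : ∀ i, p i ≠ 0)
    (hrel : ∀ i j, i ≠ j → IsRelPrime (p i) (p j)) (hsum : p 0 + p 1 + p 2 = 0)
    (hprod : ∀ j, 𝒜.form j ∣ p 0 * p 1 * p 2) (hf : ∀ i, p i = 𝒜.lineFactor (p i) * f i ^ 3) :
    ∃ R : QuasiToricRelation 𝒜, R.IsNormalized ∧ (∀ i, R.F i = 𝒜.lineFactor (p i)) ∧ R.f = f := by
  have hdvd : ∀ i, f i ∣ p i := fun i => by
    rw [hf i]; exact (dvd_pow_self _ (by norm_num)).mul_left _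
  have hf₀ : ∀ i, f i ≠ 0 := fun i h => hp₀ i (zero_dvd_iff.mp (h ▸ hdvd i))
  refine ⟨{
    F := fun i => 𝒜.lineFactor (p i)
    f := f
    F_isHomogeneous := fun i => 𝒜.lineFactor_isHomogeneous _
    F_squarefree := fun i => 𝒜.squarefree_lineFactor _
    F_coprime := fun i j hij d h1 h2 =>
      hrel i j hij (h1.trans (𝒜.lineFactor_dvd _)) (h2.trans (𝒜.lineFactor_dvd _))
    zeroSet := fun v _ => by
      rw [𝒜.lineFactor_mul_lineFactor_mul_lineFactor p hrel hprod, map_prod,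
        Finset.prod_eq_zero_iff]
      simp
    f_isHomogeneous := fun i => (hp i).of_dvd (hp₀ i) (hdvd i)
    f_ne_zero := hf₀
    f_primitive := fun d hd =>
      hrel 0 1 (by decide) ((hd 0).trans (hdvd 0)) ((hd 1).trans (hdvd 1))
    relation := by rw [← hf, ← hf, ← hf, hsum] }, ⟨1, one_ne_zero, fun i => ?_⟩, fun i => rfl, rfl⟩
  rw [QuasiToricRelation.lineProduct_eq]
  simp only [𝒜.lineFactor_lineFactor, C_1, one_mul]

/-- A rational point of the twisted curve `D c³ = s (1 - s)` over the function field of the plane,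
where `D = 0` is the equation of the arrangement, comes from three coprime forms. -/
lemma exists_forms_of_mul_pow_eq (hr : 3 ∣ r) {s c : PlaneField} (hc : c ≠ 0)
    (h : 𝒜.affineEquation * c ^ 3 = s * (1 - s)) :
    ∃ (p : Fin 3 → MvPolynomial (Fin 3) ℂ) (n : ℕ) (b : MvPolynomial (Fin 3) ℂ),
      (∀ i, (p i).IsHomogeneous n) ∧ (∀ i, p i ≠ 0) ∧
      (∀ i j, i ≠ j → IsRelPrime (p i) (p j)) ∧ p 0 + p 1 + p 2 = 0 ∧
      p 0 * p 1 * p 2 = (∏ j, 𝒜.form j) * b ^ 3 ∧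
      s = -(dehomogenize (p 0) / dehomogenize (p 2)) := by
  obtain ⟨k, rfl⟩ := hr
  -- With `r = 3k`, numerator and denominator of `s` get equal degrees, and the denominator of `c`
  -- gets degree larger by `k`. Then `D c³` has degree zero and the affine equation lifts to forms.
  obtain ⟨p, q, m, n, hp, hq, hq₀, hmn, hpq, hs⟩ := exists_eq_div s 0
  obtain ⟨g, d, a, b, hg, hd, hd₀, hab, -, hgd⟩ := exists_eq_div c k
  have hs₀ : s * (1 - s) ≠ 0 := h ▸ mul_ne_zero 𝒜.affineEquation_ne_zero (pow_ne_zero _ hc)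
  have hq' := dehomogenize_ne_zero hq hq₀
  have hd' := dehomogenize_ne_zero hd hd₀
  have hp₀ : p ≠ 0 := by
    rintro rfl
    exact left_ne_zero_of_mul hs₀ (by rw [hs, dehomogenize_zero, zero_div])
  have hpq₀ : p - q ≠ 0 := by
    intro e
    rw [sub_eq_zero] at e
    exact right_ne_zero_of_mul hs₀ (by rw [hs, e, div_self hq', sub_self])
  have hg₀ : g ≠ 0 := by
    rintro rfl
    exact hc (by rw [hgd, dehomogenize_zero, zero_div])
  obtain rfl : n = m := hmn hp₀
  obtain rfl := hab hg₀
  have e : (∏ j, 𝒜.form j) * g ^ 3 * q ^ 2 = p * (q - p) * d ^ 3 := by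
    have h1 := (𝒜.prod_form_isHomogeneous.mul (hg.pow 3)).mul (hq.pow 2)
    have h2 := (hp.mul (hq.sub hp)).mul (hd.pow 3)
    refine eq_of_dehomogenize_eq h1 ?_ ?_
    · convert h2 using 1; ring
    · rw [affineEquation, hs, hgd] at h
      simp only [dehomogenize_mul, dehomogenize_pow, dehomogenize_sub]
      field_simp at h
      linear_combination h
  have e' : (∏ j, 𝒜.form j) * (g * q) ^ 3 = p * (q - p) * q * d ^ 3 := by
    linear_combination q * e
  -- The cube of `d` divides `D (g q)³` with `D` squarefree, so `d` divides `g q`, and the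
  -- denominators disappear.
  obtain ⟨b, hb⟩ := dvd_of_pow_three_dvd_squarefree_mul 𝒜.squarefree_prod_form
    (mul_ne_zero hg₀ hq₀) ⟨_, e'.trans (mul_comm _ _)⟩
  have e'' : p * (q - p) * q = (∏ j, 𝒜.form j) * b ^ 3 := by
    apply mul_right_cancel₀ (pow_ne_zero 3 hd₀)
    rw [← e', hb]; ring
  refine ⟨![-p, p - q, q], n, b, ?_, ?_, ?_, ?_, ?_, ?_⟩
  · intro i
    fin_cases i
    exacts [hp.neg, hp.sub hq, hq]
  · intro i
    fin_cases i
    exacts [neg_ne_zero.mpr hp₀, hpq₀, hq₀]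
  · have h1 : IsRelPrime (-p) (p - q) := fun x hx hx' => hpq ((dvd_neg).mp hx)
      ((dvd_sub_right ((dvd_neg).mp hx)).mp hx')
    have h2 : IsRelPrime (-p) q := fun x hx hx' => hpq ((dvd_neg).mp hx) hx'
    have h3 : IsRelPrime (p - q) q := fun x hx hx' => hpq ((dvd_sub_left hx').mp hx) hx'
    intro i j hij
    fin_cases i <;> fin_cases j <;> first | exact absurd rfl hij | skip
    exacts [h1, h2, h1.symm, h3, h2.symm, h3.symm]
  · change -p + (p - q) + q = 0
    ring
  · change -p * (p - q) * q = _
    rw [← e'']; ring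
  · change s = -(dehomogenize (-p) / dehomogenize q)
    rw [hs, dehomogenize_neg]
    ring

end LineArrangement

namespace QuasiToricRelation

variable {r : ℕ} {𝒜 : LineArrangement r}

lemma affineEquation_mul_ratioC_pow [Nontrivial 𝒜.CoverField] {R : QuasiToricRelation 𝒜}
    (hR : R.IsNormalized) : 𝒜.affineEquation * R.ratioC ^ 3 = R.ratioS * (1 - R.ratioS) := by
  apply 𝒜.algebraMap_injective
  have h := R.mapC_pow hR
  rw [mapC_eq, mul_pow, 𝒜.coverRoot_pow, mapS_eq] at h
  rw [map_mul, map_mul, map_sub, map_one, map_pow, h]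

/-- Every rational point of the twisted curve `D c³ = s (1 - s)` over the function field of the plane
comes from a normalized quasi-toric relation. -/
lemma exists_ratio_eq [Nontrivial 𝒜.CoverField] (hr : 3 ∣ r) {s c : PlaneField} (hc : c ≠ 0)
    (h : 𝒜.affineEquation * c ^ 3 = s * (1 - s)) :
    ∃ R : QuasiToricRelation 𝒜, R.IsNormalized ∧ R.ratioS = s ∧ R.ratioC = c := by
  obtain ⟨p, n, b, hp, hp₀, hrel, hsum, hprod, hs⟩ := 𝒜.exists_forms_of_mul_pow_eq hr hc h
  have hdvd : ∀ j, 𝒜.form j ∣ p 0 * p 1 * p 2 := fun j => by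
    rw [hprod]; exact (Finset.dvd_prod_of_mem _ (Finset.mem_univ j)).mul_right _
  choose f hf using 𝒜.exists_eq_lineFactor_mul_pow p b hrel hprod
  have key : ∀ {f : Fin 3 → MvPolynomial (Fin 3) ℂ} {R : QuasiToricRelation 𝒜},
      (∀ i, p i = 𝒜.lineFactor (p i) * f i ^ 3) → (∀ i, R.F i = 𝒜.lineFactor (p i)) →
      R.f = f → R.ratioS = s := by
    intro f R hf hF hRf
    rw [ratioS_eq, hRf, hF, hF, ← hf, ← hf, hs]
  obtain ⟨R, hR, hF, rfl⟩ := 𝒜.exists_normalizedRelation p f hp hp₀ hrel hsum hdvd hf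
  have hS := key hf hF rfl
  -- The forms only know `s`, so `c` is recovered up to a cube root of unity `t`. Replacing `f` by
  -- `t⁻¹ f` corrects it without changing `f³`.
  have hC : (R.ratioC / c) ^ 3 = 1 := by
    rw [div_pow, div_eq_one_iff_eq (pow_ne_zero _ hc)]
    apply mul_left_cancel₀ 𝒜.affineEquation_ne_zero
    rw [h, affineEquation_mul_ratioC_pow hR, hS]
  obtain ⟨t, ht, htc⟩ := exists_algebraMap_eq_of_pow_three_eq_one hC
  rw [eq_div_iff hc] at htc
  have ht₀ : t ≠ 0 := by rintro rfl; norm_num at ht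
  have hf' : ∀ i, p i = 𝒜.lineFactor (p i) * (![C t⁻¹ * R.f 0, R.f 1, R.f 2] i) ^ 3 := by
    intro i
    fin_cases i
    · change p 0 = 𝒜.lineFactor (p 0) * (C t⁻¹ * R.f 0) ^ 3
      rw [mul_pow, ← C_pow, inv_pow, ht, inv_one, C_1, one_mul]
      exact hf 0
    · exact hf 1
    · exact hf 2
  obtain ⟨R', hR', hF', hRf⟩ := 𝒜.exists_normalizedRelation p _ hp hp₀ hrel hsum hdvd hf'
  refine ⟨R', hR', key hf' hF' hRf, ?_⟩
  have hP : R'.lineProduct 2 = R.lineProduct 2 := by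
    rw [lineProduct_eq, lineProduct_eq, hF, hF']
  have h0 : R'.f 0 = C t⁻¹ * R.f 0 := by rw [hRf]; rfl
  have h1 : R'.f 1 = R.f 1 := by rw [hRf]; rfl
  have h2 : R'.f 2 = R.f 2 := by rw [hRf]; rfl
  have hr : R'.ratioC = algebraMap ℂ PlaneField t⁻¹ * R.ratioC := by
    rw [ratioC, ratioC, hP, h0, h1, h2, dehomogenize_mul, dehomogenize_C]
    ring
  rw [hr, ← htc, ← mul_assoc, ← map_mul, inv_mul_cancel₀ ht₀, map_one, one_mul]

end QuasiToricRelation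

/-! ### Transcendence degree of the function field of the plane -/

section Trdeg

lemma trdeg_planeField : Algebra.trdeg ℂ PlaneField = 2 := by
  have h := trdeg_add_eq ℂ (MvPolynomial (Fin 2) ℂ) (A := PlaneField)
  have h0 : Algebra.trdeg (MvPolynomial (Fin 2) ℂ) PlaneField = 0 := by
    have := IsLocalization.isAlgebraic PlaneField (nonZeroDivisors (MvPolynomial (Fin 2) ℂ))
    exact trdeg_eq_zero
  rw [← h, h0, MvPolynomial.trdeg_of_isDomain]
  simp

end Trdeg

/-! ### The function field of the cover and its eigenfunctions -/

namespace LineArrangement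

variable {r : ℕ} (𝒜 : LineArrangement r)

lemma monic_coverPolynomial :
    (Polynomial.X ^ 3 - Polynomial.C 𝒜.affineEquation).Monic :=
  Polynomial.monic_X_pow_sub_C _ (by norm_num)

lemma irreducible_coverPolynomial [IsDomain 𝒜.CoverField] :
    Irreducible (Polynomial.X ^ 3 - Polynomial.C 𝒜.affineEquation) := by
  have h : (Ideal.span {Polynomial.X ^ 3 - Polynomial.C 𝒜.affineEquation}).IsPrime :=
    (Ideal.Quotient.isDomain_iff_prime _).mp ‹IsDomain 𝒜.CoverField›
  exact ((Ideal.span_singleton_prime 𝒜.monic_coverPolynomial.ne_zero).mp h).irreducible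

lemma trdeg_coverField_le [IsDomain 𝒜.CoverField] : Algebra.trdeg ℂ 𝒜.CoverField ≤ 2 := by
  have : Module.Finite PlaneField 𝒜.CoverField := 𝒜.monic_coverPolynomial.finite_adjoinRoot
  have : FaithfulSMul PlaneField 𝒜.CoverField :=
    (faithfulSMul_iff_algebraMap_injective _ _).mpr 𝒜.algebraMap_injective
  have h := trdeg_add_eq ℂ PlaneField (A := 𝒜.CoverField)
  rw [trdeg_planeField, trdeg_eq_zero, add_zero] at h
  exact h.ge

lemma exists_eq_add_add (k : 𝒜.CoverField) : ∃ a b c : PlaneField,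
    k = algebraMap PlaneField 𝒜.CoverField a +
      algebraMap PlaneField 𝒜.CoverField b * 𝒜.coverRoot +
      algebraMap PlaneField 𝒜.CoverField c * 𝒜.coverRoot ^ 2 := by
  obtain ⟨p, rfl⟩ := AdjoinRoot.mk_surjective k
  set f := Polynomial.X ^ 3 - Polynomial.C 𝒜.affineEquation with hf
  have hdeg : (p %ₘ f).natDegree < 3 := by
    have h := Polynomial.natDegree_modByMonic_lt p 𝒜.monic_coverPolynomial fun h => by
      have := congrArg Polynomial.natDegree h
      rw [Polynomial.natDegree_X_pow_sub_C, Polynomial.natDegree_one] at this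
      norm_num at this
    rwa [Polynomial.natDegree_X_pow_sub_C] at h
  have hp : AdjoinRoot.mk f p = AdjoinRoot.mk f (p %ₘ f) := by
    conv_lhs => rw [← Polynomial.modByMonic_add_div p f]
    rw [map_add, map_mul, AdjoinRoot.mk_self, zero_mul, add_zero]
  refine ⟨(p %ₘ f).coeff 0, (p %ₘ f).coeff 1, (p %ₘ f).coeff 2, ?_⟩
  rw [hp]
  conv_lhs => rw [Polynomial.as_sum_range' _ 3 hdeg]
  simp only [Finset.sum_range_succ, Finset.sum_range_zero, zero_add, map_add,
    ← Polynomial.C_mul_X_pow_eq_monomial, map_mul, map_pow, AdjoinRoot.mk_X, AdjoinRoot.mk_C,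
    pow_zero, mul_one, pow_one]
  rfl

/-- The action of the generator of the group of deck transformations is one over `ℂ`. -/
noncomputable def coverDeckAlgHom : 𝒜.CoverField →ₐ[ℂ] 𝒜.CoverField where
  toRingHom := 𝒜.coverDeck
  commutes' a := by
    change 𝒜.coverDeck (algebraMap ℂ 𝒜.CoverField a) = algebraMap ℂ 𝒜.CoverField a
    rw [IsScalarTower.algebraMap_apply ℂ PlaneField 𝒜.CoverField, coverDeck_algebraMap]

lemma coverDeck_algebraMap_complex (a : ℂ) :
    𝒜.coverDeck (algebraMap ℂ 𝒜.CoverField a) = algebraMap ℂ 𝒜.CoverField a :=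
  𝒜.coverDeckAlgHom.commutes a

lemma coverDeck_add_add (a b c : PlaneField) :
    𝒜.coverDeck (algebraMap PlaneField 𝒜.CoverField a +
      algebraMap PlaneField 𝒜.CoverField b * 𝒜.coverRoot +
      algebraMap PlaneField 𝒜.CoverField c * 𝒜.coverRoot ^ 2) =
    algebraMap PlaneField 𝒜.CoverField a +
      algebraMap PlaneField 𝒜.CoverField b * (algebraMap ℂ 𝒜.CoverField omega * 𝒜.coverRoot) +
      algebraMap PlaneField 𝒜.CoverField c *
        (algebraMap ℂ 𝒜.CoverField omega * 𝒜.coverRoot) ^ 2 := by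
  simp only [map_add, map_mul, map_pow, coverDeck_algebraMap, coverDeck_coverRoot]

lemma three_ne_zero_coverField [Nontrivial 𝒜.CoverField] : (3 : 𝒜.CoverField) ≠ 0 := by
  have h := (algebraMap ℂ 𝒜.CoverField).injective.ne (three_ne_zero : (3 : ℂ) ≠ 0)
  rwa [map_ofNat, map_zero] at h

lemma algebraMap_omega_sq_add :
    algebraMap ℂ 𝒜.CoverField omega ^ 2 + algebraMap ℂ 𝒜.CoverField omega + 1 = 0 := by
  rw [← map_pow, ← map_add, ← map_one (algebraMap ℂ 𝒜.CoverField), ← map_add,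
    omega_sq_add_omega_add_one, map_zero]

/-- The functions invariant under the deck transformations are those of the plane. -/
lemma exists_eq_algebraMap_of_coverDeck_eq [IsDomain 𝒜.CoverField] {k : 𝒜.CoverField}
    (h : 𝒜.coverDeck k = k) : ∃ a, k = algebraMap PlaneField 𝒜.CoverField a := by
  obtain ⟨a, b, c, hk⟩ := 𝒜.exists_eq_add_add k
  have h1 := h
  rw [hk, coverDeck_add_add] at h1
  have h2 := congrArg 𝒜.coverDeck h1
  rw [coverDeck_add_add] at h2
  simp only [map_add, map_mul, map_pow, coverDeck_algebraMap, coverDeck_coverRoot,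
    coverDeck_algebraMap_complex] at h2
  -- For invariant `k`, the sum over its orbit is `3k`; the terms in `z` and `z²` cancel in this sum
  -- because `1 + ω + ω² = 0`, and `3a` remains.
  refine ⟨a, mul_left_cancel₀ 𝒜.three_ne_zero_coverField ?_⟩
  have hw := 𝒜.algebraMap_omega_sq_add
  generalize algebraMap ℂ 𝒜.CoverField omega = w at *
  rw [hk]
  generalize 𝒜.coverRoot = z at *
  generalize algebraMap PlaneField 𝒜.CoverField a = a at *
  generalize algebraMap PlaneField 𝒜.CoverField b = b at *
  generalize algebraMap PlaneField 𝒜.CoverField c = c at *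
  linear_combination -2 * h1 - h2 + (b * z + c * z ^ 2 * (w ^ 2 - w + 1)) * hw

/-- The functions that the deck transformation multiplies by `ω`. -/
lemma exists_eq_coverRoot_mul_of_coverDeck_eq [IsDomain 𝒜.CoverField] {k : 𝒜.CoverField}
    (h : 𝒜.coverDeck k = algebraMap ℂ 𝒜.CoverField omega * k) :
    ∃ a, k = 𝒜.coverRoot * algebraMap PlaneField 𝒜.CoverField a := by
  have hz := 𝒜.coverRoot_ne_zero
  have hw := 𝒜.algebraMap_omega_sq_add
  -- Multiplying by `z²` makes the eigenvalue `ω³ = 1`.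
  have h1 : 𝒜.coverDeck (𝒜.coverRoot ^ 2 * k) = 𝒜.coverRoot ^ 2 * k := by
    rw [map_mul, map_pow, h, coverDeck_coverRoot]
    linear_combination (algebraMap ℂ 𝒜.CoverField omega - 1) * 𝒜.coverRoot ^ 2 * k * hw
  obtain ⟨d, hd⟩ := 𝒜.exists_eq_algebraMap_of_coverDeck_eq h1
  refine ⟨d / 𝒜.affineEquation, mul_left_cancel₀ (pow_ne_zero 2 hz) ?_⟩
  rw [hd, ← mul_assoc, ← pow_succ, coverRoot_pow, ← map_mul,
    mul_div_cancel₀ _ 𝒜.affineEquation_ne_zero]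

lemma coverDeck_ne_self [IsDomain 𝒜.CoverField] {k : 𝒜.CoverField} (hk : k ≠ 0) :
    algebraMap ℂ 𝒜.CoverField omega * k ≠ k := fun h => by
  have h1 : algebraMap ℂ 𝒜.CoverField omega = 1 :=
    mul_right_cancel₀ hk (h.trans (one_mul k).symm)
  have hw := 𝒜.algebraMap_omega_sq_add
  rw [h1] at hw
  exact 𝒜.three_ne_zero_coverField (by linear_combination hw)

end LineArrangement

/-! ### Affine points and constant points of the curve -/

namespace EquianharmonicCurve

lemma mul_pow_eq_of_pow_eq {R : Type*} [CommRing R] {s c t : R} (h : c ^ 3 = s * (1 - s)) (ht : t ^ 3 = 1) :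
    (t * c) ^ 3 = s * (1 - s) := by
  rw [mul_pow, ht, one_mul, h]

variable {R : Type} [CommRing R] [Algebra ℂ R]

lemma algebraMap_omega_pow : algebraMap ℂ R omega ^ 3 = 1 := by
  rw [← map_pow, omega_pow, map_one]

lemma affinePoint_deck {s c : R} (h : c ^ 3 = s * (1 - s)) :
    affinePoint s c h ≫ EquianharmonicCurve.deck =
      affinePoint s (algebraMap ℂ R omega * c) (mul_pow_eq_of_pow_eq h algebraMap_omega_pow) := by
  have h' := mul_pow_eq_of_pow_eq h (algebraMap_omega_pow (R := R))
  rw [affinePoint_eq_point, affinePoint_eq_point]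
  exact point_deck ![s, c, 1] _ _ (by simpa using h') ⟨2, isUnit_one⟩

lemma SpecMap_affinePoint {S : Type} [CommRing S] [Algebra ℂ S] (φ : R →ₐ[ℂ] S) {s c : R}
    (h : c ^ 3 = s * (1 - s)) (h' : φ c ^ 3 = φ s * (1 - φ s)) :
    Spec.map (CommRingCat.ofHom φ.toRingHom) ≫ affinePoint s c h =
      affinePoint (φ s) (φ c) h' := by
  rw [affinePoint_eq_point, affinePoint_eq_point,
    SpecMap_point φ _ _ _ (by simpa using h')]
  congr 1
  ext i
  fin_cases i <;> simp

lemma affinePoint_inj {s c s' c' : R} {h : c ^ 3 = s * (1 - s)} {h' : c' ^ 3 = s' * (1 - s')} :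
    affinePoint s c h = affinePoint s' c' h' ↔ s = s' ∧ c = c' := by
  refine ⟨fun e => ?_, fun ⟨hs, hc⟩ => by subst hs hc; rfl⟩
  rw [affinePoint_eq_point, affinePoint_eq_point] at e
  obtain ⟨u, -, hu⟩ := mul_eq_mul_of_point_eq _ _ _ _ _ _ e
  have h2 : (1 : R) = u * 1 := hu 2
  have h0 : s' = u * s := hu 0
  have h1 : c' = u * c := hu 1
  rw [mul_one] at h2
  rw [← h2, one_mul] at h0 h1
  exact ⟨h0.symm, h1.symm⟩

/-- A point with values in a field is constant, or it is an affine point off the ramification. -/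
lemma eq_affinePoint_or_constant {K : Type} [Field K] [Algebra ℂ K] (ψ : Spec (.of K) ⟶ curve)
    (hψ : ψ ≫ curveToC = Spec.map (CommRingCat.ofHom (algebraMap ℂ K))) :
    (∃ s c h, c ≠ 0 ∧ ψ = affinePoint (R := K) s c h) ∨
      ∃ p : Spec (.of ℂ) ⟶ curve, ψ = Spec.map (CommRingCat.ofHom (algebraMap ℂ K)) ≫ p := by
  obtain ⟨v, h, hu, rfl⟩ := exists_eq_point ψ hψ
  have key : ∀ (w : Fin 3 → ℂ) (hw : w 1 ^ 3 = w 0 * w 2 * (w 2 - w 0)) (hwu : ∃ i, IsUnit (w i))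
      (u : K), u ≠ 0 → (∀ i, v i = u * algebraMap ℂ K (w i)) →
      ∃ p : Spec (.of ℂ) ⟶ curve, point (R := K) v h hu =
        Spec.map (CommRingCat.ofHom (algebraMap ℂ K)) ≫ p := by
    intro w hw hwu u hu₀ e
    have hw' : (Algebra.ofId ℂ K) (w 1) ^ 3 = (Algebra.ofId ℂ K) (w 0) * (Algebra.ofId ℂ K) (w 2) *
        ((Algebra.ofId ℂ K) (w 2) - (Algebra.ofId ℂ K) (w 0)) := by
      rw [← map_pow, hw, map_mul, map_mul, map_sub]
    refine ⟨point w hw hwu, ?_⟩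
    have h1 := SpecMap_point (Algebra.ofId ℂ K) w hw hwu hw'
    refine Eq.trans ?_ h1.symm
    exact (point_eq_of_mul_eq _ _ _ _ _ _ u (IsUnit.mk0 u hu₀) e).symm
  by_cases hv1 : v 1 = 0
  -- With `c = 0` the equation leaves only the ramification points `[0 : 0 : 1]`, `[1 : 0 : 0]` and
  -- `[1 : 0 : 1]`, which are defined over `ℂ`.
  · right
    rw [hv1, zero_pow (by norm_num), eq_comm, mul_eq_zero, mul_eq_zero, sub_eq_zero] at h
    have hne : v 0 ≠ 0 ∨ v 2 ≠ 0 := by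
      obtain ⟨i, hi⟩ := hu
      fin_cases i
      · exact .inl hi.ne_zero
      · exact absurd hv1 hi.ne_zero
      · exact .inr hi.ne_zero
    rcases h with (h0 | h2) | h02
    · refine key ![0, 0, 1] (by simp) ⟨2, isUnit_one⟩ (v 2) (hne.resolve_left (· h0)) fun i => ?_
      fin_cases i <;> simp [h0, hv1]
    · refine key ![1, 0, 0] (by simp) ⟨0, isUnit_one⟩ (v 0) (hne.resolve_right (· h2)) fun i => ?_
      fin_cases i <;> simp [h2, hv1]
    · refine key ![1, 0, 1] (by simp) ⟨0, isUnit_one⟩ (v 0) (hne.elim id (h02 ▸ ·)) fun i => ?_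
      fin_cases i <;> simp [h02, hv1]
  · left
    have hv2 : v 2 ≠ 0 := fun h2 => hv1 (by
      rw [h2, mul_zero, zero_mul] at h
      exact pow_eq_zero_iff (three_ne_zero) |>.mp h)
    have h' : (v 1 / v 2) ^ 3 = v 0 / v 2 * (1 - v 0 / v 2) := by
      field_simp
      linear_combination h
    refine ⟨v 0 / v 2, v 1 / v 2, h', div_ne_zero hv1 hv2, ?_⟩
    rw [affinePoint_eq_point]
    refine point_eq_of_mul_eq _ _ _ _ _ _ (v 2)⁻¹ (IsUnit.mk0 _ (inv_ne_zero hv2)) fun i => ?_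
    fin_cases i <;> simp [div_eq_inv_mul, hv2]

end EquianharmonicCurve

/-! ### Equivariant morphisms from a model, and the bijection -/

namespace NonsingularModel

variable {r : ℕ} {𝒜 : LineArrangement r} (M : NonsingularModel 𝒜)

-- The irreducibility of `z³ - D` comes with the model: the function field of an integral scheme is
-- a field.
include M in
lemma isDomain_coverField : IsDomain 𝒜.CoverField :=
  M.functionFieldIso.commRingCatIsoToRingEquiv.symm.toMulEquiv.isDomain M.X.functionField

lemma generic_toC :
    M.generic ≫ M.toC = Spec.map (CommRingCat.ofHom (algebraMap ℂ 𝒜.CoverField)) :=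
  M.functionFieldIso_toC

lemma generic_deck :
    M.generic ≫ M.deck.hom = Spec.map (CommRingCat.ofHom 𝒜.coverDeck) ≫ M.generic :=
  M.deck_generic

variable {M} in
/-- A morphism to the curve is determined by its value at the generic point. -/
lemma hom_ext_of_generic {φ ψ : M.X ⟶ curve} (h : M.generic ≫ φ = M.generic ≫ ψ) : φ = ψ := by
  refine hom_ext_of_genericPoint ?_
  rwa [generic, Category.assoc, Category.assoc, cancel_epi] at h

lemma exists_hom {s c : 𝒜.CoverField} (h : c ^ 3 = s * (1 - s)) :
    ∃ φ : M.X ⟶ curve, M.generic ≫ φ = affinePoint s c h ∧ φ ≫ curveToC = M.toC :=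
  have := M.isDomain_coverField
  have := M.isProper
  exists_hom_of_affinePoint M.toC M.nonsingular M.functionFieldIso M.functionFieldIso_toC
    𝒜.trdeg_coverField_le s c h

variable {M}

lemma generic_deck_comp {φ : M.X ⟶ curve} {s c : 𝒜.CoverField} {h : c ^ 3 = s * (1 - s)}
    (hφ : M.generic ≫ φ = affinePoint s c h) :
    M.generic ≫ M.deck.hom ≫ φ = affinePoint (𝒜.coverDeck s) (𝒜.coverDeck c)
      (by rw [← map_pow, h, map_mul, map_sub, map_one]) := by
  rw [← Category.assoc, generic_deck, Category.assoc, hφ]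
  exact SpecMap_affinePoint 𝒜.coverDeckAlgHom h _

/-- Equivariance of a morphism, in terms of its coordinates at the generic point. -/
lemma deck_comp_eq_iff {φ : M.X ⟶ curve} {s c : 𝒜.CoverField} {h : c ^ 3 = s * (1 - s)}
    (hφ : M.generic ≫ φ = affinePoint s c h) :
    M.deck.hom ≫ φ = φ ≫ EquianharmonicCurve.deck ↔
      𝒜.coverDeck s = s ∧ 𝒜.coverDeck c = algebraMap ℂ 𝒜.CoverField omega * c := by
  have h1 : M.generic ≫ φ ≫ EquianharmonicCurve.deck =
      affinePoint s (algebraMap ℂ 𝒜.CoverField omega * c)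
        (mul_pow_eq_of_pow_eq h algebraMap_omega_pow) := by
    rw [← Category.assoc, hφ, affinePoint_deck]
  have h2 := generic_deck_comp hφ
  constructor
  · intro e
    rw [e, h1, eq_comm] at h2
    exact affinePoint_inj.mp h2
  · intro e
    exact hom_ext_of_generic (h2.trans ((affinePoint_inj.mpr e).trans h1.symm))

/-- A constant map is unchanged by the deck transformation of the source, so equivariance would give
`ωc = c`, impossible for `c ≠ 0`. -/
lemma not_isConstant {φ : M.X ⟶ curve} {s c : 𝒜.CoverField} {h : c ^ 3 = s * (1 - s)}
    (hc : c ≠ 0) (hφ : M.generic ≫ φ = affinePoint s c h)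
    (he : M.deck.hom ≫ φ = φ ≫ EquianharmonicCurve.deck) : ¬ M.IsConstant φ := by
  rintro ⟨p, rfl⟩
  have := M.isDomain_coverField
  have h1 := generic_deck_comp hφ
  rw [← Category.assoc M.deck.hom, M.deck_toC, hφ, affinePoint_inj,
    ((deck_comp_eq_iff hφ).mp he).2] at h1
  exact 𝒜.coverDeck_ne_self hc h1.2.symm

lemma exists_generic_comp_eq {φ : M.X ⟶ curve} (hφ : φ ≫ curveToC = M.toC)
    (hc : ¬ M.IsConstant φ) : ∃ s c h, c ≠ 0 ∧ M.generic ≫ φ = affinePoint s c h := by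
  have := M.isDomain_coverField
  have : Fact (Irreducible (Polynomial.X ^ 3 - Polynomial.C 𝒜.affineEquation)) :=
    ⟨𝒜.irreducible_coverPolynomial⟩
  rcases eq_affinePoint_or_constant (K := 𝒜.CoverField) (M.generic ≫ φ) (by
    rw [Category.assoc, hφ, generic_toC]) with h | ⟨p, hp⟩
  · exact h
  · refine absurd ⟨p, hom_ext_of_generic ?_⟩ hc
    rw [← Category.assoc, generic_toC]
    exact hp

variable (M)

lemma exists_equivariantMap (R : NormalizedRelation 𝒜) :
    ∃ φ : M.EquivariantMap, M.generic ≫ φ.1 = affinePoint R.1.mapS R.1.mapC (R.1.mapC_pow R.2) := by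
  have := M.isDomain_coverField
  obtain ⟨φ, hφ, hC⟩ := M.exists_hom (R.1.mapC_pow R.2)
  have he := (deck_comp_eq_iff hφ).mpr ⟨R.1.coverDeck_mapS, R.1.coverDeck_mapC⟩
  exact ⟨⟨φ, hC, he, not_isConstant R.1.mapC_ne_zero hφ he⟩, hφ⟩

/-- The equivariant map of a normalized quasi-toric relation. -/
noncomputable def equivariantMap (R : NormalizedRelation 𝒜) : M.EquivariantMap :=
  (M.exists_equivariantMap R).choose

lemma generic_equivariantMap (R : NormalizedRelation 𝒜) :
    M.generic ≫ (M.equivariantMap R).1 = affinePoint R.1.mapS R.1.mapC (R.1.mapC_pow R.2) :=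
  (M.exists_equivariantMap R).choose_spec

lemma equivariantMap_eq_iff (R R' : NormalizedRelation 𝒜) :
    M.equivariantMap R = M.equivariantMap R' ↔ R.1.Equivalent R'.1 := by
  have := M.isDomain_coverField
  have h1 : M.equivariantMap R = M.equivariantMap R' ↔
      M.generic ≫ (M.equivariantMap R).1 = M.generic ≫ (M.equivariantMap R').1 :=
    ⟨fun e => by rw [e], fun e => Subtype.ext (hom_ext_of_generic e)⟩
  rw [h1, generic_equivariantMap, generic_equivariantMap, affinePoint_inj]
  exact ⟨fun h => QuasiToricRelation.equivalent_of_map_eq R.2 R'.2 h.1 h.2, fun h => h.map_eq⟩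

/-- Equivariance puts `s` in the function field of the plane and `c` in `z` times that field; the
resulting point of the twisted curve comes from a relation. -/
lemma equivariantMap_surjective (hr : 3 ∣ r) : Function.Surjective M.equivariantMap := by
  rintro ⟨φ, hC, he, hc⟩
  have := M.isDomain_coverField
  obtain ⟨s, c, h, hc₀, hφ⟩ := exists_generic_comp_eq hC hc
  obtain ⟨hs, hcω⟩ := (deck_comp_eq_iff hφ).mp he
  obtain ⟨s, rfl⟩ := 𝒜.exists_eq_algebraMap_of_coverDeck_eq hs
  obtain ⟨c, rfl⟩ := 𝒜.exists_eq_coverRoot_mul_of_coverDeck_eq hcω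
  have hc₁ : c ≠ 0 := by
    rintro rfl
    exact hc₀ (by rw [map_zero, mul_zero])
  have h' : 𝒜.affineEquation * c ^ 3 = s * (1 - s) := by
    apply 𝒜.algebraMap_injective
    rw [mul_pow, 𝒜.coverRoot_pow] at h
    rw [map_mul, map_mul, map_sub, map_one, map_pow, h]
  obtain ⟨R, hR, rfl, rfl⟩ := QuasiToricRelation.exists_ratio_eq hr hc₁ h'
  refine ⟨⟨R, hR⟩, Subtype.ext (hom_ext_of_generic ?_)⟩
  rw [generic_equivariantMap, hφ, affinePoint_inj]
  exact ⟨R.mapS_eq, R.mapC_eq⟩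

end NonsingularModel

theorem mainTheorem5 {r : ℕ} (𝒜 : LineArrangement r) (hr : 3 ∣ r) (M : NonsingularModel 𝒜) :
    (∀ R : QuasiToricRelation 𝒜, ∃ R' : NormalizedRelation 𝒜,
      ∀ i, Associated (R'.1.F i) (R.F i) ∧ R'.1.F i * R'.1.f i ^ 3 = R.F i * R.f i ^ 3) ∧
    ∃ e : Quotient (NormalizedRelation.setoid 𝒜) ≃ M.EquivariantMap,
      ∀ R : NormalizedRelation 𝒜, ∃ h : R.1.mapC ^ 3 = R.1.mapS * (1 - R.1.mapS),
        M.generic ≫ (e ⟦R⟧).1 = EquianharmonicCurve.affinePoint R.1.mapS R.1.mapC h :=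
  ⟨fun R => R.exists_normalized, Equiv.ofBijective
    (Quotient.lift M.equivariantMap fun R R' h => (M.equivariantMap_eq_iff R R').mpr h)
    ⟨fun a b => Quotient.inductionOn₂ a b fun R R' h =>
        Quotient.sound ((M.equivariantMap_eq_iff R R').mp h),
      Quotient.lift_surjective _ _ (M.equivariantMap_surjective hr)⟩,
    fun R => ⟨R.1.mapC_pow R.2, M.generic_equivariantMap R⟩⟩
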